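/- **Theorem 5.1.** *Setting.* Let $G$ be a connected Lie group with simple Lie algebra $\mathfrak g$, $\sigma\neq 1$ an involutive automorphism of $G$, and $H$ an open subgroup of $G^\sigma$ which is the stabilizer $\{g:\mathrm{Ad}(g)Z_0=Z_0\}$ of an element $Z_0\in\mathfrak g$. Let $\mathfrak g=\mathfrak h+\mathfrak q$ be the decomposition into the $\pm1$-eigenspaces of $d\sigma$, and suppose that $G/H$ is para-Hermitian: the centre of $\mathfrak h$ is $\mathbb R Z_0$, and $(\mathrm{ad}\,Z_0)^2=1$ on $\mathfrak q$. Here $G/H$ is the space of right cosets $Hg$. Let $\mathfrak q^\pm$ be the $\pm1$-eigenspaces of $\mathrm{ad}\,Z_0$ on $\mathfrak q$, $Q^\pm=\exp\mathfrak q^\pm$ and $P^\pm=HQ^\pm$. For $\xi\in\mathfrak q^-$, $\eta\in\mathfrak q^+$, $g\in G$, define $\xi\bullet g\in\mathfrak q^-$, $\eta\circ g\in\mathfrak q^+$ and $\widetilde h,\widehat h,h(\xi,\eta)\in H$ (wherever the decompositions exist) by $$\exp\xi\cdot g=\exp Y'\cdot\widetilde h\cdot\exp(\xi\bullet g),\qquad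 \exp\eta\cdot g=\exp X'\cdot\widehat h\cdot\exp(\eta\circ g),$$ $$\exp\xi\cdot\exp(-\eta)=\exp(-Y)\cdot\exp X\cdot h(\xi,\eta),$$ with $X,X'\in\mathfrak q^-$ and $Y,Y'\in\mathfrak q^+$. The point $x=Hg\in G/H$ with $g=\exp Y\exp\xi=\exp X\cdot h(\xi,\eta)\cdot\exp\eta$ is said to have horospherical coordinates $(\xi,\eta)$. Put $b(h)=\det(\mathrm{Ad}\,h|_{\mathfrak q^+})$ for $h\in H$. Let $N$ be the irreducible polynomial on $\mathfrak q^-\times\mathfrak q^+$ and $\varkappa\ge1$ the integer (the genus) with $b(h(\xi,\eta))=N(\xi,\eta)^{-\varkappa}$. For $\lambda\in\mathbb C$ put $\omega_\lambda(h)=|b(h)|^{-\lambda/\varkappa}$ and $\Phi_\lambda(\xi,\eta)=|N(\xi,\eta)|^\lambda$. Let $\mathcal C$ be the set of all subsets $s_1^{-1}Q^-Q^+s_2$ of $G$, $s_1,s_2\in G$, and $\mathcal D_\lambda(\mathcal C)$ the space of $C^\infty$ functions on $\mathcal C$ with $f(s_1^{-1}hQ^-Q^+s_2)=\omega_\lambda(h)f(s_1^{-1}Q^-Q^+s_2)$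 for $h\in H$. The representation $\widetilde R_\lambda$ of $G\times G$ on $\mathcal D_\lambda(\mathcal C)$ is $(\widetilde R_\lambda(g_1,g_2)f)(y)=f(g_1^{-1}yg_2)$. Functions in $\mathcal D_\lambda(\mathcal C)$ are regarded as functions on $G/H$ by $f(Hs)=f(s^{-1}Q^-Q^+s)$, and are written $f(\xi,\eta)$ in horospherical coordinates. *Statement.* Let $\lambda\in\mathbb C$ and $g_1,g_2\in G$. Let $(\xi,\eta)$ be such that $\xi\bullet g_2$ and $\eta\circ g_1$ are defined and both $(\xi,\eta)$ and $(\xi\bullet g_2,\eta\circ g_1)$ are the horospherical coordinates of points of $G/H$. Then $\Phi_\lambda(\xi,\eta)\neq0$, and for every $f\in\mathcal D_\lambda(\mathcal C)$ $$(\widetilde R_\lambda(g_1,g_2)f)(\xi,\eta)=\frac{\Phi_\lambda(\xi\bullet g_2,\eta\circ g_1)}{\Phi_\lambda(\xi,\eta)}\;\omega_\lambda(\widetilde h_2)\,\omega_\lambda(\widehat h_1^{-1})\,f(\xi\bullet g_2,\eta\circ g_1),$$ where $\widetilde h_2$ and $\widehat h_1$ are the factors $\widetilde h$ for $g=g_2$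 and $\widehat h$ for $g=g_1$. The same formula holds for the representation of $G\times G$ by right translations on the space of $C^\infty$ functions $F$ on $G\times G$ with $F(zh_1s_1,h_2ns_2)=\omega_\lambda(h_1^{-1}h_2)F(s_1,s_2)$ for all $z\in Q^-$, $n\in Q^+$, $h_1,h_2\in H$, $s_1,s_2\in G$ (the representation induced by the character $(zh_1,h_2n)\mapsto\omega_\lambda(h_1^{-1}h_2)$ of $P^-\times P^+$), when $F$ is regarded as the function $Hs\mapsto F(s,s)$ on $G/H$. -/

import Mathlib

open scoped Manifold ContDiff
noncomputable section
namespace ParaHermitian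

section LieGroupBasics

variable {d : ℕ} {G : Type*} [TopologicalSpace G] [ChartedSpace (EuclideanSpace ℝ (Fin d)) G]
  [Group G]

instance instLieGroupMinSmoothness [LieGroup (𝓡 d) ∞ G] :
    LieGroup (𝓡 d) (minSmoothness ℝ 3) G := by
  rw [minSmoothness_of_isRCLikeNormedField]; infer_instance

instance instFiniteDimensionalGroupLieAlgebra :
    FiniteDimensional ℝ (GroupLieAlgebra (𝓡 d) G) :=
  inferInstanceAs (FiniteDimensional ℝ (EuclideanSpace ℝ (Fin d)))

/-- The differential at the identity of a map `φ : G → G` with `φ 1 = 1`, as an endomorphism of the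
Lie algebra. -/
def diffOne (φ : G → G) : GroupLieAlgebra (𝓡 d) G →ₗ[ℝ] GroupLieAlgebra (𝓡 d) G where
  toFun X := mfderiv (𝓡 d) (𝓡 d) φ 1 X
  map_add' X Y := map_add (mfderiv (𝓡 d) (𝓡 d) φ 1) X Y
  map_smul' c X := map_smul (mfderiv (𝓡 d) (𝓡 d) φ 1) c X

/-- The adjoint representation: `Ad g` is the differential at `1` of `x ↦ g x g⁻¹`. -/
def Ad (g : G) : GroupLieAlgebra (𝓡 d) G →ₗ[ℝ] GroupLieAlgebra (𝓡 d) G :=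
  diffOne (fun x : G => g * x * g⁻¹)

open Classical in
/-- The exponential map: `lieExp X = γ 1`, where `γ : ℝ → G` is the integral curve through the
identity of the left-invariant vector field determined by `X`. -/
def lieExp (X : GroupLieAlgebra (𝓡 d) G) : G :=
  if h : ∃ γ : ℝ → G, γ 0 = 1 ∧ IsMIntegralCurve (I := 𝓡 d) γ (mulInvariantVectorField X)
  then h.choose 1 else 1

variable [LieGroup (𝓡 d) ∞ G]

theorem contMDiff_conj (g : G) : ContMDiff (𝓡 d) (𝓡 d) ∞ (fun x : G => g * x * g⁻¹) :=
  (contMDiff_mul_right (I := 𝓡 d) (n := ∞) (a := g⁻¹)).comp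
    (contMDiff_mul_left (I := 𝓡 d) (n := ∞) (a := g))

theorem mdifferentiableAt_conj (g x : G) :
    MDifferentiableAt (𝓡 d) (𝓡 d) (fun y : G => g * y * g⁻¹) x :=
  (contMDiff_conj g).mdifferentiableAt (by simp)

theorem mfderiv_conj_comp (g h x y : G) (hg : h * g = 1) (hy : y = g * x * g⁻¹) :
    ∀ v, (mfderiv (𝓡 d) (𝓡 d) (fun z : G => h * z * h⁻¹) y : _ → EuclideanSpace ℝ (Fin d))
      ((mfderiv (𝓡 d) (𝓡 d) (fun z : G => g * z * g⁻¹) x : _ → EuclideanSpace ℝ (Fin d)) v)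
      = v := by
  intro v
  have := mfderiv_comp_apply_of_eq (I := 𝓡 d) (I' := 𝓡 d) (I'' := 𝓡 d) (x := x) (y := y)
    (mdifferentiableAt_conj h y) (mdifferentiableAt_conj g x) hy.symm v
  have e : (fun z : G => h * z * h⁻¹) ∘ (fun z : G => g * z * g⁻¹) = id := by
    obtain rfl := eq_inv_of_mul_eq_one_left hg
    funext z; simp [mul_assoc]
  rw [e, mfderiv_id] at this
  exact this.symm

theorem mfderiv_conj_isInvertible (g x : G) :
    (mfderiv (𝓡 d) (𝓡 d) (fun y : G => g * y * g⁻¹) x).IsInvertible := by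
  refine ContinuousLinearMap.IsInvertible.of_inverse
    (g := (mfderiv (𝓡 d) (𝓡 d) (fun y : G => g⁻¹ * y * g⁻¹⁻¹) (g * x * g⁻¹) :
      EuclideanSpace ℝ (Fin d) →L[ℝ] EuclideanSpace ℝ (Fin d))) ?_ ?_
  · ext1 v
    exact mfderiv_conj_comp g⁻¹ g (g * x * g⁻¹) x (by simp) (by simp [mul_assoc]) v
  · ext1 v
    exact mfderiv_conj_comp g g⁻¹ x (g * x * g⁻¹) (by simp) rfl v

theorem mpullback_conj (g : G) (X : GroupLieAlgebra (𝓡 d) G) :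
    VectorField.mpullback (𝓡 d) (𝓡 d) (fun y : G => g * y * g⁻¹)
      (mulInvariantVectorField (Ad g X)) = mulInvariantVectorField X := by
  have hl : ∀ a b : G, MDifferentiableAt (𝓡 d) (𝓡 d) (fun y : G => a * y) b := fun a b =>
    (contMDiff_mul_left (I := 𝓡 d) (n := ∞) (a := a)).mdifferentiableAt (by simp)
  funext x
  refine (mfderiv_conj_isInvertible g x).inverse_apply_eq.2 ?_
  have e : (fun y : G => g * x * g⁻¹ * y) ∘ (fun y : G => g * y * g⁻¹) =
      (fun y : G => g * y * g⁻¹) ∘ (fun y : G => x * y) := by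
    funext y; simp [mul_assoc]
  have h1 := mfderiv_comp_apply_of_eq (I := 𝓡 d) (I' := 𝓡 d) (I'' := 𝓡 d) (x := (1 : G)) (y := 1)
    (hl (g * x * g⁻¹) 1) (mdifferentiableAt_conj g 1) (by simp) X
  have h2 := mfderiv_comp_apply_of_eq (I := 𝓡 d) (I' := 𝓡 d) (I'' := 𝓡 d) (x := (1 : G)) (y := x)
    (mdifferentiableAt_conj g x) (hl x 1) (by simp) X
  rw [e] at h1
  exact h1.symm.trans h2

theorem Ad_lie (g : G) (X Y : GroupLieAlgebra (𝓡 d) G) : Ad g ⁅X, Y⁆ = ⁅Ad g X, Ad g Y⁆ := by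
  have h := VectorField.mpullback_mlieBracket (I := 𝓡 d) (I' := 𝓡 d) (n := ∞) (x₀ := (1 : G))
    (f := fun y : G => g * y * g⁻¹)
    (V := mulInvariantVectorField (Ad g X)) (W := mulInvariantVectorField (Ad g Y))
    (mdifferentiableAt_mulInvariantVectorField _) (mdifferentiableAt_mulInvariantVectorField _)
    (contMDiff_conj g).contMDiffAt
    (by rw [minSmoothness_of_isRCLikeNormedField]; exact WithTop.coe_le_coe.2 le_top)
  rw [mpullback_conj, mpullback_conj] at h
  have h' := (mfderiv_conj_isInvertible g (1 : G)).inverse_apply_eq.1 h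
  have e : ∀ z : G, z = 1 → (VectorField.mlieBracket (𝓡 d) (mulInvariantVectorField (Ad g X))
      (mulInvariantVectorField (Ad g Y)) z : EuclideanSpace ℝ (Fin d)) =
      (⁅Ad g X, Ad g Y⁆ : GroupLieAlgebra (𝓡 d) G) := by
    rintro z rfl; rfl
  exact h'.symm.trans (e _ (by simp))

/-- `Ad g` commutes with the differential of an automorphism fixing `g`. -/
theorem Ad_diffOne_comm (σ : G ≃* G) (hσ : ContMDiff (𝓡 d) (𝓡 d) ∞ σ) (g : G) (hg : σ g = g)
    (X : GroupLieAlgebra (𝓡 d) G) : diffOne σ (Ad g X) = Ad g (diffOne σ X) := by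
  have hd : ∀ x, MDifferentiableAt (𝓡 d) (𝓡 d) σ x := fun x => hσ.mdifferentiableAt (by simp)
  have h1 := mfderiv_comp_apply_of_eq (I := 𝓡 d) (I' := 𝓡 d) (I'' := 𝓡 d) (x := (1 : G)) (y := 1)
    (hd 1) (mdifferentiableAt_conj g 1) (by simp) X
  have h2 := mfderiv_comp_apply_of_eq (I := 𝓡 d) (I' := 𝓡 d) (I'' := 𝓡 d) (x := (1 : G)) (y := 1)
    (mdifferentiableAt_conj g 1) (hd 1) (by simp) X
  have e : σ ∘ (fun y : G => g * y * g⁻¹) = (fun y : G => g * y * g⁻¹) ∘ σ := by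
    funext y; simp [hg]
  rw [e] at h1
  exact h1.symm.trans h2

end LieGroupBasics

/-- A para-Hermitian symmetric space `G/H`, realized as the adjoint orbit of `Z₀`, together with the
chosen normalization of `Z₀`: `G` is a Lie group with simple Lie algebra, `σ ≠ 1` is an
involutive automorphism of `G`, `H` is an open subgroup of the group of fixed points of `σ`
and is the stabilizer of `Z₀`; with `𝔥` and `𝔮` the `+1`- and `-1`-eigenspaces of `dσ`, the centre
of `𝔥` is the line `ℝ Z₀`, and `(ad Z₀)² = 1` on `𝔮`. -/
structure ParaHermitianSpace (d : ℕ) (G : Type*) [TopologicalSpace G]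
    [ChartedSpace (EuclideanSpace ℝ (Fin d)) G] [Group G] [LieGroup (𝓡 d) ∞ G] where
  /-- the Lie algebra of `G` is simple -/
  simple : LieAlgebra.IsSimple ℝ (GroupLieAlgebra (𝓡 d) G)
  /-- the involution -/
  σ : G ≃* G
  smooth_σ : ContMDiff (𝓡 d) (𝓡 d) ∞ σ
  involutive_σ : ∀ g, σ (σ g) = g
  σ_ne_one : ∃ g, σ g ≠ g
  /-- the isotropy subgroup -/
  H : Subgroup G
  /-- `H` is an open subgroup of the group of fixed points of `σ` -/
  isOpen_H : ∃ U : Set G, IsOpen U ∧ ∀ g, g ∈ H ↔ g ∈ U ∧ σ g = g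
  /-- the grading element -/
  Z₀ : GroupLieAlgebra (𝓡 d) G
  /-- `H` is the stabilizer of `Z₀` in the adjoint representation -/
  mem_H_iff : ∀ g, g ∈ H ↔ Ad g Z₀ = Z₀
  /-- the centre of `𝔥` is `ℝ Z₀` -/
  center_eq : ∀ Z, (Z ∈ Module.End.eigenspace (diffOne (d := d) σ) 1 ∧
    ∀ Y ∈ Module.End.eigenspace (diffOne (d := d) σ) 1, ⁅Z, Y⁆ = 0) ↔ ∃ c : ℝ, Z = c • Z₀
  /-- `ad Z₀` has eigenvalues `±1` on `𝔮` -/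
  sq_eq_one : ∀ X ∈ Module.End.eigenspace (diffOne (d := d) σ) (-1), ⁅Z₀, ⁅Z₀, X⁆⁆ = X

namespace ParaHermitianSpace

variable {d : ℕ} {G : Type*} [TopologicalSpace G] [ChartedSpace (EuclideanSpace ℝ (Fin d)) G]
  [Group G] [LieGroup (𝓡 d) ∞ G] (S : ParaHermitianSpace d G)

/-- `𝔮`, the `-1`-eigenspace of `dσ`. -/
def q : Submodule ℝ (GroupLieAlgebra (𝓡 d) G) :=
  Module.End.eigenspace (diffOne S.σ) (-1)

/-- `𝔮⁺`, the `+1`-eigenspace of `ad Z₀` on `𝔮`. -/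
def qPlus : Submodule ℝ (GroupLieAlgebra (𝓡 d) G) :=
  S.q ⊓ Module.End.eigenspace (LieAlgebra.ad ℝ (GroupLieAlgebra (𝓡 d) G) S.Z₀) 1

/-- `𝔮⁻`, the `-1`-eigenspace of `ad Z₀` on `𝔮`. -/
def qMinus : Submodule ℝ (GroupLieAlgebra (𝓡 d) G) :=
  S.q ⊓ Module.End.eigenspace (LieAlgebra.ad ℝ (GroupLieAlgebra (𝓡 d) G) S.Z₀) (-1)

/-- The exponential map on `𝔮⁺`. -/
def expPlus (η : S.qPlus) : G := lieExp (η : GroupLieAlgebra (𝓡 d) G)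

/-- The exponential map on `𝔮⁻`. -/
def expMinus (ξ : S.qMinus) : G := lieExp (ξ : GroupLieAlgebra (𝓡 d) G)

theorem Ad_mem_qPlus (h : S.H) : ∀ X ∈ S.qPlus, Ad (h : G) X ∈ S.qPlus := by
  rintro X ⟨hq, hX⟩
  obtain ⟨U, -, hU⟩ := S.isOpen_H
  refine ⟨?_, ?_⟩
  · have hq' := Module.End.mem_eigenspace_iff.1 hq
    refine Module.End.mem_eigenspace_iff.2 ?_
    rw [Ad_diffOne_comm S.σ S.smooth_σ _ ((hU _).1 h.2).2, hq', map_smul]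
  · have hX' := Module.End.mem_eigenspace_iff.1 hX
    refine Module.End.mem_eigenspace_iff.2 ?_
    rw [LieAlgebra.ad_apply] at hX' ⊢
    conv_lhs => rw [← (S.mem_H_iff h).1 h.2]
    rw [← Ad_lie, hX', map_smul]

/-- `b(h) = det (Ad h |_{𝔮⁺})` for `h ∈ H`. -/
def b (h : S.H) : ℝ := LinearMap.det ((Ad (h : G)).restrict (S.Ad_mem_qPlus h))

/-! ### Gauss decompositions and horospherical coordinates -/

/-- `ξ' = ξ • g` and `h = h̃`: the decomposition `exp ξ · g = exp Y · h · exp ξ'`, `Y ∈ 𝔮⁺`. -/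
def IsGauss (ξ : S.qMinus) (g : G) (h : S.H) (ξ' : S.qMinus) : Prop :=
  ∃ Y : S.qPlus, S.expMinus ξ * g = S.expPlus Y * h * S.expMinus ξ'

/-- `η' = η ∘ g` and `h = ĥ`: the decomposition `exp η · g = exp X · h · exp η'`, `X ∈ 𝔮⁻`. -/
def IsAntiGauss (η : S.qPlus) (g : G) (h : S.H) (η' : S.qPlus) : Prop :=
  ∃ X : S.qMinus, S.expPlus η * g = S.expMinus X * h * S.expPlus η'

/-- `exp ξ · exp (-η) = exp (-Y) · exp X · h`, so that `h = h(ξ, η)`. -/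
def IsRedecomp (ξ : S.qMinus) (η : S.qPlus) (Y : S.qPlus) (X : S.qMinus) (h : S.H) : Prop :=
  S.expMinus ξ * S.expPlus (-η) = S.expPlus (-Y) * S.expMinus X * h

/-- The space `G/H` of right cosets `Hg`. -/
abbrev Space : Type _ := Quotient (QuotientGroup.rightRel S.H)

/-- The point `x^0 g = Hg` of `G/H`. -/
def coset (g : G) : S.Space := Quotient.mk (QuotientGroup.rightRel S.H) g

/-- The point `x ∈ G/H` has horospherical coordinates `(ξ, η)`: `x = x^0 g` with
`g = exp Y · exp ξ = exp X · h(ξ, η) · exp η`. -/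
def HasCoords (x : S.Space) (ξ : S.qMinus) (η : S.qPlus) : Prop :=
  ∃ Y X h, S.IsRedecomp ξ η Y X h ∧ x = S.coset (S.expPlus Y * S.expMinus ξ)

/-! ### The polynomial `N`, the genus and the characters -/

/-- Polynomials on `𝔮⁻ × 𝔮⁺`, in linear coordinates. -/
abbrev Poly : Type :=
  MvPolynomial (Fin (Module.finrank ℝ S.qMinus) ⊕ Fin (Module.finrank ℝ S.qPlus)) ℝ

/-- The value of a polynomial at `(ξ, η)`. -/
def evalAt (P : S.Poly) (ξ : S.qMinus) (η : S.qPlus) : ℝ :=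
  MvPolynomial.eval (Sum.elim (fun i => (Module.finBasis ℝ S.qMinus).repr ξ i)
    (fun j => (Module.finBasis ℝ S.qPlus).repr η j)) P

/-- `b(h(ξ, η)) = P(ξ, η)^{-k}` with an irreducible polynomial `P` and an integer `k ≥ 1`. -/
def IsNormPair (P : S.Poly) (k : ℕ) : Prop :=
  Irreducible P ∧ 0 < k ∧
    ∀ ξ η Y X h, S.IsRedecomp ξ η Y X h → S.b h = (S.evalAt P ξ η ^ k)⁻¹

open Classical in
/-- The pair `(N, ϰ)` with `N` an irreducible polynomial and `b(h(ξ, η)) = N(ξ, η)^{-ϰ}`. As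
`h(ξ, η)` is defined on a dense set, unique factorization determines `ϰ`, and `N` up to sign. -/
def normPair : S.Poly × ℕ :=
  if h : ∃ p : S.Poly × ℕ, S.IsNormPair p.1 p.2 then h.choose else (1, 0)

/-- The genus `ϰ`. -/
def genus : ℕ := S.normPair.2

/-- The polynomial `N(ξ, η)`. -/
def N (ξ : S.qMinus) (η : S.qPlus) : ℝ := S.evalAt S.normPair.1 ξ η

/-- The character `ω_λ(h) = |b(h)|^{-λ/ϰ}` of `H`. -/
def omega (lam : ℂ) (h : S.H) : ℂ := ((|S.b h| : ℝ) : ℂ) ^ (-lam / (S.genus : ℂ))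

/-- `Φ_λ(ξ, η) = |N(ξ, η)|^λ`. -/
def Phi (lam : ℂ) (ξ : S.qMinus) (η : S.qPlus) : ℂ := ((|S.N ξ η| : ℝ) : ℂ) ^ lam

/-! ### The manifold of double cosets and the representation of the overgroup -/

/-- The double coset `s₁⁻¹ Q⁻ Q⁺ s₂`, where `Q^± = exp 𝔮^±`. -/
def doubleCoset (s₁ s₂ : G) : Set G :=
  {y | ∃ (ξ : S.qMinus) (η : S.qPlus), y = s₁⁻¹ * S.expMinus ξ * S.expPlus η * s₂}

/-- The set `𝒞` of all double cosets `s₁⁻¹ Q⁻ Q⁺ s₂`. -/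
def Cone : Type _ := {y : Set G // ∃ s₁ s₂ : G, y = S.doubleCoset s₁ s₂}

/-- `s₁⁻¹ Q⁻ Q⁺ s₂` as a point of `𝒞`. -/
def pt (s₁ s₂ : G) : S.Cone := ⟨S.doubleCoset s₁ s₂, s₁, s₂, rfl⟩

theorem translate_doubleCoset (g₁ g₂ s₁ s₂ : G) :
    (fun u => g₁⁻¹ * u * g₂) '' S.doubleCoset s₁ s₂ = S.doubleCoset (s₁ * g₁) (s₂ * g₂) := by
  ext u
  constructor
  · rintro ⟨_, ⟨ξ, η, rfl⟩, rfl⟩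
    exact ⟨ξ, η, by group⟩
  · rintro ⟨ξ, η, rfl⟩
    exact ⟨_, ⟨ξ, η, rfl⟩, by group⟩

/-- The translate `g₁⁻¹ y g₂` of a point `y` of `𝒞`. -/
def translate (g₁ g₂ : G) (y : S.Cone) : S.Cone :=
  ⟨(fun u => g₁⁻¹ * u * g₂) '' y.1, by
    obtain ⟨_, s₁, s₂, rfl⟩ := y
    exact ⟨_, _, S.translate_doubleCoset g₁ g₂ s₁ s₂⟩⟩

theorem translate_pt (g₁ g₂ s₁ s₂ : G) :
    S.translate g₁ g₂ (S.pt s₁ s₂) = S.pt (s₁ * g₁) (s₂ * g₂) :=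
  Subtype.ext (S.translate_doubleCoset g₁ g₂ s₁ s₂)

/-- The space `𝒟_λ(𝒞)` of functions of class `C^∞` on `𝒞` with
`f(s₁⁻¹ h Q⁻ Q⁺ s₂) = ω_λ(h) f(s₁⁻¹ Q⁻ Q⁺ s₂)` for `h ∈ H`. As `𝒞` is a homogeneous space
of `G × G`, a function on it is smooth when its pullback to `G × G` is. -/
def coneSpace (lam : ℂ) : Submodule ℂ (S.Cone → ℂ) where
  carrier := {f |
    ContMDiff ((𝓡 d).prod (𝓡 d)) 𝓘(ℝ, ℂ) ∞ (fun s : G × G => f (S.pt s.1 s.2)) ∧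
    ∀ (h : S.H) (s₁ s₂ : G),
      f (S.pt ((h : G)⁻¹ * s₁) s₂) = S.omega lam h * f (S.pt s₁ s₂)}
  add_mem' := by
    rintro f₁ f₂ ⟨h₁, k₁⟩ ⟨h₂, k₂⟩
    exact ⟨h₁.add h₂, fun h s₁ s₂ => by simp only [Pi.add_apply, k₁, k₂, mul_add]⟩
  zero_mem' := ⟨contMDiff_const, fun h s₁ s₂ => by simp⟩
  smul_mem' := by
    rintro c f ⟨hf, kf⟩
    refine ⟨?_, fun h s₁ s₂ => by simp only [Pi.smul_apply, kf, smul_eq_mul]; ring⟩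
    exact (contDiff_const.mul contDiff_id : ContDiff ℝ ∞ fun z : ℂ => c * z).contMDiff.comp hf

/-- The representation `R̃_λ` of `G × G` on `𝒟_λ(𝒞)`:
`(R̃_λ(g₁, g₂) f)(y) = f(g₁⁻¹ y g₂)`. -/
def Rtilde (lam : ℂ) : Representation ℂ (G × G) (S.coneSpace lam) where
  toFun g :=
    { toFun := fun f => ⟨fun y => f.1 (S.translate g.1 g.2 y), by
        obtain ⟨f, hf, kf⟩ := f
        refine ⟨?_, fun h s₁ s₂ => ?_⟩
        · simp only [translate_pt]
          have hg : ContMDiff ((𝓡 d).prod (𝓡 d)) ((𝓡 d).prod (𝓡 d)) ∞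
              (fun s : G × G => s * g) := contMDiff_mul_right
          exact hf.comp hg
        · simp only [translate_pt, mul_assoc, kf]⟩
      map_add' := fun _ _ => rfl
      map_smul' := fun _ _ => rfl }
  map_one' := by
    ext f y
    obtain ⟨_, s₁, s₂, rfl⟩ := y
    change f.1 (S.translate 1 1 (S.pt s₁ s₂)) = f.1 (S.pt s₁ s₂)
    simp only [translate_pt, mul_one]
  map_mul' g g' := by
    ext f y
    obtain ⟨_, s₁, s₂, rfl⟩ := y
    change f.1 (S.translate (g.1 * g'.1) (g.2 * g'.2) (S.pt s₁ s₂)) =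
      f.1 (S.translate g'.1 g'.2 (S.translate g.1 g.2 (S.pt s₁ s₂)))
    simp only [translate_pt, mul_assoc]

/-- The space of the representation of `G × G` induced (in the class `C^∞`) by the character
`(z h₁, h₂ n) ↦ ω_λ(h₁⁻¹ h₂)` of the parabolic subgroup `P⁻ × P⁺` of `G × G`, where
`z ∈ Q⁻`, `n ∈ Q⁺`, `h₁, h₂ ∈ H`. -/
def inducedSpace (lam : ℂ) : Submodule ℂ (G × G → ℂ) where
  carrier := {F |
    ContMDiff ((𝓡 d).prod (𝓡 d)) 𝓘(ℝ, ℂ) ∞ F ∧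
    ∀ (z : S.qMinus) (n : S.qPlus) (h₁ h₂ : S.H) (s₁ s₂ : G),
      F (S.expMinus z * h₁ * s₁, h₂ * S.expPlus n * s₂) =
        S.omega lam (h₁⁻¹ * h₂) * F (s₁, s₂)}
  add_mem' := by
    rintro f₁ f₂ ⟨h₁, k₁⟩ ⟨h₂, k₂⟩
    exact ⟨h₁.add h₂, fun z n a b s₁ s₂ => by simp only [Pi.add_apply, k₁, k₂, mul_add]⟩
  zero_mem' := ⟨contMDiff_const, fun z n a b s₁ s₂ => by simp⟩
  smul_mem' := by
    rintro c f ⟨hf, kf⟩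
    refine ⟨?_, fun z n a b s₁ s₂ => by simp only [Pi.smul_apply, kf, smul_eq_mul]; ring⟩
    exact (contDiff_const.mul contDiff_id : ContDiff ℝ ∞ fun z : ℂ => c * z).contMDiff.comp hf

/-- The induced representation: right translations on `inducedSpace`. -/
def inducedRep (lam : ℂ) : Representation ℂ (G × G) (S.inducedSpace lam) where
  toFun g :=
    { toFun := fun F => ⟨fun s => F.1 (s * g), by
        obtain ⟨F, hF, kF⟩ := F
        refine ⟨?_, fun z n a b s₁ s₂ => ?_⟩
        · have hg : ContMDiff ((𝓡 d).prod (𝓡 d)) ((𝓡 d).prod (𝓡 d)) ∞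
              (fun s : G × G => s * g) := contMDiff_mul_right
          exact hF.comp hg
        · have := kF z n a b (s₁ * g.1) (s₂ * g.2)
          simpa only [Prod.mk_mul_mk, mul_assoc, ← Prod.mk_mul_mk] using this⟩
      map_add' := fun _ _ => rfl
      map_smul' := fun _ _ => rfl }
  map_one' := by
    ext F s
    simp
  map_mul' g g' := by
    ext F s
    simp [mul_assoc]

end ParaHermitianSpace

end ParaHermitian

end

/-! Both formulas are one statement about functions `F` on `G × G` with the covariance of the
induced space: since `Q^±` are groups normalized by `H`, the pullback of a function on `𝒞` has that
covariance too. A point with coordinates `(ξ, η)` is represented by `s = h₀ exp Y exp ξ = h₀ exp X h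
exp η` with `h = h(ξ, η)`. Using the second form for `s g₁` and the first for `s g₂`, covariance
removes everything in front of `exp (η ∘ g₁)` and `exp (ξ • g₂)` at the cost of `ω(h)⁻¹ ω(ĥ₁)⁻¹
ω(h̃₂)`. In the same way `F (t, t)` is `ω(h')⁻¹` times the same value of `F`. Since `ω_λ(h(ξ, η)) =
Φ_λ(ξ, η)`, the formula follows (`IsCovariant.apply_mul_eq`).

That last identity requires `N` and the genus to exist; otherwise `normPair` is a default value.
Existence is the main work. The operator `Ad h(ξ, η)⁻¹` on `𝔮⁺` is the weight-one component of `exp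
(ad η) exp (-ad ξ)`, so `b(h)⁻¹` is a polynomial `D(ξ, η)`, the determinant of `bergman`. It must be
shown to be a power of an irreducible polynomial (`exists_det_bergman_eq_pow`).

`D` is an eigenvector, with polynomial eigenvalues, of two families of derivations: linear fields
`ad T` with `T` of weight zero, and quadratic fields that form a frame at the origin. Prime factors
of `D` inherit this. A prime factor `p` with `p(0) = 1` is killed by the linear fields, so its
gradient at `0` vanishes and its Hessian there is an invariant symmetric form. Such forms are
multiples of the Killing form, because the commutant of the weight-zero elements on `𝔮⁺` is `ℝ`;
this is where simplicity and the one-dimensional centre enter. The logarithmic derivatives of `p`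
along the frame have degree at most one and are read off from the Hessian. Hence those of two prime
factors are proportional, which forces the factors to be associated (`exists_eq_pow_irreducible`).

The Lie group input is `d/dt Ad (exp tX) Y = Ad (exp tX) ⁅X, Y⁆`. It makes `Ad ∘ exp` a quadratic
polynomial on `𝔮^±` and `exp` additive there. -/

namespace ParaHermitian

/-! ### The exponential map and one-parameter subgroups -/

section Exponential

variable {d : ℕ} {G : Type*} [TopologicalSpace G] [ChartedSpace (EuclideanSpace ℝ (Fin d)) G]
  [Group G] [LieGroup (𝓡 d) ∞ G]

theorem mdifferentiableAt_mul_left (g x : G) :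
    MDifferentiableAt (𝓡 d) (𝓡 d) (fun y : G => g * y) x :=
  (contMDiff_mul_left (I := 𝓡 d) (n := ∞) (a := g)).mdifferentiableAt (by simp)

theorem mdifferentiableAt_mul_right (g x : G) :
    MDifferentiableAt (𝓡 d) (𝓡 d) (fun y : G => y * g) x :=
  (contMDiff_mul_right (I := 𝓡 d) (n := ∞) (a := g)).mdifferentiableAt (by simp)

theorem contMDiff_one_mulInvariantVectorField (X : GroupLieAlgebra (𝓡 d) G) :
    ContMDiff (𝓡 d) (𝓡 d).tangent 1
      (fun g : G => (⟨g, mulInvariantVectorField X g⟩ : TangentBundle (𝓡 d) G)) := by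
  refine (contMDiff_mulInvariantVectorField (I := 𝓡 d) X).of_le ?_
  rw [minSmoothness_of_isRCLikeNormedField]
  norm_num

omit [Group G] [LieGroup (𝓡 d) ∞ G] in
/-- A smooth map carries integral curves to integral curves of a related vector field. -/
theorem isMIntegralCurveOn_comp {V W : (x : G) → TangentSpace (𝓡 d) x} {φ : G → G}
    (hφ : ∀ x, MDifferentiableAt (𝓡 d) (𝓡 d) φ x)
    (hVW : ∀ x, mfderiv (𝓡 d) (𝓡 d) φ x (V x) = W (φ x)) {γ : ℝ → G} {s : Set ℝ}
    (hγ : IsMIntegralCurveOn (I := 𝓡 d) γ V s) :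
    IsMIntegralCurveOn (I := 𝓡 d) (fun t => φ (γ t)) W s := by
  intro t ht
  have h := (hφ (γ t)).hasMFDerivAt.comp_hasMFDerivWithinAt t (hγ t ht)
  have e : ContinuousLinearMap.smulRight (1 : ℝ →L[ℝ] ℝ) (W (φ (γ t))) =
      (mfderiv (𝓡 d) (𝓡 d) φ (γ t)).comp
        (ContinuousLinearMap.smulRight (1 : ℝ →L[ℝ] ℝ) (V (γ t))) := by
    ext1
    simp [← hVW]
  rw [e]
  exact h

omit [Group G] [LieGroup (𝓡 d) ∞ G] in
theorem isMIntegralCurve_comp {V W : (x : G) → TangentSpace (𝓡 d) x} {φ : G → G}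
    (hφ : ∀ x, MDifferentiableAt (𝓡 d) (𝓡 d) φ x)
    (hVW : ∀ x, mfderiv (𝓡 d) (𝓡 d) φ x (V x) = W (φ x)) {γ : ℝ → G}
    (hγ : IsMIntegralCurve (I := 𝓡 d) γ V) :
    IsMIntegralCurve (I := 𝓡 d) (fun t => φ (γ t)) W :=
  isMIntegralCurve_iff_isMIntegralCurveOn.2
    (isMIntegralCurveOn_comp hφ hVW (isMIntegralCurve_iff_isMIntegralCurveOn.1 hγ))

theorem mfderiv_mul_left_mulInvariantVectorField (g x : G) (X : GroupLieAlgebra (𝓡 d) G) :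
    mfderiv (𝓡 d) (𝓡 d) (fun y : G => g * y) x (mulInvariantVectorField X x) =
      mulInvariantVectorField X (g * x) := by
  have h := mfderiv_comp_apply_of_eq (I := 𝓡 d) (I' := 𝓡 d) (I'' := 𝓡 d) (x := (1 : G)) (y := x)
    (mdifferentiableAt_mul_left g x) (mdifferentiableAt_mul_left x 1) (by simp) X
  have e : (fun y : G => g * y) ∘ (fun y : G => x * y) = fun y => g * x * y := by
    funext y; simp [mul_assoc]
  rw [e] at h
  exact h.symm

theorem mfderiv_hom_mulInvariantVectorField (φ : G →* G) (hφ : ContMDiff (𝓡 d) (𝓡 d) ∞ φ) (x : G)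
    (X : GroupLieAlgebra (𝓡 d) G) :
    mfderiv (𝓡 d) (𝓡 d) φ x (mulInvariantVectorField X x) =
      mulInvariantVectorField (diffOne φ X) (φ x) := by
  have hd : ∀ x, MDifferentiableAt (𝓡 d) (𝓡 d) φ x := fun x => hφ.mdifferentiableAt (by simp)
  have h1 := mfderiv_comp_apply_of_eq (I := 𝓡 d) (I' := 𝓡 d) (I'' := 𝓡 d) (x := (1 : G)) (y := x)
    (hd x) (mdifferentiableAt_mul_left x 1) (by simp) X
  have h2 := mfderiv_comp_apply_of_eq (I := 𝓡 d) (I' := 𝓡 d) (I'' := 𝓡 d) (x := (1 : G)) (y := 1)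
    (mdifferentiableAt_mul_left (φ x) 1) (hd 1) (by simp) X
  have e : φ ∘ (fun y : G => x * y) = (fun y : G => φ x * y) ∘ φ := by
    funext y; simp
  rw [e] at h1
  exact h1.symm.trans h2

theorem mfderiv_conj_mulInvariantVectorField (g x : G) (X : GroupLieAlgebra (𝓡 d) G) :
    mfderiv (𝓡 d) (𝓡 d) (fun y : G => g * y * g⁻¹) x (mulInvariantVectorField X x) =
      mulInvariantVectorField (Ad g X) (g * x * g⁻¹) :=
  mfderiv_hom_mulInvariantVectorField (MulAut.conj g).toMonoidHom (contMDiff_conj g) x X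

theorem Ad_mul (g h : G) (X : GroupLieAlgebra (𝓡 d) G) : Ad (g * h) X = Ad g (Ad h X) := by
  have h1 := mfderiv_comp_apply_of_eq (I := 𝓡 d) (I' := 𝓡 d) (I'' := 𝓡 d) (x := (1 : G)) (y := 1)
    (mdifferentiableAt_conj g 1) (mdifferentiableAt_conj h 1) (by simp) X
  have e : (fun y : G => g * y * g⁻¹) ∘ (fun y : G => h * y * h⁻¹) =
      fun y : G => g * h * y * (g * h)⁻¹ := by
    funext y; simp [mul_assoc]
  rw [e] at h1
  exact h1

omit [LieGroup (𝓡 d) ∞ G] in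
theorem Ad_one (X : GroupLieAlgebra (𝓡 d) G) : Ad (1 : G) X = X := by
  have e : (fun y : G => 1 * y * 1⁻¹) = id := by funext y; simp
  change mfderiv (𝓡 d) (𝓡 d) (fun y : G => 1 * y * 1⁻¹) 1 X = X
  rw [e, mfderiv_id]
  rfl

/-- Left translation carries the local solution through `1` to a solution through any point with the
same lifetime `ε`, and a uniform lifetime makes solutions global. -/
theorem exists_isMIntegralCurve_mulInvariantVectorField [T2Space G]
    (X : GroupLieAlgebra (𝓡 d) G) :
    ∃ γ : ℝ → G, γ 0 = 1 ∧ IsMIntegralCurve (I := 𝓡 d) γ (mulInvariantVectorField X) := by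
  have : IsManifold (𝓡 d) 1 G := IsManifold.of_le (n := ∞) (by simp)
  obtain ⟨γ, hγ0, hγ⟩ := exists_isMIntegralCurveAt_of_contMDiffAt_boundaryless (I := 𝓡 d) (0 : ℝ)
    (contMDiff_one_mulInvariantVectorField X).contMDiffAt (x₀ := (1 : G))
  obtain ⟨ε, hε, hγ⟩ := isMIntegralCurveAt_iff'.1 hγ
  refine exists_isMIntegralCurve_of_isMIntegralCurveOn (I := 𝓡 d)
    (contMDiff_one_mulInvariantVectorField X) hε (fun x => ⟨fun t => x * γ t, by simp [hγ0], ?_⟩) 1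
  rw [Real.ball_eq_Ioo, zero_sub, zero_add] at hγ
  exact isMIntegralCurveOn_comp (mdifferentiableAt_mul_left x)
    (fun y => mfderiv_mul_left_mulInvariantVectorField x y X) hγ

theorem integralCurve_unique [T2Space G] {X : GroupLieAlgebra (𝓡 d) G} {γ γ' : ℝ → G}
    (hγ : IsMIntegralCurve (I := 𝓡 d) γ (mulInvariantVectorField X))
    (hγ' : IsMIntegralCurve (I := 𝓡 d) γ' (mulInvariantVectorField X)) (h : γ 0 = γ' 0) :
    γ = γ' := by
  have : IsManifold (𝓡 d) 1 G := IsManifold.of_le (n := ∞) (by simp)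
  exact isMIntegralCurve_Ioo_eq_of_contMDiff_boundaryless (I := 𝓡 d) (t₀ := 0)
    (contMDiff_one_mulInvariantVectorField X) hγ hγ' h

theorem lieExp_eq [T2Space G] {X : GroupLieAlgebra (𝓡 d) G} {γ : ℝ → G} (h0 : γ 0 = 1)
    (hγ : IsMIntegralCurve (I := 𝓡 d) γ (mulInvariantVectorField X)) : lieExp X = γ 1 := by
  have h : ∃ γ : ℝ → G, γ 0 = 1 ∧ IsMIntegralCurve (I := 𝓡 d) γ (mulInvariantVectorField X) :=
    ⟨γ, h0, hγ⟩
  rw [lieExp, dif_pos h, integralCurve_unique h.choose_spec.2 hγ (h.choose_spec.1.trans h0.symm)]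

theorem lieExp_smul_eq [T2Space G] {X : GroupLieAlgebra (𝓡 d) G} {γ : ℝ → G} (h0 : γ 0 = 1)
    (hγ : IsMIntegralCurve (I := 𝓡 d) γ (mulInvariantVectorField X)) (t : ℝ) :
    lieExp (t • X) = γ t := by
  have h := hγ.comp_mul t
  rw [← mulInvariantVectorField_smul] at h
  rw [lieExp_eq (by simpa using h0) h]
  simp

theorem isMIntegralCurve_lieExp [T2Space G] (X : GroupLieAlgebra (𝓡 d) G) :
    IsMIntegralCurve (I := 𝓡 d) (fun t : ℝ => (lieExp (t • X) : G))
      (mulInvariantVectorField X) := by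
  obtain ⟨γ, h0, hγ⟩ := exists_isMIntegralCurve_mulInvariantVectorField X
  rwa [funext (lieExp_smul_eq h0 hγ)]

@[simp]
theorem lieExp_zero [T2Space G] : (lieExp (0 : GroupLieAlgebra (𝓡 d) G) : G) = 1 := by
  obtain ⟨γ, h0, hγ⟩ := exists_isMIntegralCurve_mulInvariantVectorField
    (0 : GroupLieAlgebra (𝓡 d) G)
  rw [← zero_smul ℝ (0 : GroupLieAlgebra (𝓡 d) G), lieExp_smul_eq h0 hγ, h0]

/-- As functions of `t` both sides are integral curves of the same left-invariant field, and they
agree at `t = 0`. -/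
theorem lieExp_add_smul [T2Space G] (X : GroupLieAlgebra (𝓡 d) G) (s t : ℝ) :
    (lieExp ((s + t) • X) : G) = lieExp (s • X) * lieExp (t • X) := by
  have h1 := isMIntegralCurve_comp (mdifferentiableAt_mul_left (lieExp (s • X)))
    (fun y => mfderiv_mul_left_mulInvariantVectorField (lieExp (s • X)) y X)
    (isMIntegralCurve_lieExp X)
  have h2 := (isMIntegralCurve_lieExp X).comp_add s
  have h3 := congrFun (integralCurve_unique h2 h1 (by simp)) t
  simpa [add_comm] using h3

theorem lieExp_neg [T2Space G] (X : GroupLieAlgebra (𝓡 d) G) :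
    (lieExp (-X) : G) = (lieExp X)⁻¹ := by
  have h := lieExp_add_smul (G := G) X (-1) 1
  rw [neg_add_cancel, zero_smul, lieExp_zero, one_smul, neg_one_smul] at h
  exact eq_inv_of_mul_eq_one_left h.symm

theorem conj_lieExp [T2Space G] (g : G) (X : GroupLieAlgebra (𝓡 d) G) :
    g * lieExp X * g⁻¹ = lieExp (Ad g X) := by
  have h := isMIntegralCurve_comp (mdifferentiableAt_conj g)
    (fun y => mfderiv_conj_mulInvariantVectorField g y X) (isMIntegralCurve_lieExp X)
  rw [lieExp_eq (by simp) h, one_smul]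

end Exponential

end ParaHermitian

/-! ### The derivative of `Ad` along a one-parameter subgroup -/

namespace ParaHermitian

section AdDerivative

open Filter Topology

/-- `M` plays the role of a group law near its unit `x₀`. By `hA`, the right translate of `A a` by
`a` is the left translate of `Y`, so `A` is `a ↦ Ad a Y`. Differentiating at `x₀` gives `A' X + D²M
(0, X) (Y, 0) = D²M (X, 0) (0, Y)`, and the symmetry of `D²M` turns this into the bracket of the
left-invariant fields of `X` and `Y`. -/
theorem hasFDerivAt_of_local_group {E : Type*} [NormedAddCommGroup E] [NormedSpace ℝ E]
    [CompleteSpace E] {M : E × E → E} {x₀ : E} (hM : ContDiffAt ℝ 2 M (x₀, x₀))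
    (h1 : ∀ᶠ a in 𝓝 x₀, M (a, x₀) = a) (h2 : ∀ᶠ a in 𝓝 x₀, M (x₀, a) = a)
    {A : E → E} {Y : E}
    (hA : ∀ᶠ a in 𝓝 x₀, fderiv ℝ M (x₀, a) (A a, 0) = fderiv ℝ M (a, x₀) (0, Y)) :
    ∃ A' : E →L[ℝ] E, HasFDerivAt A A' x₀ ∧ ∀ X, A' X =
      fderiv ℝ (fun a => fderiv ℝ M (a, x₀) (0, Y)) x₀ X -
        fderiv ℝ (fun a => fderiv ℝ M (a, x₀) (0, X)) x₀ Y := by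
  have hd : DifferentiableAt ℝ M (x₀, x₀) := hM.differentiableAt (by simp)
  have hd2 : HasFDerivAt (fderiv ℝ M) (fderiv ℝ (fderiv ℝ M) (x₀, x₀)) (x₀, x₀) :=
    ((hM.fderiv_right (m := 1) (by norm_num)).differentiableAt (by simp)).hasFDerivAt
  set D2 := fderiv ℝ (fderiv ℝ M) (x₀, x₀) with hD2
  have hsymm : ∀ v w, D2 v w = D2 w v := fun v w =>
    (hM.isSymmSndFDerivAt (by simp)).eq v w
  have hr : HasFDerivAt (fun a : E => ((a, x₀) : E × E)) (ContinuousLinearMap.inl ℝ E E) x₀ :=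
    hasFDerivAt_prodMk_left x₀ x₀
  have hl : HasFDerivAt (fun a : E => ((x₀, a) : E × E)) (ContinuousLinearMap.inr ℝ E E) x₀ :=
    hasFDerivAt_prodMk_right x₀ x₀
  have hinl : (fderiv ℝ M (x₀, x₀)).comp (ContinuousLinearMap.inl ℝ E E) =
      ContinuousLinearMap.id ℝ E :=
    (HasFDerivAt.comp (f := fun a : E => ((a, x₀) : E × E)) x₀ hd.hasFDerivAt hr).unique
      ((hasFDerivAt_id x₀).congr_of_eventuallyEq h1)
  have hinr : (fderiv ℝ M (x₀, x₀)).comp (ContinuousLinearMap.inr ℝ E E) =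
      ContinuousLinearMap.id ℝ E :=
    (hd.hasFDerivAt.comp x₀ hl).unique ((hasFDerivAt_id x₀).congr_of_eventuallyEq h2)
  have hV : ∀ Z : E, HasFDerivAt (fun a => fderiv ℝ M (a, x₀) (0, Z))
      ((ContinuousLinearMap.apply ℝ E ((0, Z) : E × E)).comp
        (D2.comp (ContinuousLinearMap.inl ℝ E E))) x₀ := fun Z =>
    (ContinuousLinearMap.apply ℝ E ((0, Z) : E × E)).hasFDerivAt.comp x₀
      (HasFDerivAt.comp (f := fun a : E => ((a, x₀) : E × E)) x₀ hd2 hr)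
  let P : E → E →L[ℝ] E := fun a =>
    (fderiv ℝ M (x₀, a)).comp (ContinuousLinearMap.inl ℝ E E)
  have hP : HasFDerivAt P (((ContinuousLinearMap.compL ℝ E (E × E) E).flip
      (ContinuousLinearMap.inl ℝ E E)).comp (D2.comp (ContinuousLinearMap.inr ℝ E E))) x₀ :=
    ((ContinuousLinearMap.compL ℝ E (E × E) E).flip
      (ContinuousLinearMap.inl ℝ E E)).hasFDerivAt.comp x₀ (hd2.comp x₀ hl)
  have hP0 : P x₀ = (ContinuousLinearEquiv.refl ℝ E : E →L[ℝ] E) := hinl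
  have hinv : ∀ᶠ a in 𝓝 x₀, P a ∈ Set.range ((↑) : (E ≃L[ℝ] E) → E →L[ℝ] E) := by
    refine hP.continuousAt.eventually ?_
    rw [hP0]
    exact (ContinuousLinearEquiv.refl ℝ E).nhds
  -- The partial derivative `P a` is the identity at `x₀`, hence invertible nearby. Solving `hA` for
  -- `A` yields its differentiability, which is not assumed.
  have hAe : A =ᶠ[𝓝 x₀] fun a => (P a).inverse (fderiv ℝ M (a, x₀) (0, Y)) := by
    filter_upwards [hA, hinv] with a ha ⟨e, he⟩
    rw [← ha, show fderiv ℝ M (x₀, a) (A a, 0) = P a (A a) from rfl, ← he]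
    simp
  have hdiff : DifferentiableAt ℝ A x₀ := by
    refine DifferentiableAt.congr_of_eventuallyEq ?_ hAe
    refine DifferentiableAt.clm_apply ?_ (hV Y).differentiableAt
    have h := (contDiffAt_map_inverse (n := 1) (𝕜 := ℝ)
      (ContinuousLinearEquiv.refl ℝ E)).differentiableAt (by simp)
    rw [← hP0] at h
    exact h.comp x₀ hP.differentiableAt
  have hA0 : A x₀ = Y := by
    have h := hA.self_of_nhds
    have e1 : fderiv ℝ M (x₀, x₀) (A x₀, 0) = A x₀ := DFunLike.congr_fun hinl (A x₀)
    have e2 : fderiv ℝ M (x₀, x₀) (0, Y) = Y := DFunLike.congr_fun hinr Y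
    rw [← e1, h, e2]
  refine ⟨fderiv ℝ A x₀, hdiff.hasFDerivAt, fun X => ?_⟩
  have h3 := (hP.clm_apply hdiff.hasFDerivAt).unique
    ((hV Y).congr_of_eventuallyEq (by filter_upwards [hA] with a ha using ha))
  have h4 := DFunLike.congr_fun h3 X
  simp [hP0, hA0] at h4
  rw [(hV Y).fderiv, (hV X).fderiv]
  simp
  rw [← h4, hsymm (Y, 0) (0, X)]
  abel

variable {d : ℕ} {G : Type*} [TopologicalSpace G] [ChartedSpace (EuclideanSpace ℝ (Fin d)) G]
  [Group G] [LieGroup (𝓡 d) ∞ G]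

variable (d G) in
/-- The multiplication of `G` read in the chart at the identity. -/
noncomputable def chartMul (p : EuclideanSpace ℝ (Fin d) × EuclideanSpace ℝ (Fin d)) :
    EuclideanSpace ℝ (Fin d) :=
  extChartAt (𝓡 d) (1 : G) ((extChartAt (𝓡 d) (1 : G)).symm p.1 *
    (extChartAt (𝓡 d) (1 : G)).symm p.2)

theorem contDiffAt_chartMul {a b : EuclideanSpace ℝ (Fin d)}
    (ha : a ∈ (extChartAt (𝓡 d) (1 : G)).target) (hb : b ∈ (extChartAt (𝓡 d) (1 : G)).target)
    (hab : (extChartAt (𝓡 d) (1 : G)).symm a * (extChartAt (𝓡 d) (1 : G)).symm b ∈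
      (extChartAt (𝓡 d) (1 : G)).source) : ContDiffAt ℝ ∞ (chartMul d G) (a, b) := by
  have hs : ∀ c ∈ (extChartAt (𝓡 d) (1 : G)).target,
      ContMDiffAt (𝓡 d) (𝓡 d) ∞ (extChartAt (𝓡 d) (1 : G)).symm c := fun c hc =>
    (contMDiffOn_extChartAt_symm (1 : G)).contMDiffAt
      ((isOpen_extChartAt_target (1 : G)).mem_nhds hc)
  have h1 : ContMDiffAt 𝓘(ℝ, EuclideanSpace ℝ (Fin d) × EuclideanSpace ℝ (Fin d)) (𝓡 d) ∞
      (fun p : EuclideanSpace ℝ (Fin d) × EuclideanSpace ℝ (Fin d) => (extChartAt (𝓡 d) (1 : G)).symm p.1 *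
    (extChartAt (𝓡 d) (1 : G)).symm p.2) (a, b) :=
    ((hs a ha).comp (a, b) contDiffAt_fst.contMDiffAt).mul
      ((hs b hb).comp (a, b) contDiffAt_snd.contMDiffAt)
  have h2 := (contMDiffAt_extChartAt' (I := 𝓡 d) (n := ∞) (by simpa using hab)).comp (a, b) h1
  exact contMDiffAt_iff_contDiffAt.1 h2

theorem hasMFDerivAt_extChartAt_symm_one :
    HasMFDerivAt (𝓡 d) (𝓡 d) (extChartAt (𝓡 d) (1 : G)).symm (extChartAt (𝓡 d) (1 : G) 1)
      (ContinuousLinearMap.id ℝ (EuclideanSpace ℝ (Fin d))) := by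
  have : IsManifold (𝓡 d) 1 G := IsManifold.of_le (n := ∞) (by simp)
  have h := mdifferentiableWithinAt_extChartAt_symm (I := 𝓡 d) (x := (1 : G))
    (mem_extChartAt_target (1 : G))
  have h' := h.hasMFDerivWithinAt
  have e := mfderivWithin_range_extChartAt_symm (I := 𝓡 d) (x := (1 : G))
  rw [ModelWithCorners.range_eq_univ] at h' e
  rw [e] at h'
  exact hasMFDerivWithinAt_univ.1 h'

theorem fderiv_chartMul_right {a : EuclideanSpace ℝ (Fin d)}
    (ha : a ∈ (extChartAt (𝓡 d) (1 : G)).target) (Y : GroupLieAlgebra (𝓡 d) G) :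
    fderiv ℝ (chartMul d G) (a, extChartAt (𝓡 d) (1 : G) 1) (0, Y) =
      mfderiv (𝓡 d) (𝓡 d) (extChartAt (𝓡 d) (1 : G)) ((extChartAt (𝓡 d) (1 : G)).symm a)
        (mulInvariantVectorField Y ((extChartAt (𝓡 d) (1 : G)).symm a)) := by
  have : IsManifold (𝓡 d) 1 G := IsManifold.of_le (n := ∞) (by simp)
  have hs := (extChartAt (𝓡 d) (1 : G)).map_target ha
  set g := (extChartAt (𝓡 d) (1 : G)).symm a with hg
  have e1 : (extChartAt (𝓡 d) (1 : G)).symm (extChartAt (𝓡 d) (1 : G) 1) = 1 :=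
    (extChartAt (𝓡 d) (1 : G)).left_inv (mem_extChartAt_source (1 : G))
  have hM := (contDiffAt_chartMul ha (mem_extChartAt_target (1 : G))
    (by rw [e1, mul_one]; exact hs)).differentiableAt (by simp)
  have h1 := HasFDerivAt.comp
    (f := fun b : EuclideanSpace ℝ (Fin d) => ((a, b) : _ × EuclideanSpace ℝ (Fin d))) _
    hM.hasFDerivAt (hasFDerivAt_prodMk_right a _)
  have h2 : HasMFDerivAt (𝓡 d) (𝓡 d) (fun y : G => g * y)
      ((extChartAt (𝓡 d) (1 : G)).symm (extChartAt (𝓡 d) (1 : G) 1))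
      (mfderiv (𝓡 d) (𝓡 d) (fun y : G => g * y) 1) := by
    rw [e1]
    exact (mdifferentiableAt_mul_left g 1).hasMFDerivAt
  have h3 : HasMFDerivAt (𝓡 d) (𝓡 d) (extChartAt (𝓡 d) (1 : G))
      (g * (extChartAt (𝓡 d) (1 : G)).symm (extChartAt (𝓡 d) (1 : G) 1))
      (mfderiv (𝓡 d) (𝓡 d) (extChartAt (𝓡 d) (1 : G)) g) := by
    rw [e1, mul_one]
    exact (mdifferentiableAt_extChartAt (by simpa using hs)).hasMFDerivAt
  have h23 := HasMFDerivAt.comp (g := fun y : G => g * y)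
    (f := (extChartAt (𝓡 d) (1 : G)).symm) _ h2 hasMFDerivAt_extChartAt_symm_one
  have h4 := (HasMFDerivAt.comp (g := extChartAt (𝓡 d) (1 : G))
    (f := fun b => g * (extChartAt (𝓡 d) (1 : G)).symm b) _ h3 h23).hasFDerivAt
  exact DFunLike.congr_fun (h1.unique h4) Y

/-- From `g y = (g y g⁻¹) g`: the right translate of `Ad g Y` by `g` is the left-invariant field of
`Y` at `g`. With `fderiv_chartMul_right` this gives the hypothesis `hA` of
`hasFDerivAt_of_local_group`. -/
theorem fderiv_chartMul_left {a : EuclideanSpace ℝ (Fin d)}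
    (ha : a ∈ (extChartAt (𝓡 d) (1 : G)).target) (Y : GroupLieAlgebra (𝓡 d) G) :
    fderiv ℝ (chartMul d G) (extChartAt (𝓡 d) (1 : G) 1, a)
        (Ad ((extChartAt (𝓡 d) (1 : G)).symm a) Y, 0) =
      mfderiv (𝓡 d) (𝓡 d) (extChartAt (𝓡 d) (1 : G)) ((extChartAt (𝓡 d) (1 : G)).symm a)
        (mulInvariantVectorField Y ((extChartAt (𝓡 d) (1 : G)).symm a)) := by
  have : IsManifold (𝓡 d) 1 G := IsManifold.of_le (n := ∞) (by simp)
  have hs := (extChartAt (𝓡 d) (1 : G)).map_target ha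
  set g := (extChartAt (𝓡 d) (1 : G)).symm a with hg
  have e1 : (extChartAt (𝓡 d) (1 : G)).symm (extChartAt (𝓡 d) (1 : G) 1) = 1 :=
    (extChartAt (𝓡 d) (1 : G)).left_inv (mem_extChartAt_source (1 : G))
  have hM := (contDiffAt_chartMul (mem_extChartAt_target (1 : G)) ha
    (by rw [e1, one_mul]; exact hs)).differentiableAt (by simp)
  have h1 := HasFDerivAt.comp
    (f := fun b : EuclideanSpace ℝ (Fin d) => ((b, a) : _ × EuclideanSpace ℝ (Fin d))) _
    hM.hasFDerivAt (hasFDerivAt_prodMk_left _ a)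
  have h2 : HasMFDerivAt (𝓡 d) (𝓡 d) (fun y : G => y * g)
      ((extChartAt (𝓡 d) (1 : G)).symm (extChartAt (𝓡 d) (1 : G) 1))
      (mfderiv (𝓡 d) (𝓡 d) (fun y : G => y * g) 1) := by
    rw [e1]
    exact (mdifferentiableAt_mul_right g 1).hasMFDerivAt
  have h3 : HasMFDerivAt (𝓡 d) (𝓡 d) (extChartAt (𝓡 d) (1 : G))
      ((extChartAt (𝓡 d) (1 : G)).symm (extChartAt (𝓡 d) (1 : G) 1) * g)
      (mfderiv (𝓡 d) (𝓡 d) (extChartAt (𝓡 d) (1 : G)) g) := by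
    rw [e1, one_mul]
    exact (mdifferentiableAt_extChartAt (by simpa using hs)).hasMFDerivAt
  have h23 := HasMFDerivAt.comp (g := fun y : G => y * g)
    (f := (extChartAt (𝓡 d) (1 : G)).symm) _ h2 hasMFDerivAt_extChartAt_symm_one
  have h4 := (HasMFDerivAt.comp (g := extChartAt (𝓡 d) (1 : G))
    (f := fun b => (extChartAt (𝓡 d) (1 : G)).symm b * g) _ h3 h23).hasFDerivAt
  have h5 := mfderiv_comp_apply_of_eq (I := 𝓡 d) (I' := 𝓡 d) (I'' := 𝓡 d) (x := (1 : G)) (y := 1)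
    (mdifferentiableAt_mul_right g 1) (mdifferentiableAt_conj g 1) (by simp) Y
  have e : (fun y : G => y * g) ∘ (fun y : G => g * y * g⁻¹) = fun y => g * y := by
    funext y; simp
  rw [e] at h5
  refine (DFunLike.congr_fun (h1.unique h4) (Ad g Y)).trans ?_
  exact congrArg (mfderiv (𝓡 d) (𝓡 d) (extChartAt (𝓡 d) (1 : G)) g) h5.symm

omit [LieGroup (𝓡 d) ∞ G] in
theorem chartMul_one_right {a : EuclideanSpace ℝ (Fin d)}
    (ha : a ∈ (extChartAt (𝓡 d) (1 : G)).target) :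
    chartMul d G (a, extChartAt (𝓡 d) (1 : G) 1) = a := by
  rw [chartMul, (extChartAt (𝓡 d) (1 : G)).left_inv (mem_extChartAt_source (1 : G)), mul_one,
    (extChartAt (𝓡 d) (1 : G)).right_inv ha]

omit [LieGroup (𝓡 d) ∞ G] in
theorem chartMul_one_left {a : EuclideanSpace ℝ (Fin d)}
    (ha : a ∈ (extChartAt (𝓡 d) (1 : G)).target) :
    chartMul d G (extChartAt (𝓡 d) (1 : G) 1, a) = a := by
  rw [chartMul, (extChartAt (𝓡 d) (1 : G)).left_inv (mem_extChartAt_source (1 : G)), one_mul,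
    (extChartAt (𝓡 d) (1 : G)).right_inv ha]

theorem contDiffAt_chartMul_one : ContDiffAt ℝ ∞ (chartMul d G)
    (extChartAt (𝓡 d) (1 : G) 1, extChartAt (𝓡 d) (1 : G) 1) := by
  refine contDiffAt_chartMul (mem_extChartAt_target (1 : G)) (mem_extChartAt_target (1 : G)) ?_
  rw [(extChartAt (𝓡 d) (1 : G)).left_inv (mem_extChartAt_source (1 : G)), one_mul]
  exact mem_extChartAt_source (1 : G)

theorem fderiv_chartMul_one (Z : EuclideanSpace ℝ (Fin d)) :
    fderiv ℝ (chartMul d G) (extChartAt (𝓡 d) (1 : G) 1, extChartAt (𝓡 d) (1 : G) 1) (0, Z) =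
      Z := by
  have h := HasFDerivAt.comp
    (f := fun b : EuclideanSpace ℝ (Fin d) =>
      ((extChartAt (𝓡 d) (1 : G) 1, b) : _ × EuclideanSpace ℝ (Fin d)))
    (extChartAt (𝓡 d) (1 : G) 1)
    (contDiffAt_chartMul_one.differentiableAt (by simp)).hasFDerivAt
    (hasFDerivAt_prodMk_right (𝕜 := ℝ) (extChartAt (𝓡 d) (1 : G) 1) _)
  refine DFunLike.congr_fun (h.unique ((hasFDerivAt_id _).congr_of_eventuallyEq ?_)) Z
  filter_upwards [extChartAt_target_mem_nhds (I := 𝓡 d) (1 : G)] with a ha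
  exact chartMul_one_left ha

theorem lieBracketWithin_univ_eq_of_eventuallyEq {E : Type*} [NormedAddCommGroup E]
    [NormedSpace ℝ E] {V W V' W' : E → E} {x : E} (hV : V =ᶠ[𝓝 x] V') (hW : W =ᶠ[𝓝 x] W') :
    VectorField.lieBracketWithin ℝ V W Set.univ x =
      fderiv ℝ W' x (V' x) - fderiv ℝ V' x (W' x) := by
  rw [VectorField.lieBracketWithin_univ, VectorField.lieBracket, hV.fderiv_eq, hW.fderiv_eq,
    hV.self_of_nhds, hW.self_of_nhds]

theorem inverse_apply_of_eq_id {E : Type*} [NormedAddCommGroup E] [NormedSpace ℝ E]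
    {f : E →L[ℝ] E} (hf : f = ContinuousLinearMap.id ℝ E) (v : E) : f.inverse v = v := by
  rw [hf, ContinuousLinearMap.inverse_id]
  rfl

/-- Left-invariant fields, read in the chart at `1`, are partial derivatives of the multiplication,
and the chart has the identity as its differential at `1`. -/
theorem bracket_eq_chart (X Y : EuclideanSpace ℝ (Fin d)) :
    @Bracket.bracket (GroupLieAlgebra (𝓡 d) G) (GroupLieAlgebra (𝓡 d) G) _ X Y =
      (fderiv ℝ (fun a => fderiv ℝ (chartMul d G) (a, extChartAt (𝓡 d) (1 : G) 1) (0, Y))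
          (extChartAt (𝓡 d) (1 : G) 1) X -
        fderiv ℝ (fun a => fderiv ℝ (chartMul d G) (a, extChartAt (𝓡 d) (1 : G) 1) (0, X))
          (extChartAt (𝓡 d) (1 : G) 1) Y : EuclideanSpace ℝ (Fin d)) := by
  have : IsManifold (𝓡 d) 1 G := IsManifold.of_le (n := ∞) (by simp)
  have hV : ∀ Z : EuclideanSpace ℝ (Fin d),
      VectorField.mpullbackWithin (𝓡 d) (𝓡 d) (extChartAt (𝓡 d) (1 : G)).symm
        (mulInvariantVectorField (Z : GroupLieAlgebra (𝓡 d) G)) (Set.range (𝓡 d)) =ᶠ[𝓝 (extChartAt (𝓡 d) (1 : G) 1)]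
      fun a => fderiv ℝ (chartMul d G) (a, extChartAt (𝓡 d) (1 : G) 1) (0, Z) := by
    intro Z
    filter_upwards [extChartAt_target_mem_nhds (I := 𝓡 d) (1 : G)] with a ha
    refine Eq.trans ?_ (fderiv_chartMul_right ha Z).symm
    refine (isInvertible_mfderivWithin_extChartAt_symm ha).inverse_apply_eq.2 ?_
    exact (DFunLike.congr_fun (mfderivWithin_extChartAt_symm_comp_mfderiv_extChartAt ha)
      (mulInvariantVectorField (Z : GroupLieAlgebra (𝓡 d) G) ((extChartAt (𝓡 d) (1 : G)).symm a))).symm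
  have h := lieBracketWithin_univ_eq_of_eventuallyEq (hV X) (hV Y)
  simp only [fderiv_chartMul_one] at h
  rw [← h]
  have hset : (extChartAt (𝓡 d) (1 : G)).symm ⁻¹' Set.univ ∩ Set.range (𝓡 d) = Set.univ := by
    simp
  rw [← hset]
  exact inverse_apply_of_eq_id (E := EuclideanSpace ℝ (Fin d))
    (f := mfderiv (𝓡 d) (𝓡 d) (extChartAt (𝓡 d) (1 : G)) 1)
    (mfderiv_extChartAt_self (I := 𝓡 d) (x := (1 : G))) _

omit [LieGroup (𝓡 d) ∞ G] in
theorem mulInvariantVectorField_one (X : GroupLieAlgebra (𝓡 d) G) :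
    mulInvariantVectorField X (1 : G) = X := by
  have e : (fun y : G => 1 * y) = id := by funext y; simp
  change mfderiv (𝓡 d) (𝓡 d) (fun y : G => 1 * y) 1 X = X
  rw [e, mfderiv_id]
  rfl

theorem hasDerivAt_Ad_zero [T2Space G] (X Y : GroupLieAlgebra (𝓡 d) G) :
    HasDerivAt (F := EuclideanSpace ℝ (Fin d))
      (fun t : ℝ => (Ad (lieExp (t • X) : G) Y : EuclideanSpace ℝ (Fin d)))
      (⁅X, Y⁆ : GroupLieAlgebra (𝓡 d) G) 0 := by
  have : IsManifold (𝓡 d) 1 G := IsManifold.of_le (n := ∞) (by simp)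
  have htar := extChartAt_target_mem_nhds (I := 𝓡 d) (1 : G)
  have hγ := isMIntegralCurve_lieExp (G := G) X
  have h0 : (lieExp ((0 : ℝ) • X) : G) = 1 := by rw [zero_smul, lieExp_zero]
  obtain ⟨A', hA', hA''⟩ := hasFDerivAt_of_local_group (M := chartMul d G)
    (x₀ := extChartAt (𝓡 d) (1 : G) 1) (contDiffAt_chartMul_one.of_le (WithTop.coe_le_coe.2 le_top))
    (by filter_upwards [htar] with a ha using chartMul_one_right ha)
    (by filter_upwards [htar] with a ha using chartMul_one_left ha)
    (A := fun a => Ad ((extChartAt (𝓡 d) (1 : G)).symm a) Y) (Y := Y)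
    (by filter_upwards [htar] with a ha using
      (fderiv_chartMul_left ha Y).trans (fderiv_chartMul_right ha Y).symm)
  have hφ : HasMFDerivAt (𝓡 d) (𝓡 d) (extChartAt (𝓡 d) (1 : G)) (lieExp ((0 : ℝ) • X))
      (ContinuousLinearMap.id ℝ (EuclideanSpace ℝ (Fin d))) := by
    rw [h0]
    have h := (mdifferentiableAt_extChartAt (I := 𝓡 d) (mem_chart_source _ (1 : G))).hasMFDerivAt
    rw [mfderiv_extChartAt_self] at h
    exact h
  have hc : HasDerivAt (F := EuclideanSpace ℝ (Fin d))
      (fun t : ℝ => extChartAt (𝓡 d) (1 : G) (lieExp (t • X))) X 0 := by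
    have h : HasFDerivAt (F := EuclideanSpace ℝ (Fin d))
        (fun t : ℝ => extChartAt (𝓡 d) (1 : G) (lieExp (t • X)))
        ((ContinuousLinearMap.id ℝ (EuclideanSpace ℝ (Fin d))).comp
          (ContinuousLinearMap.smulRight (1 : ℝ →L[ℝ] ℝ)
            (mulInvariantVectorField X (lieExp ((0 : ℝ) • X)) : EuclideanSpace ℝ (Fin d)))) 0 :=
      (HasMFDerivAt.comp (g := extChartAt (𝓡 d) (1 : G))
        (f := fun t : ℝ => (lieExp (t • X) : G)) 0 hφ (hγ 0)).hasFDerivAt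
    have e : ∀ g : G, g = 1 →
        (mulInvariantVectorField X g : EuclideanSpace ℝ (Fin d)) = X := by
      rintro g rfl
      exact mulInvariantVectorField_one X
    have h' := h.hasDerivAt
    rw [e _ h0] at h'
    refine h'.congr_deriv ?_
    exact one_smul ℝ (X : EuclideanSpace ℝ (Fin d))
  have hA0 : HasFDerivAt (fun a => (Ad ((extChartAt (𝓡 d) (1 : G)).symm a) Y :
      EuclideanSpace ℝ (Fin d))) A' (extChartAt (𝓡 d) (1 : G) (lieExp ((0 : ℝ) • X))) := by
    rw [h0]
    exact hA'
  have h1 := HasFDerivAt.comp_hasDerivAt (E := EuclideanSpace ℝ (Fin d))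
    (F := EuclideanSpace ℝ (Fin d)) (0 : ℝ) hA0 hc
  have h2 := HasDerivAt.congr_deriv (F := EuclideanSpace ℝ (Fin d)) h1
    ((hA'' X).trans (bracket_eq_chart (G := G) X Y).symm)
  refine HasDerivAt.congr_of_eventuallyEq (F := EuclideanSpace ℝ (Fin d)) h2 ?_
  have hcont : ContinuousAt (fun t : ℝ => (lieExp (t • X) : G)) 0 := hγ.continuous.continuousAt
  have hsrc := hcont.preimage_mem_nhds (t := (extChartAt (𝓡 d) (1 : G)).source) (by
    rw [h0]
    exact extChartAt_source_mem_nhds (1 : G))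
  filter_upwards [hsrc] with t ht
  exact congrArg (fun g : G => (Ad g Y : EuclideanSpace ℝ (Fin d)))
    ((extChartAt (𝓡 d) (1 : G)).left_inv ht).symm

/-- The case `t = 0` is transported by `Ad (exp sX) = Ad (exp tX) Ad (exp ((s - t)X))`. -/
theorem hasDerivAt_Ad [T2Space G] (X Y : GroupLieAlgebra (𝓡 d) G) (t : ℝ) :
    HasDerivAt (F := EuclideanSpace ℝ (Fin d))
      (fun t : ℝ => (Ad (lieExp (t • X) : G) Y : EuclideanSpace ℝ (Fin d)))
      (Ad (lieExp (t • X) : G) ⁅X, Y⁆ : GroupLieAlgebra (𝓡 d) G) t := by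
  have h := hasDerivAt_Ad_zero (G := G) X Y
  have h1 : HasDerivAt (fun s : ℝ => s - t) 1 t := (hasDerivAt_id t).sub_const t
  rw [← sub_self t] at h
  have h2 := HasDerivAt.scomp (h := fun s : ℝ => s - t) t h h1
  have h2' := h2.congr_deriv (one_smul ℝ (_ : EuclideanSpace ℝ (Fin d)))
  let L : EuclideanSpace ℝ (Fin d) →ₗ[ℝ] EuclideanSpace ℝ (Fin d) := Ad (lieExp (t • X) : G)
  have h3 := (LinearMap.toContinuousLinearMap L).hasFDerivAt.comp_hasDerivAt t h2'
  refine h3.congr_of_eventuallyEq (Eventually.of_forall fun s => ?_)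
  have e := lieExp_add_smul (G := G) X t (s - t)
  rw [add_sub_cancel] at e
  change (Ad (lieExp (s • X) : G) Y : EuclideanSpace ℝ (Fin d)) = _
  rw [e]
  exact Ad_mul _ _ Y

end AdDerivative

end ParaHermitian

/-! ### Nilpotent and commuting elements -/

namespace ParaHermitian

section Commuting

variable {d : ℕ} {G : Type*} [TopologicalSpace G] [ChartedSpace (EuclideanSpace ℝ (Fin d)) G]
  [Group G] [LieGroup (𝓡 d) ∞ G] [T2Space G]

theorem eq_of_hasDerivAt_eq {E : Type*} [NormedAddCommGroup E] [NormedSpace ℝ E] {f g f' : ℝ → E}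
    (hf : ∀ t, HasDerivAt f (f' t) t) (hg : ∀ t, HasDerivAt g (f' t) t) (h0 : f 0 = g 0) (t : ℝ) :
    f t = g t := by
  have h : ∀ t, HasDerivAt (fun t => f t - g t) 0 t := fun t => by
    simpa using! (hf t).sub (hg t)
  have h1 := is_const_of_deriv_eq_zero (fun t => (h t).differentiableAt) (fun t => (h t).deriv) t 0
  simpa [h0, sub_eq_zero] using h1

theorem eq_quadratic_of_hasDerivAt {E : Type*} [NormedAddCommGroup E] [NormedSpace ℝ E]
    {f : ℝ → E} {Y Z W : E} (hf : ∀ t, HasDerivAt f (Z + t • W) t) (h0 : f 0 = Y) (t : ℝ) :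
    f t = Y + t • Z + (t ^ 2 / 2) • W := by
  refine eq_of_hasDerivAt_eq (g := fun t => Y + t • Z + (t ^ 2 / 2) • W) hf (fun t => ?_)
    (by simp [h0]) t
  have h2 := (hasDerivAt_id t).smul_const Z
  have h3 := (((hasDerivAt_id t).pow 2).div_const 2).smul_const W
  refine ((h2.const_add Y).add h3).congr_deriv ?_
  simp

theorem eq_affine_of_hasDerivAt {E : Type*} [NormedAddCommGroup E] [NormedSpace ℝ E]
    {f : ℝ → E} {Y Z : E} (hf : ∀ t, HasDerivAt f Z t) (h0 : f 0 = Y) (t : ℝ) :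
    f t = Y + t • Z := by
  have h := eq_quadratic_of_hasDerivAt (f := f) (Z := Z) (W := 0) (fun t => by simpa using hf t) h0 t
  simpa using h

theorem eq_const_of_hasDerivAt {E : Type*} [NormedAddCommGroup E] [NormedSpace ℝ E]
    {f : ℝ → E} {Y : E} (hf : ∀ t, HasDerivAt f 0 t) (h0 : f 0 = Y) (t : ℝ) : f t = Y := by
  simpa using eq_affine_of_hasDerivAt hf h0 t

theorem Ad_lieExp_zero_smul (X Y : GroupLieAlgebra (𝓡 d) G) :
    Ad (lieExp ((0 : ℝ) • X) : G) Y = Y := by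
  rw [zero_smul, lieExp_zero, Ad_one]

/-- The derivative of `Ad (exp tX) Y` is the same expression for `⁅X, Y⁆`. Integrating three times
gives first a constant, then an affine and then a quadratic function of `t`. -/
theorem Ad_lieExp_smul_of_lie_lie_lie_eq_zero {X Y : GroupLieAlgebra (𝓡 d) G}
    (h : ⁅X, ⁅X, ⁅X, Y⁆⁆⁆ = 0) (t : ℝ) :
    Ad (lieExp (t • X) : G) Y = Y + t • ⁅X, Y⁆ + (t ^ 2 / 2) • ⁅X, ⁅X, Y⁆⁆ := by
  have h0 : ∀ Z : GroupLieAlgebra (𝓡 d) G, ⁅X, Z⁆ = 0 → ∀ t : ℝ,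
      Ad (lieExp (t • X) : G) Z = Z := fun Z hZ t => by
    refine eq_const_of_hasDerivAt (E := EuclideanSpace ℝ (Fin d))
      (f := fun t : ℝ => Ad (lieExp (t • X) : G) Z) (fun t => ?_) (Ad_lieExp_zero_smul X Z) t
    have h1 := hasDerivAt_Ad (G := G) X Z t
    rw [hZ, map_zero] at h1
    exact h1
  have h1 : ∀ Z : GroupLieAlgebra (𝓡 d) G, ⁅X, ⁅X, Z⁆⁆ = 0 → ∀ t : ℝ,
      Ad (lieExp (t • X) : G) Z = Z + t • ⁅X, Z⁆ := fun Z hZ t => by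
    refine eq_affine_of_hasDerivAt (E := EuclideanSpace ℝ (Fin d))
      (f := fun t : ℝ => Ad (lieExp (t • X) : G) Z)
      (Z := (⁅X, Z⁆ : GroupLieAlgebra (𝓡 d) G)) (fun t => ?_) (Ad_lieExp_zero_smul X Z) t
    have h1 := hasDerivAt_Ad (G := G) X Z t
    rw [h0 _ hZ] at h1
    exact h1
  refine eq_quadratic_of_hasDerivAt (E := EuclideanSpace ℝ (Fin d))
    (f := fun t : ℝ => Ad (lieExp (t • X) : G) Y) (Y := Y)
    (Z := (⁅X, Y⁆ : GroupLieAlgebra (𝓡 d) G)) (W := (⁅X, ⁅X, Y⁆⁆ : GroupLieAlgebra (𝓡 d) G))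
    (fun t => ?_) (Ad_lieExp_zero_smul X Y) t
  have h2 := hasDerivAt_Ad (G := G) X Y t
  rw [h1 _ h] at h2
  exact h2

theorem Ad_lieExp_of_lie_lie_lie_eq_zero {X Y : GroupLieAlgebra (𝓡 d) G}
    (h : ⁅X, ⁅X, ⁅X, Y⁆⁆⁆ = 0) :
    Ad (lieExp X : G) Y = Y + ⁅X, Y⁆ + (1 / 2 : ℝ) • ⁅X, ⁅X, Y⁆⁆ := by
  have h1 := Ad_lieExp_smul_of_lie_lie_lie_eq_zero (G := G) h 1
  rwa [one_smul, one_smul, one_pow] at h1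

theorem Ad_lieExp_smul_of_lie_eq_zero {X Y : GroupLieAlgebra (𝓡 d) G} (h : ⁅X, Y⁆ = 0) (t : ℝ) :
    Ad (lieExp (t • X) : G) Y = Y := by
  rw [Ad_lieExp_smul_of_lie_lie_lie_eq_zero (by simp [h]) t, h]
  simp

omit [T2Space G] in
theorem mfderiv_mul_right_mulInvariantVectorField (g x : G) (X : GroupLieAlgebra (𝓡 d) G) :
    mfderiv (𝓡 d) (𝓡 d) (fun y : G => y * g) x (mulInvariantVectorField X x) =
      mulInvariantVectorField (Ad g⁻¹ X) (x * g) := by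
  have h1 := mfderiv_comp_apply_of_eq (I := 𝓡 d) (I' := 𝓡 d) (I'' := 𝓡 d) (x := (1 : G)) (y := x)
    (mdifferentiableAt_mul_right g x) (mdifferentiableAt_mul_left x 1) (by simp) X
  have h2 := mfderiv_comp_apply_of_eq (I := 𝓡 d) (I' := 𝓡 d) (I'' := 𝓡 d) (x := (1 : G)) (y := 1)
    (mdifferentiableAt_mul_left (x * g) 1) (mdifferentiableAt_conj g⁻¹ 1) (by simp) X
  have e : (fun y : G => y * g) ∘ (fun y : G => x * y) =
      (fun y : G => x * g * y) ∘ (fun y : G => g⁻¹ * y * g⁻¹⁻¹) := by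
    funext y; simp [mul_assoc]
  rw [e] at h1
  exact h1.symm.trans h2

/-- The curve `exp tX · exp tY` has left-invariant velocity `Ad (exp (-tY)) X + Y`, and `Ad (exp
(-tY))` fixes `X`. -/
theorem lieExp_add_of_lie_eq_zero {X Y : GroupLieAlgebra (𝓡 d) G} (h : ⁅X, Y⁆ = 0) :
    (lieExp (X + Y) : G) = lieExp X * lieExp Y := by
  have hYX : ⁅Y, X⁆ = 0 := by rw [← lie_skew, h, neg_zero]
  have hcurve : IsMIntegralCurve (I := 𝓡 d) (fun t : ℝ => (lieExp (t • X) * lieExp (t • Y) : G))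
      (mulInvariantVectorField (X + Y)) := by
    intro t
    have hm : MDifferentiableAt ((𝓡 d).prod (𝓡 d)) (𝓡 d) (fun p : G × G => p.1 * p.2)
        (lieExp (t • X), lieExp (t • Y)) :=
      (contMDiff_mul (𝓡 d) ∞).mdifferentiableAt (by simp)
    have h1 := HasMFDerivAt.comp (g := fun p : G × G => p.1 * p.2)
      (f := fun t : ℝ => ((lieExp (t • X), lieExp (t • Y)) : G × G)) t hm.hasMFDerivAt
      ((isMIntegralCurve_lieExp X t).prodMk (isMIntegralCurve_lieExp Y t))
    have e : mfderiv ((𝓡 d).prod (𝓡 d)) (𝓡 d) (fun p : G × G => p.1 * p.2)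
        (lieExp (t • X), lieExp (t • Y)) (mulInvariantVectorField X (lieExp (t • X)),
          mulInvariantVectorField Y (lieExp (t • Y))) =
        mulInvariantVectorField (X + Y) (lieExp (t • X) * lieExp (t • Y)) := by
      rw [mulInvariantVectorField_add]
      refine (mfderiv_prod_eq_add_apply hm).trans ?_
      have e1 := mfderiv_mul_right_mulInvariantVectorField (lieExp (t • Y) : G) (lieExp (t • X)) X
      rw [← lieExp_neg, ← neg_smul, Ad_lieExp_smul_of_lie_eq_zero hYX] at e1
      exact congrArg₂ (· + ·) e1
        (mfderiv_mul_left_mulInvariantVectorField (lieExp (t • X)) (lieExp (t • Y)) Y)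
    have e' : ContinuousLinearMap.smulRight (1 : ℝ →L[ℝ] ℝ)
        (mulInvariantVectorField (X + Y) (lieExp (t • X) * lieExp (t • Y) : G)) =
        (mfderiv ((𝓡 d).prod (𝓡 d)) (𝓡 d) (fun p : G × G => p.1 * p.2)
          (lieExp (t • X), lieExp (t • Y))).comp
        ((ContinuousLinearMap.smulRight (1 : ℝ →L[ℝ] ℝ)
          (mulInvariantVectorField X (lieExp (t • X) : G))).prod
          (ContinuousLinearMap.smulRight (1 : ℝ →L[ℝ] ℝ)
            (mulInvariantVectorField Y (lieExp (t • Y) : G)))) := by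
      ext1
      rw [← e]
      refine (one_smul ℝ (_ : EuclideanSpace ℝ (Fin d))).trans ?_
      refine congrArg (mfderiv ((𝓡 d).prod (𝓡 d)) (𝓡 d) (fun p : G × G => p.1 * p.2)
          (lieExp (t • X), lieExp (t • Y))) ?_
      exact Prod.ext (one_smul ℝ (_ : EuclideanSpace ℝ (Fin d))).symm
        (one_smul ℝ (_ : EuclideanSpace ℝ (Fin d))).symm
    rw [e']
    exact h1
  rw [lieExp_eq (by simp) hcurve, one_smul, one_smul]

end Commuting

end ParaHermitian

/-! ### Derivations of polynomial rings and prime factors -/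

namespace MvPolynomial

variable {ι : Type*}

theorem derivation_sum_apply {R κ : Type*} [CommRing R]
    (δ : κ → Derivation R (MvPolynomial ι R) (MvPolynomial ι R)) (s : Finset κ)
    (p : MvPolynomial ι R) : (∑ i ∈ s, δ i) p = ∑ i ∈ s, δ i p := by
  classical
  induction s using Finset.induction_on with
  | empty => simp
  | insert a s ha ih => simp [Finset.sum_insert ha, ih]

theorem derivation_eq_sum [Fintype ι] {R : Type*} [CommRing R]
    (δ : Derivation R (MvPolynomial ι R) (MvPolynomial ι R)) (p : MvPolynomial ι R) :
    δ p = ∑ i, δ (X i) * pderiv i p := by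
  classical
  have h : δ = ∑ i, δ (X i) • (pderiv i : Derivation R (MvPolynomial ι R) (MvPolynomial ι R)) := by
    refine derivation_ext fun j => ?_
    rw [derivation_sum_apply, Finset.sum_eq_single j]
    · simp
    · intro i _ hij
      simp [pderiv_X_of_ne hij.symm]
    · simp
  conv_lhs => rw [h]
  simp [derivation_sum_apply]

theorem totalDegree_pderiv_le {R : Type*} [CommRing R] (i : ι) (p : MvPolynomial ι R) :
    (pderiv i p).totalDegree ≤ p.totalDegree - 1 := by
  classical
  refine Finset.sup_le fun m hm => ?_
  have h1 : coeff (m + Finsupp.single i 1) p ≠ 0 := by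
    intro h
    rw [mem_support_iff, coeff_pderiv, h, zero_mul] at hm
    exact hm rfl
  have h2 := le_totalDegree (mem_support_iff.2 h1)
  rw [Finsupp.sum_add_index' (fun _ => rfl) (fun _ _ _ => rfl),
    Finsupp.sum_single_index rfl] at h2
  omega

theorem totalDegree_derivation_le [Fintype ι] {R : Type*} [CommRing R]
    (δ : Derivation R (MvPolynomial ι R) (MvPolynomial ι R)) {n : ℕ}
    (hδ : ∀ i, (δ (X i)).totalDegree ≤ n + 1) (p : MvPolynomial ι R) :
    (δ p).totalDegree ≤ p.totalDegree + n := by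
  rw [derivation_eq_sum]
  refine totalDegree_finsetSum_le fun i _ => ?_
  -- Constants are separated because the bound `totalDegree p - 1` for a partial derivative
  -- truncates at zero.
  by_cases hp : p.totalDegree = 0
  · rw [totalDegree_eq_zero_iff_eq_C] at hp
    rw [hp]
    simp
  · refine (totalDegree_mul _ _).trans ?_
    have := totalDegree_pderiv_le i p
    have := hδ i
    omega

theorem eq_C_of_pderiv_eq_zero (p : MvPolynomial ι ℝ) (hp : ∀ i, pderiv i p = 0) :
    p = C (constantCoeff p) := by
  classical
  ext m
  rw [coeff_C]
  split_ifs with hm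
  · rw [← hm]; rfl
  · obtain ⟨i, hi⟩ := Finsupp.ne_iff.1 (Ne.symm hm)
    have hi' : Finsupp.single i 1 ≤ m := by
      rw [Finsupp.single_le_iff]
      exact Nat.one_le_iff_ne_zero.2 hi
    have h := congrArg (coeff (m - Finsupp.single i 1)) (hp i)
    rw [coeff_pderiv, tsub_add_cancel_of_le hi', coeff_zero] at h
    exact (mul_eq_zero.1 h).resolve_right (by positivity)

theorem eq_zero_of_totalDegree_le_one {R : Type*} [CommRing R] {r : MvPolynomial ι R}
    (hr : r.totalDegree ≤ 1) (h0 : constantCoeff r = 0)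
    (h1 : ∀ i, constantCoeff (pderiv i r) = 0) : r = 0 := by
  classical
  ext m
  rw [coeff_zero]
  by_contra hm
  have h2 := (le_totalDegree (mem_support_iff.2 hm)).trans hr
  by_cases hm0 : m = 0
  · rw [hm0] at hm
    exact hm h0
  · obtain ⟨i, hi⟩ := Finsupp.ne_iff.1 hm0
    have h3 : m = Finsupp.single i 1 := by
      have hi' : Finsupp.single i 1 ≤ m := by
        rw [Finsupp.single_le_iff]
        exact Nat.one_le_iff_ne_zero.2 hi
      obtain ⟨m', rfl⟩ := exists_add_of_le hi'
      rw [Finsupp.sum_add_index' (fun _ => rfl) (fun _ _ _ => rfl),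
        Finsupp.sum_single_index rfl] at h2
      have h4 : m'.sum (fun _ e => e) = 0 := by omega
      have h5 : m' = 0 := (Finsupp.degree_eq_zero_iff m').1 h4
      rw [h5, add_zero]
    have h := h1 i
    rw [constantCoeff_eq, coeff_pderiv, zero_add] at h
    rw [h3] at hm
    simp at h
    exact hm h

/-- A nonzero multiple of `p` has at least the degree of `p`, but `∂ᵢ p` has smaller degree unless
`p` is constant. -/
theorem pderiv_eq_zero_of_dvd {p : MvPolynomial ι ℝ} {i : ι} (h : p ∣ pderiv i p) :
    pderiv i p = 0 := by
  by_contra h0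
  have h1 := totalDegree_le_of_dvd_of_isDomain h h0
  have h2 := totalDegree_pderiv_le i p
  have h3 : p.totalDegree = 0 := by omega
  rw [totalDegree_eq_zero_iff_eq_C] at h3
  rw [h3] at h0
  simp at h0

/-- The prime factors of an eigenvector of a derivation are eigenvectors. -/
theorem Prime.dvd_derivation [Finite ι]
    (δ : Derivation ℝ (MvPolynomial ι ℝ) (MvPolynomial ι ℝ))
    {p D : MvPolynomial ι ℝ} (hp : Prime p) (hD : D ≠ 0) (hpD : p ∣ D) (hδ : D ∣ δ D) :
    p ∣ δ p := by
  obtain ⟨q, hq, hpq⟩ :=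
    (FiniteMultiplicity.of_prime_left hp hD).exists_eq_pow_mul_and_not_dvd
  set e := multiplicity p D
  have he : e ≠ 0 := by
    intro h
    rw [h, pow_zero, one_mul] at hq
    exact hpq (hq ▸ hpD)
  obtain ⟨e', he'⟩ := Nat.exists_eq_succ_of_ne_zero he
  have h1 : p ^ (e' + 1) ∣ δ D := (Dvd.intro _ (by rw [hq, he'])).trans hδ
  -- For `D = p ^ e * q` with `p ∤ q` the Leibniz rule gives `δ D = p ^ e δ q + e p ^ (e - 1) q δ
  -- p`. Divisibility by `p ^ e` leaves `p ∣ e q δ p`, and `e` is a unit in characteristic zero.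
  rw [hq, he', Derivation.leibniz, Derivation.leibniz_pow] at h1
  simp only [smul_eq_mul, Nat.succ_eq_add_one, add_tsub_cancel_right, nsmul_eq_mul] at h1
  rw [dvd_add_right (Dvd.intro _ rfl)] at h1
  have h2 : p ^ e' * p ∣ p ^ e' * (q * ((e' + 1 : ℕ) * δ p)) := by
    rw [← pow_succ]
    convert h1 using 1
    ring
  have h3 := (mul_dvd_mul_iff_left (pow_ne_zero _ hp.ne_zero)).1 h2
  have h4 := (hp.dvd_or_dvd h3).resolve_left hpq
  have h5 : IsUnit (((e' + 1 : ℕ) : MvPolynomial ι ℝ)) := by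
    have : ((e' + 1 : ℕ) : MvPolynomial ι ℝ) = C ((e' + 1 : ℕ) : ℝ) := by simp
    rw [this]
    exact (isUnit_iff_ne_zero.2 (by positivity)).map C
  exact h5.dvd_mul_left.1 h4

/-- The degree bound makes the cofactor constant, and comparison of constant terms makes it zero. -/
theorem derivation_dvd_eq_zero [Finite ι] {p q : MvPolynomial ι ℝ} (hp0 : constantCoeff p = 1)
    (hdeg : q.totalDegree ≤ p.totalDegree) (hpq : p ∣ q) (hq0 : constantCoeff q = 0) : q = 0 := by
  obtain ⟨c, rfl⟩ := hpq
  by_contra h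
  have hp : p ≠ 0 := left_ne_zero_of_mul h
  have hc : c ≠ 0 := right_ne_zero_of_mul h
  rw [totalDegree_mul_of_isDomain hp hc] at hdeg
  have h3 : c.totalDegree = 0 := by omega
  rw [totalDegree_eq_zero_iff_eq_C] at h3
  rw [map_mul, hp0, one_mul] at hq0
  rw [← constantCoeff_eq, hq0, C_0] at h3
  exact hc h3

/-! ### Semi-invariant polynomials are powers of irreducible ones -/

section Homogeneous

variable [Fintype ι] {τ : Type*}
  (L : ι → Derivation ℝ (MvPolynomial ι ℝ) (MvPolynomial ι ℝ))
  (T : τ → Derivation ℝ (MvPolynomial ι ℝ) (MvPolynomial ι ℝ)) (A : τ → ι → ι → ℝ)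

/-- A linear vector field does not raise degrees and vanishes at the origin, so
`derivation_dvd_eq_zero` applies. -/
theorem derivation_eq_zero_of_dvd (hT : ∀ s i, T s (X i) = ∑ j, C (A s i j) * X j)
    {p : MvPolynomial ι ℝ} (hp0 : constantCoeff p = 1) (s : τ) (h : p ∣ T s p) : T s p = 0 := by
  refine derivation_dvd_eq_zero hp0 ?_ h ?_
  · refine totalDegree_derivation_le (n := 0) (T s) (fun i => ?_) p
    rw [hT]
    refine totalDegree_finsetSum_le fun j _ => (totalDegree_mul _ _).trans ?_
    rw [totalDegree_C, totalDegree_X]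
  · rw [derivation_eq_sum, map_sum]
    refine Finset.sum_eq_zero fun i _ => ?_
    rw [hT, map_mul, map_sum]
    simp

/-- The gradient at the origin transforms by the transpose of `A s`; for `T s p = 0` it is an
invariant covector. The next lemma does the same for the Hessian. -/
theorem constantCoeff_pderiv_linear (hT : ∀ s i, T s (X i) = ∑ j, C (A s i j) * X j)
    (p : MvPolynomial ι ℝ) (s : τ) (j : ι) :
    constantCoeff (pderiv j (T s p)) = ∑ i, A s i j * constantCoeff (pderiv i p) := by
  classical
  rw [derivation_eq_sum (T s) p, map_sum, map_sum]
  refine Finset.sum_congr rfl fun i _ => ?_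
  rw [hT, Derivation.leibniz, map_add, smul_eq_mul, smul_eq_mul, map_mul, map_mul]
  simp [pderiv_X, Pi.single_apply, mul_comm]

theorem constantCoeff_pderiv_pderiv_linear (hT : ∀ s i, T s (X i) = ∑ j, C (A s i j) * X j)
    (p : MvPolynomial ι ℝ) (s : τ) (j k : ι) :
    constantCoeff (pderiv k (pderiv j (T s p))) =
      ∑ i, A s i j * constantCoeff (pderiv k (pderiv i p)) +
        ∑ i, A s i k * constantCoeff (pderiv j (pderiv i p)) := by
  classical
  rw [derivation_eq_sum (T s) p, map_sum, map_sum, map_sum, ← Finset.sum_add_distrib]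
  refine Finset.sum_congr rfl fun i _ => ?_
  have e : ∀ l, pderiv l (T s (X i)) = C (A s i l) := fun l => by
    rw [hT]
    simp [pderiv_X, Pi.single_apply]
  have e0 : constantCoeff (T s (X i)) = 0 := by
    rw [hT]
    simp
  simp only [Derivation.leibniz, smul_eq_mul, map_add, map_mul, e, e0, pderiv_C]
  simp
  ring

/-- The matrix of the fields is the identity at the origin, so its determinant is a nonzero
polynomial, and a 1-form `θ` annihilated by all the fields vanishes. -/
theorem eq_zero_of_frame [DecidableEq ι]
    (hL0 : ∀ k i, constantCoeff (L k (X i)) = if i = k then 1 else 0)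
    (θ : ι → MvPolynomial ι ℝ) (hθ : ∀ k, ∑ i, L k (X i) * θ i = 0) : θ = 0 := by
  let M : Matrix ι ι (MvPolynomial ι ℝ) := Matrix.of fun k i => L k (X i)
  have hM : M.det ≠ 0 := by
    intro h
    have h1 : constantCoeff M.det = 0 := by rw [h, map_zero]
    rw [RingHom.map_det] at h1
    have h2 : (constantCoeff : MvPolynomial ι ℝ →+* ℝ).mapMatrix M = 1 := by
      ext k i
      simp [M, hL0, Matrix.one_apply, eq_comm]
    rw [h2, Matrix.det_one] at h1
    exact one_ne_zero h1
  exact Matrix.eq_zero_of_mulVec_eq_zero hM (_root_.funext hθ)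

variable {L T A}

/-- A prime factor of a polynomial which is invariant under the linear fields `T` and an eigenvector
of the fields `L`. -/
theorem Prime.derivation_eq [DecidableEq ι]
    (hLdeg : ∀ k i, (L k (X i)).totalDegree ≤ 2)
    (hL0 : ∀ k i, constantCoeff (L k (X i)) = if i = k then 1 else 0)
    (hT : ∀ s i, T s (X i) = ∑ j, C (A s i j) * X j)
    (inv1 : ∀ a : ι → ℝ, (∀ s j, ∑ i, A s i j * a i = 0) → a = 0)
    {b₀ : ι → ι → ℝ} (inv2 : ∀ b : ι → ι → ℝ, (∀ j k, b j k = b k j) →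
      (∀ s j k, ∑ i, A s i j * b k i + ∑ i, A s i k * b j i = 0) →
      ∃ γ : ℝ, ∀ j k, b j k = γ * b₀ j k)
    {p D : MvPolynomial ι ℝ} (hp : Prime p) (hp0 : constantCoeff p = 1) (hpD : p ∣ D)
    (hD : D ≠ 0) (hDL : ∀ k, D ∣ L k D) (hDT : ∀ s, D ∣ T s D) :
    ∃ (γ : ℝ) (c : ι → MvPolynomial ι ℝ), (∀ k, L k p = c k * p) ∧
      (∀ k, (c k).totalDegree ≤ 1) ∧ (∀ k, constantCoeff (c k) = 0) ∧
      ∀ k j, constantCoeff (pderiv j (c k)) = γ * b₀ j k := by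
  have hTp : ∀ s, T s p = 0 := fun s => derivation_eq_zero_of_dvd T A hT hp0 s
    (Prime.dvd_derivation (T s) hp hD hpD (hDT s))
  have h1 : ∀ i, constantCoeff (pderiv i p) = 0 := by
    refine congrFun (inv1 (fun i => constantCoeff (pderiv i p)) fun s j => ?_)
    rw [← constantCoeff_pderiv_linear T A hT, hTp, map_zero, map_zero]
  have hcomm : ∀ j k, pderiv j (pderiv k p) = pderiv k (pderiv j p) := fun j k => by
    ext m
    simp only [coeff_pderiv]
    by_cases hjk : j = k
    · rw [hjk]
    · rw [add_right_comm]
      simp [hjk, Ne.symm hjk]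
      ring
  obtain ⟨γ, hγ⟩ := inv2 (fun j k => constantCoeff (pderiv j (pderiv k p)))
    (fun j k => by rw [hcomm]) (fun s j k => by
      rw [← constantCoeff_pderiv_pderiv_linear T A hT, hTp, map_zero, map_zero, map_zero])
  choose c hc using fun k => Prime.dvd_derivation (L k) hp hD hpD (hDL k)
  -- At the origin `L k` is `∂ₖ`, `p` has value `1` and its gradient vanishes.
  have hcoef : ∀ k, constantCoeff (c k) = 0 := fun k => by
    have h := congrArg constantCoeff (hc k)
    rw [map_mul, hp0, one_mul, derivation_eq_sum, map_sum] at h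
    rw [← h]
    exact Finset.sum_eq_zero fun i _ => by rw [map_mul, h1, mul_zero]
  refine ⟨γ, c, fun k => by rw [hc, mul_comm], fun k => ?_, hcoef, fun k j => ?_⟩
  · by_cases h : c k = 0
    · simp [h]
    · have h2 := totalDegree_derivation_le (n := 1) (L k) (hLdeg k) p
      rw [hc, totalDegree_mul_of_isDomain hp.ne_zero h] at h2
      omega
  -- Comparing linear terms in `L k p = p * c k`: since `p` has constant term `1` and no linear
  -- term, the linear part of `c k` is a row of the Hessian of `p` at the origin.
  · have h := congrArg (fun q => constantCoeff (pderiv j q)) (hc k)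
    simp only [Derivation.leibniz, smul_eq_mul, map_add, map_mul, hp0, hcoef, one_mul,
      zero_mul, add_zero] at h
    rw [← h, derivation_eq_sum (L k) p, map_sum, map_sum, Finset.sum_eq_single k]
    · simp [Derivation.leibniz, hL0, h1, hγ]
    · intro i _ hik
      simp [Derivation.leibniz, hL0, hik, h1]
    · simp

/-- A polynomial that is an eigenvector of a generically transitive family of quadratic vector
fields and of a family of linear vector fields with an essentially unique invariant symmetric
bilinear form is a power of an irreducible polynomial. -/
theorem exists_eq_pow_irreducible [DecidableEq ι]
    (hLdeg : ∀ k i, (L k (X i)).totalDegree ≤ 2)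
    (hL0 : ∀ k i, constantCoeff (L k (X i)) = if i = k then 1 else 0)
    (hT : ∀ s i, T s (X i) = ∑ j, C (A s i j) * X j)
    (inv1 : ∀ a : ι → ℝ, (∀ s j, ∑ i, A s i j * a i = 0) → a = 0)
    {b₀ : ι → ι → ℝ} (inv2 : ∀ b : ι → ι → ℝ, (∀ j k, b j k = b k j) →
      (∀ s j k, ∑ i, A s i j * b k i + ∑ i, A s i k * b j i = 0) →
      ∃ γ : ℝ, ∀ j k, b j k = γ * b₀ j k)
    {D : MvPolynomial ι ℝ} (hD0 : constantCoeff D = 1)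
    (hDL : ∀ k, D ∣ L k D) (hDT : ∀ s, D ∣ T s D) (hDu : ¬ IsUnit D) :
    ∃ (p : MvPolynomial ι ℝ) (k : ℕ), Irreducible p ∧ 0 < k ∧ D = p ^ k := by
  have hD : D ≠ 0 := by
    rintro rfl
    simp at hD0
  have hnorm : ∀ {p : MvPolynomial ι ℝ}, Irreducible p → p ∣ D →
      ∃ p' : MvPolynomial ι ℝ, Associated p p' ∧ constantCoeff p' = 1 := by
    rintro p - ⟨q, rfl⟩
    rw [map_mul] at hD0
    have hp0 : constantCoeff p ≠ 0 := left_ne_zero_of_mul_eq_one hD0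
    refine ⟨p * C (constantCoeff p)⁻¹, ?_, by simp [hp0]⟩
    exact associated_mul_unit_right _ _ ((isUnit_iff_ne_zero.2 (inv_ne_zero hp0)).map C)
  -- The cofactors satisfy `γ' c = γ c'`, so the 1-form `γ' p' dp - γ p dp'` is annihilated by the
  -- frame and vanishes. Hence `p` divides `p' ∂ᵢ p` for some nonzero `∂ᵢ p`, which `p` cannot
  -- divide for reasons of degree.
  have key : ∀ {p p' : MvPolynomial ι ℝ}, Irreducible p → Irreducible p' →
      constantCoeff p = 1 → constantCoeff p' = 1 → p ∣ D → p' ∣ D → p ∣ p' := by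
    intro p p' hp hp' hp0 hp0' hpD hpD'
    obtain ⟨γ, c, hc, hcdeg, hc0, hc1⟩ :=
      Prime.derivation_eq hLdeg hL0 hT inv1 inv2 hp.prime hp0 hpD hD hDL hDT
    obtain ⟨γ', c', hc', hcdeg', hc0', hc1'⟩ :=
      Prime.derivation_eq hLdeg hL0 hT inv1 inv2 hp'.prime hp0' hpD' hD hDL hDT
    have hne : ∃ i, pderiv i p ≠ 0 := by
      by_contra! h
      refine hp.not_isUnit ?_
      rw [eq_C_of_pderiv_eq_zero p h, hp0]
      simp
    have hne' : ∃ i, pderiv i p' ≠ 0 := by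
      by_contra! h
      refine hp'.not_isUnit ?_
      rw [eq_C_of_pderiv_eq_zero p' h, hp0']
      simp
    -- For `γ' = 0` the cofactors of `p'` vanish, so the frame kills `p'` and `p'` is constant.
    have hγ' : γ' ≠ 0 := by
      rintro rfl
      obtain ⟨i, hi⟩ := hne'
      refine hi (congrFun (eq_zero_of_frame L hL0 (fun i => pderiv i p') fun k => ?_) i)
      rw [← derivation_eq_sum, hc', eq_zero_of_totalDegree_le_one (hcdeg' k) (hc0' k)
        (fun j => by rw [hc1', zero_mul]), zero_mul]
    have hr : ∀ k, C γ' * c k = C γ * c' k := fun k => by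
      rw [← sub_eq_zero]
      refine eq_zero_of_totalDegree_le_one ?_ (by simp [hc0, hc0']) fun j => ?_
      · refine (totalDegree_sub _ _).trans (max_le ?_ ?_) <;>
          refine (totalDegree_mul _ _).trans ?_ <;> simp [hcdeg, hcdeg']
      · simp [hc1, hc1']
        ring
    have hθ := eq_zero_of_frame L hL0
      (fun i => C γ' * p' * pderiv i p - C γ * p * pderiv i p') fun k => by
        have e : ∀ i, L k (X i) * (C γ' * p' * pderiv i p - C γ * p * pderiv i p') =
            C γ' * p' * (L k (X i) * pderiv i p) - C γ * p * (L k (X i) * pderiv i p') :=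
          fun i => by ring
        simp only [e, Finset.sum_sub_distrib, ← Finset.mul_sum]
        rw [← derivation_eq_sum, ← derivation_eq_sum, hc, hc']
        linear_combination p * p' * hr k
    obtain ⟨i, hi⟩ := hne
    have h1 : C γ' * p' * pderiv i p = C γ * p * pderiv i p' := sub_eq_zero.1 (congrFun hθ i)
    have h2 : p ∣ C γ' * (p' * pderiv i p) := ⟨C γ * pderiv i p', by linear_combination h1⟩
    have h3 : p ∣ p' * pderiv i p :=
      (((isUnit_iff_ne_zero.2 hγ').map C).dvd_mul_left).1 h2
    exact (hp.prime.dvd_or_dvd h3).resolve_right fun h => hi (pderiv_eq_zero_of_dvd h)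
  obtain ⟨p₁, hp₁, hpD₁⟩ := WfDvdMonoid.exists_irreducible_factor hDu hD
  obtain ⟨p, hass, hp0⟩ := hnorm hp₁ hpD₁
  have hp : Irreducible p := hass.irreducible hp₁
  have hpD : p ∣ D := hass.symm.dvd.trans hpD₁
  obtain ⟨q, hq, hpq⟩ :=
    (FiniteMultiplicity.of_prime_left hp.prime hD).exists_eq_pow_mul_and_not_dvd
  have hqu : IsUnit q := by
    by_contra h
    obtain ⟨p₂, hp₂, hpq₂⟩ := WfDvdMonoid.exists_irreducible_factor h
      (right_ne_zero_of_mul (hq ▸ hD))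
    have hpD₂ : p₂ ∣ D := hpq₂.trans (hq ▸ Dvd.intro_left _ rfl)
    obtain ⟨p', hass', hp0'⟩ := hnorm hp₂ hpD₂
    exact hpq (((key hp (hass'.irreducible hp₂) hp0 hp0' hpD
      (hass'.symm.dvd.trans hpD₂)).trans hass'.symm.dvd).trans hpq₂)
  have hq1 : q = 1 := by
    obtain ⟨u, -, hu⟩ := (isUnit_iff_eq_C_of_isReduced).1 hqu
    have h := congrArg constantCoeff hq
    rw [hD0, map_mul, map_pow, hp0, hu] at h
    rw [hu]
    simp at h
    rw [← h, C_1]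
  rw [hq1, mul_one] at hq
  refine ⟨p, _, hp, Nat.pos_of_ne_zero fun h => hDu ?_, hq⟩
  rw [hq, h, pow_zero]
  exact isUnit_one

end Homogeneous

end MvPolynomial

/-! ### Graded simple Lie algebras and invariant forms -/

namespace ParaHermitian

/-- A simple real Lie algebra `𝔤` graded by an element `Z` with `(ad Z)³ = ad Z` such that the
centralizer of `Z` has centre `ℝ Z`; `m` and `p` are the `-1`- and `+1`-eigenspaces of `ad Z`. -/
structure IsGraded {𝔤 : Type*} [LieRing 𝔤] [LieAlgebra ℝ 𝔤] (Z : 𝔤) (m p : Submodule ℝ 𝔤) :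
    Prop where
  simple : LieAlgebra.IsSimple ℝ 𝔤
  mem_m : ∀ X : 𝔤, X ∈ m ↔ ⁅Z, X⁆ = -X
  mem_p : ∀ X : 𝔤, X ∈ p ↔ ⁅Z, X⁆ = X
  cube : ∀ X : 𝔤, ⁅Z, ⁅Z, ⁅Z, X⁆⁆⁆ = ⁅Z, X⁆
  center : ∀ W : 𝔤, ⁅Z, W⁆ = 0 → (∀ Y : 𝔤, ⁅Z, Y⁆ = 0 → ⁅W, Y⁆ = 0) → ∃ c : ℝ, W = c • Z
  ne_zero : Z ≠ 0

namespace IsGraded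

variable {𝔤 : Type*} [LieRing 𝔤] [LieAlgebra ℝ 𝔤] {Z : 𝔤} {m p : Submodule ℝ 𝔤}

theorem lie_lie_of_weight {X Y : 𝔤} {a b : ℝ} (hX : ⁅Z, X⁆ = a • X) (hY : ⁅Z, Y⁆ = b • Y) :
    ⁅Z, ⁅X, Y⁆⁆ = (a + b) • ⁅X, Y⁆ := by
  rw [leibniz_lie, hX, hY, smul_lie, lie_smul, add_smul]

variable (h : IsGraded Z m p)
include h

/-- The relation `(ad Z)³ = ad Z` on an eigenvector gives `a³ = a`. The absence of the weights `±2`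
makes `m` and `p` abelian. -/
theorem eq_zero_of_weight {X : 𝔤} {a : ℝ} (hX : ⁅Z, X⁆ = a • X) (ha : a ^ 3 ≠ a) : X = 0 := by
  have h1 := h.cube X
  simp only [hX, lie_smul, smul_smul] at h1
  rw [← sub_eq_zero, ← sub_smul] at h1
  refine (smul_eq_zero.1 h1).resolve_left fun h2 => ha ?_
  linarith

theorem weight_m {X : 𝔤} (hX : X ∈ m) : ⁅Z, X⁆ = (-1 : ℝ) • X := by
  rw [(h.mem_m X).1 hX, neg_one_smul]

theorem weight_p {X : 𝔤} (hX : X ∈ p) : ⁅Z, X⁆ = (1 : ℝ) • X := by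
  rw [(h.mem_p X).1 hX, one_smul]

theorem mem_m_of_weight {X : 𝔤} {a : ℝ} (hX : ⁅Z, X⁆ = a • X) (ha : a = -1) : X ∈ m := by
  rw [h.mem_m, hX, ha, neg_one_smul]

theorem mem_p_of_weight {X : 𝔤} {a : ℝ} (hX : ⁅Z, X⁆ = a • X) (ha : a = 1) : X ∈ p := by
  rw [h.mem_p, hX, ha, one_smul]

omit h in
theorem weight_zero {X : 𝔤} (hX : ⁅Z, X⁆ = 0) : ⁅Z, X⁆ = (0 : ℝ) • X := by
  rw [hX, zero_smul]

theorem lie_m_p {v u : 𝔤} (hv : v ∈ m) (hu : u ∈ p) : ⁅Z, ⁅v, u⁆⁆ = 0 := by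
  rw [lie_lie_of_weight (h.weight_m hv) (h.weight_p hu)]
  simp

theorem lie_p_m {v u : 𝔤} (hv : v ∈ m) (hu : u ∈ p) : ⁅Z, ⁅u, v⁆⁆ = 0 := by
  rw [lie_lie_of_weight (h.weight_p hu) (h.weight_m hv)]
  simp

theorem lie_p_p {v u : 𝔤} (hv : v ∈ p) (hu : u ∈ p) : ⁅v, u⁆ = 0 :=
  h.eq_zero_of_weight (lie_lie_of_weight (h.weight_p hv) (h.weight_p hu)) (by norm_num)

theorem lie_m_m {v u : 𝔤} (hv : v ∈ m) (hu : u ∈ m) : ⁅v, u⁆ = 0 :=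
  h.eq_zero_of_weight (lie_lie_of_weight (h.weight_m hv) (h.weight_m hu)) (by norm_num)

theorem lie_zero_p {T u : 𝔤} (hT : ⁅Z, T⁆ = 0) (hu : u ∈ p) : ⁅T, u⁆ ∈ p :=
  h.mem_p_of_weight (lie_lie_of_weight (weight_zero hT) (h.weight_p hu)) (by norm_num)

theorem lie_zero_m {T u : 𝔤} (hT : ⁅Z, T⁆ = 0) (hu : u ∈ m) : ⁅T, u⁆ ∈ m :=
  h.mem_m_of_weight (lie_lie_of_weight (weight_zero hT) (h.weight_m hu)) (by norm_num)

theorem lie_m_zero {T u : 𝔤} (hT : ⁅Z, T⁆ = 0) (hu : u ∈ m) : ⁅u, T⁆ ∈ m := by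
  rw [← lie_skew]
  exact m.neg_mem (h.lie_zero_m hT hu)

theorem lie_p_zero {T u : 𝔤} (hT : ⁅Z, T⁆ = 0) (hu : u ∈ p) : ⁅u, T⁆ ∈ p := by
  rw [← lie_skew]
  exact p.neg_mem (h.lie_zero_p hT hu)

/-- The projection onto `p` along the other eigenspaces of `ad Z`. -/
noncomputable def projP : 𝔤 →ₗ[ℝ] p :=
  LinearMap.codRestrict p ((1 / 2 : ℝ) • (LieAlgebra.ad ℝ 𝔤 Z * LieAlgebra.ad ℝ 𝔤 Z +
    LieAlgebra.ad ℝ 𝔤 Z)) fun X => by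
    rw [h.mem_p]
    simp only [LinearMap.smul_apply, LinearMap.add_apply, Module.End.mul_apply,
      LieAlgebra.ad_apply, lie_smul, lie_add, h.cube]
    rw [add_comm]

/-- The projection onto `m` along the other eigenspaces of `ad Z`. -/
noncomputable def projM : 𝔤 →ₗ[ℝ] m :=
  LinearMap.codRestrict m ((1 / 2 : ℝ) • (LieAlgebra.ad ℝ 𝔤 Z * LieAlgebra.ad ℝ 𝔤 Z -
    LieAlgebra.ad ℝ 𝔤 Z)) fun X => by
    rw [h.mem_m]
    simp only [LinearMap.smul_apply, LinearMap.sub_apply, Module.End.mul_apply,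
      LieAlgebra.ad_apply, lie_smul, lie_sub, h.cube]
    rw [← smul_neg, neg_sub]

theorem coe_projP (X : 𝔤) : (h.projP X : 𝔤) = (1 / 2 : ℝ) • (⁅Z, ⁅Z, X⁆⁆ + ⁅Z, X⁆) := rfl

theorem coe_projM (X : 𝔤) : (h.projM X : 𝔤) = (1 / 2 : ℝ) • (⁅Z, ⁅Z, X⁆⁆ - ⁅Z, X⁆) := rfl

theorem projP_p {X : 𝔤} (hX : X ∈ p) : (h.projP X : 𝔤) = X := by
  rw [coe_projP, (h.mem_p X).1 hX, (h.mem_p X).1 hX]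
  module

theorem projP_m {X : 𝔤} (hX : X ∈ m) : h.projP X = 0 := by
  ext
  rw [coe_projP, (h.mem_m X).1 hX, lie_neg, (h.mem_m X).1 hX]
  simp

theorem projP_zero {X : 𝔤} (hX : ⁅Z, X⁆ = 0) : h.projP X = 0 := by
  ext
  simp [coe_projP, hX]

theorem projM_m {X : 𝔤} (hX : X ∈ m) : (h.projM X : 𝔤) = X := by
  rw [coe_projM, (h.mem_m X).1 hX, lie_neg, (h.mem_m X).1 hX]
  module

theorem projM_p {X : 𝔤} (hX : X ∈ p) : h.projM X = 0 := by
  ext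
  rw [coe_projM, (h.mem_p X).1 hX, (h.mem_p X).1 hX]
  simp

/-- Every element is the sum of its components of weight `-1`, `0` and `1`. -/
theorem exists_decomp (X : 𝔤) :
    ∃ v ∈ m, ∃ T, ⁅Z, T⁆ = 0 ∧ ∃ u ∈ p, X = v + T + u := by
  refine ⟨h.projM X, (h.projM X).2, X - ⁅Z, ⁅Z, X⁆⁆, ?_, h.projP X, (h.projP X).2, ?_⟩
  · rw [lie_sub, h.cube, sub_self]
  · rw [coe_projM, coe_projP]
    module

theorem eq_zero_of_central {X : 𝔤} (hX : ∀ Y : 𝔤, ⁅X, Y⁆ = 0) : X = 0 := by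
  have := h.simple
  have h1 : X ∈ LieAlgebra.center ℝ 𝔤 := by
    rw [LieModule.mem_maxTrivSubmodule]
    intro Y
    rw [← lie_skew, hX, neg_zero]
  rwa [LieAlgebra.center_eq_bot, LieSubmodule.mem_bot] at h1

/-- The space of weight-zero elements is spanned by brackets. -/
theorem mem_span_lie {T : 𝔤} (hT : ⁅Z, T⁆ = 0) :
    T ∈ Submodule.span ℝ {y : 𝔤 | ∃ v ∈ m, ∃ u ∈ p, y = ⁅v, u⁆} := by
  set K := Submodule.span ℝ {y : 𝔤 | ∃ v ∈ m, ∃ u ∈ p, y = ⁅v, u⁆} with hK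
  have hvu : ∀ v ∈ m, ∀ u ∈ p, ⁅v, u⁆ ∈ K := fun v hv u hu =>
    Submodule.subset_span ⟨v, hv, u, hu, rfl⟩
  have huv : ∀ v ∈ m, ∀ u ∈ p, ⁅u, v⁆ ∈ K := fun v hv u hu => by
    rw [← lie_skew]
    exact K.neg_mem (hvu v hv u hu)
  have hTK : ∀ T : 𝔤, ⁅Z, T⁆ = 0 → ∀ y ∈ K, ⁅T, y⁆ ∈ K := fun T hT y hy => by
    induction hy using Submodule.span_induction with
    | mem y hy =>
      obtain ⟨v, hv, u, hu, rfl⟩ := hy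
      rw [leibniz_lie]
      exact K.add_mem (hvu _ (h.lie_zero_m hT hv) _ hu) (hvu _ hv _ (h.lie_zero_p hT hu))
    | zero => simp
    | add x y _ _ hx hy => rw [lie_add]; exact K.add_mem hx hy
    | smul c x _ hx => rw [lie_smul]; exact K.smul_mem c hx
  -- `π` is the projection to weight zero, so the preimage of `K` is `m + K + p`. It is an ideal
  -- containing the image of `ad Z`, which is not zero since `Z` is not central; by simplicity it is
  -- everything.
  let π : 𝔤 →ₗ[ℝ] 𝔤 := LinearMap.id - LieAlgebra.ad ℝ 𝔤 Z * LieAlgebra.ad ℝ 𝔤 Z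
  have hπ : ∀ x, π x = x - ⁅Z, ⁅Z, x⁆⁆ := fun x => rfl
  have hπ0 : ∀ x, ⁅Z, x⁆ = 0 → π x = x := fun x hx => by rw [hπ, hx]; simp
  have hπm : ∀ x ∈ m, π x = 0 := fun x hx => by
    rw [hπ, (h.mem_m x).1 hx, lie_neg, (h.mem_m x).1 hx]; simp
  have hπp : ∀ x ∈ p, π x = 0 := fun x hx => by
    rw [hπ, (h.mem_p x).1 hx, (h.mem_p x).1 hx]; simp
  let I : LieIdeal ℝ 𝔤 :=
    { K.comap π with
      lie_mem := by
        intro y x hx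
        obtain ⟨v, hv, T, hT, u, hu, rfl⟩ := h.exists_decomp x
        obtain ⟨v', hv', T', hT', u', hu', rfl⟩ := h.exists_decomp y
        have hT2 : T ∈ K := by
          have : π (v + T + u) ∈ K := hx
          rwa [map_add, map_add, hπm v hv, hπp u hu, hπ0 T hT, zero_add, add_zero] at this
        have hTT : ⁅Z, ⁅T', T⁆⁆ = 0 := by
          rw [leibniz_lie, hT, hT']
          simp
        change π _ ∈ K
        simp only [lie_add, add_lie, map_add, h.lie_m_m hv' hv, h.lie_p_p hu' hu,
          hπm _ (h.lie_zero_m hT' hv), hπm _ (h.lie_m_zero hT hv'), hπp _ (h.lie_zero_p hT' hu),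
          hπp _ (h.lie_p_zero hT hu'), hπ0 _ (h.lie_p_m hv hu'), hπ0 _ (h.lie_m_p hv' hu),
          hπ0 _ hTT, zero_add, add_zero]
        exact K.add_mem (K.add_mem (huv v hv u' hu') (hTK T' hT' T hT2)) (hvu v' hv' u hu) }
  have hI : ∀ x, x ∈ I ↔ π x ∈ K := fun x => Iff.rfl
  have := h.simple
  rcases LieAlgebra.IsSimple.eq_bot_or_eq_top (R := ℝ) I with hb | ht
  · exfalso
    refine h.ne_zero (h.eq_zero_of_central fun Y => ?_)
    have : ⁅Z, Y⁆ ∈ I := by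
      rw [hI, hπ, h.cube, sub_self]
      exact K.zero_mem
    rwa [hb, LieSubmodule.mem_bot] at this
  · have : T ∈ I := by rw [ht]; exact LieSubmodule.mem_top T
    rwa [hI, hπ0 T hT] at this

variable [FiniteDimensional ℝ 𝔤]

omit h in
omit [FiniteDimensional ℝ 𝔤] in
theorem killing_eq_zero {X Y : 𝔤} {a b : ℝ} (hX : ⁅Z, X⁆ = a • X) (hY : ⁅Z, Y⁆ = b • Y)
    (hab : a + b ≠ 0) : killingForm ℝ 𝔤 X Y = 0 := by
  have h1 := LieModule.traceForm_apply_lie_apply' ℝ 𝔤 𝔤 Z X Y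
  rw [hX, hY, map_smul, LinearMap.smul_apply, map_smul, smul_eq_mul, smul_eq_mul] at h1
  have h2 : (a + b) * killingForm ℝ 𝔤 X Y = 0 := by linear_combination h1
  exact (mul_eq_zero.1 h2).resolve_left hab

/-- The radical of the Killing form is an ideal. If it were everything, the idempotent `(ad Z)²`
would have trace zero and hence vanish; then `ad Z = (ad Z)³ = 0`, making `Z` central. -/
theorem eq_zero_of_killing {X : 𝔤} (hX : ∀ Y, killingForm ℝ 𝔤 X Y = 0) : X = 0 := by
  have := h.simple
  have hmem : X ∈ LieIdeal.killingCompl ℝ 𝔤 ⊤ := by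
    rw [LieIdeal.mem_killingCompl]
    intro Y _
    rw [LieModule.traceForm_comm]
    exact hX Y
  rcases LieAlgebra.IsSimple.eq_bot_or_eq_top (R := ℝ) (LieIdeal.killingCompl ℝ 𝔤 ⊤) with hb | ht
  · rwa [hb, LieSubmodule.mem_bot] at hmem
  · exfalso
    have hZ : Z ∈ LieIdeal.killingCompl ℝ 𝔤 ⊤ := by rw [ht]; exact LieSubmodule.mem_top Z
    rw [LieIdeal.mem_killingCompl] at hZ
    have h1 := hZ Z (LieSubmodule.mem_top Z)
    rw [killingForm_apply_apply] at h1
    have hidem : IsIdempotentElem (LieAlgebra.ad ℝ 𝔤 Z ∘ₗ LieAlgebra.ad ℝ 𝔤 Z) := by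
      ext Y
      simp [h.cube]
    have h2 := (LinearMap.IsIdempotentElem.trace_eq_zero_iff hidem).1 h1
    refine h.ne_zero (h.eq_zero_of_central fun Y => ?_)
    rw [← h.cube]
    exact LinearMap.congr_fun h2 ⁅Z, Y⁆

/-- By invariance `T` is Killing-orthogonal to all `⁅v, u⁆`, which span the weight-zero part;
orthogonality to `m` and `p` is a matter of weights. -/
theorem eq_zero_of_lie_p_eq_zero {T : 𝔤} (hT : ⁅Z, T⁆ = 0) (hTp : ∀ u ∈ p, ⁅T, u⁆ = 0) :
    T = 0 := by
  refine h.eq_zero_of_killing fun Y => ?_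
  obtain ⟨v, hv, T', hT', u, hu, rfl⟩ := h.exists_decomp Y
  have h1 : killingForm ℝ 𝔤 T T' = 0 := by
    have hT'' := h.mem_span_lie hT'
    clear hT'
    induction hT'' using Submodule.span_induction with
    | mem y hy =>
      obtain ⟨v, hv, u, hu, rfl⟩ := hy
      rw [← LieModule.traceForm_apply_lie_apply, LieModule.traceForm_apply_lie_apply', hTp u hu,
        map_zero, neg_zero]
    | zero => simp
    | add x y _ _ hx hy => rw [map_add, hx, hy, add_zero]
    | smul c x _ hx => rw [map_smul, hx, smul_zero]
  rw [map_add, map_add, h1, killing_eq_zero (weight_zero hT) (h.weight_m hv) (by norm_num),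
    killing_eq_zero (weight_zero hT) (h.weight_p hu) (by norm_num), add_zero, add_zero]

theorem eq_zero_of_killing_p {v : 𝔤} (hv : v ∈ m) (hvp : ∀ u ∈ p, killingForm ℝ 𝔤 v u = 0) :
    v = 0 := by
  refine h.eq_zero_of_killing fun Y => ?_
  obtain ⟨v', hv', T', hT', u, hu, rfl⟩ := h.exists_decomp Y
  rw [map_add, map_add, killing_eq_zero (h.weight_m hv) (weight_zero hT') (by norm_num),
    killing_eq_zero (h.weight_m hv) (h.weight_m hv') (by norm_num), hvp u hu, add_zero, add_zero]

theorem eq_zero_of_killing_m {u : 𝔤} (hu : u ∈ p) (hvp : ∀ v ∈ m, killingForm ℝ 𝔤 v u = 0) :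
    u = 0 := by
  refine h.eq_zero_of_killing fun Y => ?_
  obtain ⟨v, hv, T', hT', u', hu', rfl⟩ := h.exists_decomp Y
  rw [map_add, map_add, killing_eq_zero (h.weight_p hu) (weight_zero hT') (by norm_num),
    killing_eq_zero (h.weight_p hu) (h.weight_p hu') (by norm_num), LieModule.traceForm_comm,
    hvp v hv, add_zero, add_zero]

/-- An endomorphism of `p` that commutes with the weight-zero elements is a scalar. -/
theorem exists_eq_smul_of_commute (A : p →ₗ[ℝ] p)
    (hA : ∀ T : 𝔤, ⁅Z, T⁆ = 0 → ∀ u : p, (A (h.projP ⁅T, (u : 𝔤)⁆) : 𝔤) = ⁅T, (A u : 𝔤)⁆) :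
    ∃ c : ℝ, ∀ u, A u = c • u := by
  -- As `p` is abelian, `⁅⁅v, u⁆, u'⁆` is symmetric in `u` and `u'`. Letting `A` act through either
  -- argument gives `A ∘ ad ⁅v, u⁆ = ad ⁅v, A u⁆` on `p`, so `A ∘ ad y` is again given by a
  -- weight-zero element.
  have key : ∀ y, y ∈ Submodule.span ℝ {y : 𝔤 | ∃ v ∈ m, ∃ u ∈ p, y = ⁅v, u⁆} →
      ∃ T : 𝔤, ⁅Z, T⁆ = 0 ∧ ∀ u : p, ⁅T, (u : 𝔤)⁆ = A (h.projP ⁅y, (u : 𝔤)⁆) := by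
    intro y hy
    induction hy using Submodule.span_induction with
    | mem y hy =>
      obtain ⟨v, hv, u, hu, rfl⟩ := hy
      refine ⟨⁅v, (A ⟨u, hu⟩ : 𝔤)⁆, h.lie_m_p hv (A ⟨u, hu⟩).2, fun u' => ?_⟩
      have e : ∀ w ∈ p, ⁅⁅v, w⁆, (u' : 𝔤)⁆ = ⁅⁅v, (u' : 𝔤)⁆, w⁆ := fun w hw => by
        have h1 := leibniz_lie v w (u' : 𝔤)
        rw [h.lie_p_p hw u'.2, lie_zero, ← lie_skew w] at h1
        exact add_neg_eq_zero.1 h1.symm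
      rw [e _ (A ⟨u, hu⟩).2, ← hA _ (h.lie_m_p hv u'.2), e u hu]
    | zero => exact ⟨0, by simp, fun u => by simp⟩
    | add x y _ _ hx hy =>
      obtain ⟨T, hT, e⟩ := hx
      obtain ⟨T', hT', e'⟩ := hy
      refine ⟨T + T', by rw [lie_add, hT, hT', add_zero], fun u => ?_⟩
      rw [add_lie, e, e', add_lie, map_add, map_add, Submodule.coe_add]
    | smul c x _ hx =>
      obtain ⟨T, hT, e⟩ := hx
      refine ⟨c • T, by rw [lie_smul, hT, smul_zero], fun u => ?_⟩
      rw [smul_lie, e, smul_lie, map_smul, map_smul, Submodule.coe_smul]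
  -- For `y = Z` this exhibits `A` itself as `ad T`. Brackets of `T` with weight-zero elements kill
  -- `p`, hence vanish, and so `T` is a multiple of `Z`.
  obtain ⟨T, hT, e⟩ := key Z (h.mem_span_lie (lie_self Z))
  have e' : ∀ u : p, ⁅T, (u : 𝔤)⁆ = A u := fun u => by
    rw [e, (h.mem_p _).1 u.2]
    congr 2
    ext
    exact h.projP_p u.2
  obtain ⟨c, hc⟩ := h.center T hT fun s hs => by
    refine h.eq_zero_of_lie_p_eq_zero (by rw [leibniz_lie, hT, hs]; simp) fun u hu => ?_
    have h1 := hA s hs ⟨u, hu⟩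
    rw [← e', ← e', h.projP_p (h.lie_zero_p hs hu)] at h1
    rw [lie_lie, h1, sub_self]
  refine ⟨c, fun u => ?_⟩
  ext
  rw [← e', hc, smul_lie, (h.mem_p _).1 u.2]
  rfl

/-- An invariant pairing of `m` and `p` is a multiple of the Killing form. -/
theorem exists_eq_mul_killing (β : LinearMap.BilinForm ℝ 𝔤)
    (hβ : ∀ T : 𝔤, ⁅Z, T⁆ = 0 → ∀ v ∈ m, ∀ u ∈ p, β ⁅T, v⁆ u + β v ⁅T, u⁆ = 0) :
    ∃ c : ℝ, ∀ v ∈ m, ∀ u ∈ p, β v u = c * killingForm ℝ 𝔤 v u := by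
  -- The Killing form pairs `m` and `p` perfectly, so `β` is the Killing form twisted by an
  -- endomorphism `A` of `p`; invariance of `β` makes `A` commute with the weight-zero elements.
  let res : LinearMap.BilinForm ℝ 𝔤 → p →ₗ[ℝ] Module.Dual ℝ m := fun γ =>
    (m.subtype.dualMap) ∘ₗ γ.flip ∘ₗ p.subtype
  have hres : ∀ γ u v, res γ u v = γ v u := fun _ _ _ => rfl
  have hinj : Function.Injective (res (killingForm ℝ 𝔤)) := by
    rw [← LinearMap.ker_eq_bot, LinearMap.ker_eq_bot']
    intro u hu
    ext
    exact h.eq_zero_of_killing_m u.2 fun v hv => LinearMap.congr_fun hu (⟨v, hv⟩ : m)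
  have hinj' : Function.Injective
      ((p.subtype.dualMap) ∘ₗ (killingForm ℝ 𝔤) ∘ₗ m.subtype : m →ₗ[ℝ] Module.Dual ℝ p) := by
    rw [← LinearMap.ker_eq_bot, LinearMap.ker_eq_bot']
    intro v hv
    ext
    exact h.eq_zero_of_killing_p v.2 fun u hu => LinearMap.congr_fun hv (⟨u, hu⟩ : p)
  have hdim : Module.finrank ℝ p = Module.finrank ℝ (Module.Dual ℝ m) := by
    refine le_antisymm (LinearMap.finrank_le_finrank_of_injective hinj) ?_
    have := LinearMap.finrank_le_finrank_of_injective hinj'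
    rwa [Subspace.dual_finrank_eq] at this ⊢
  let e : p ≃ₗ[ℝ] Module.Dual ℝ m :=
    LinearEquiv.ofInjectiveOfFinrankEq (res (killingForm ℝ 𝔤)) hinj hdim
  have he : ∀ u v, e u v = killingForm ℝ 𝔤 v u := fun u v => rfl
  let A : p →ₗ[ℝ] p := e.symm.toLinearMap ∘ₗ res β
  have hA : ∀ (v : m) (u : p), killingForm ℝ 𝔤 v (A u) = β v u := fun v u => by
    rw [← he]
    simp [A, hres]
  obtain ⟨c, hc⟩ := h.exists_eq_smul_of_commute A fun T hT u => by
    rw [← sub_eq_zero]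
    refine h.eq_zero_of_killing_m (p.sub_mem (A _).2 (h.lie_zero_p hT (A u).2)) fun v hv => ?_
    have h1 := hA ⟨v, hv⟩ (h.projP ⁅T, (u : 𝔤)⁆)
    rw [h.projP_p (h.lie_zero_p hT u.2)] at h1
    have h2 := hA ⟨⁅T, v⁆, h.lie_zero_m hT hv⟩ u
    have h3 := LieModule.traceForm_apply_lie_apply' ℝ 𝔤 𝔤 T v (A u)
    have h4 := hβ T hT v hv u u.2
    simp only at h1 h2
    rw [map_sub, h1]
    linarith
  refine ⟨c, fun v hv u hu => ?_⟩
  have h1 := hA ⟨v, hv⟩ ⟨u, hu⟩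
  rw [hc] at h1
  rw [← h1]
  simp

end IsGraded

end ParaHermitian

/-! ### The derivative of a determinant -/

section MatrixDerivation

open Matrix

/-- A derivation of a commutative ring as a homomorphism to the dual numbers. -/
def Derivation.toDualNumber {k R : Type*} [CommRing k] [CommRing R] [Algebra k R]
    (L : Derivation k R R) : R →+* DualNumber R where
  toFun a := TrivSqZeroExt.inl a + TrivSqZeroExt.inr (L a)
  map_one' := by ext <;> simp
  map_zero' := by ext <;> simp
  map_mul' a b := by ext <;> simp [mul_comm]
  map_add' a b := by ext <;> simp

/-- The derivative of the determinant of a matrix `M` that satisfies a linear equation. -/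
theorem Derivation.det_eq_of_map_eq {k R n : Type*} [CommRing k] [CommRing R] [Algebra k R]
    [Fintype n] [DecidableEq n] (L : Derivation k R R) (M A₁ A₂ : Matrix n n R)
    (h : M.map L = M * A₁ - A₂ * M) : L M.det = M.det * (A₁.trace - A₂.trace) := by
  have key : ∀ A : Matrix n n R, (1 + (DualNumber.eps : DualNumber R) •
      A.map (algebraMap R (DualNumber R))).det =
        1 + TrivSqZeroExt.inr A.trace := fun A => by
    rw [Matrix.det_one_add_smul, pow_two, DualNumber.eps_mul_eps, mul_zero, add_zero,
      show (A.map (algebraMap R (DualNumber R))).trace = algebraMap R (DualNumber R) A.trace from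
        (AddMonoidHom.map_trace (algebraMap R (DualNumber R)) A).symm]
    ext <;> simp [DualNumber.eps, TrivSqZeroExt.algebraMap_eq_inl, -DualNumber.inr_eq_smul_eps]
  -- Over the dual numbers the equation reads `M + ε L M = (1 - ε A₂) M (1 + ε A₁)`; the claim is
  -- the `ε`-coefficient of the determinants.
  have e : L.toDualNumber.mapMatrix M = (1 + (DualNumber.eps : DualNumber R) •
      (-A₂).map (algebraMap R (DualNumber R))) * (M.map (algebraMap R (DualNumber R))) *
      (1 + (DualNumber.eps : DualNumber R) • A₁.map (algebraMap R (DualNumber R))) := by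
    have h1 : L.toDualNumber.mapMatrix M = M.map (algebraMap R (DualNumber R)) +
        (DualNumber.eps : DualNumber R) • (M.map L).map (algebraMap R (DualNumber R)) := by
      ext i j <;> simp [Derivation.toDualNumber, DualNumber.eps, TrivSqZeroExt.algebraMap_eq_inl,
        -DualNumber.inr_eq_smul_eps]
    have h2 : (M.map L).map (algebraMap R (DualNumber R)) =
        M.map (algebraMap R (DualNumber R)) * A₁.map (algebraMap R (DualNumber R)) +
          (-A₂).map (algebraMap R (DualNumber R)) * M.map (algebraMap R (DualNumber R)) := by
      rw [h, ← Matrix.map_mul, ← Matrix.map_mul, ← Matrix.map_add _ (map_add _), neg_mul,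
        ← sub_eq_add_neg]
    rw [h1, h2]
    simp only [add_mul, mul_add, one_mul, mul_one, smul_mul_assoc, mul_smul_comm, smul_smul,
      DualNumber.eps_mul_eps, zero_smul, smul_add, add_zero]
    abel
  have h3 := congrArg Matrix.det e
  rw [← RingHom.map_det, Matrix.det_mul, Matrix.det_mul, key, key,
    show (M.map (algebraMap R (DualNumber R))).det = algebraMap R (DualNumber R) M.det from
      (RingHom.map_det (algebraMap R (DualNumber R)) M).symm] at h3
  have h4 := congrArg TrivSqZeroExt.snd h3
  simp [Derivation.toDualNumber, TrivSqZeroExt.algebraMap_eq_inl,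
    -DualNumber.inr_eq_smul_eps] at h4
  rw [h4]
  ring

end MatrixDerivation

/-! ### Vector-valued polynomial functions -/

namespace MvPolynomial

variable {ι V : Type*} [AddCommGroup V] [Module ℝ V]

/-- `f` is a vector-valued polynomial function, and `f'` is its derivative along `L`. -/
def HasPolyDeriv (L : Derivation ℝ (MvPolynomial ι ℝ) (MvPolynomial ι ℝ)) (f f' : (ι → ℝ) → V) :
    Prop :=
  ∀ φ : V →ₗ[ℝ] ℝ, ∃ P : MvPolynomial ι ℝ, (∀ c, eval c P = φ (f c)) ∧
    ∀ c, eval c (L P) = φ (f' c)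

namespace HasPolyDeriv

variable {L : Derivation ℝ (MvPolynomial ι ℝ) (MvPolynomial ι ℝ)} {f f' g g' : (ι → ℝ) → V}

theorem eval_eq (hf : HasPolyDeriv L f f') (φ : V →ₗ[ℝ] ℝ) {P : MvPolynomial ι ℝ}
    (hP : ∀ c, eval c P = φ (f c)) (c : ι → ℝ) : eval c (L P) = φ (f' c) := by
  obtain ⟨Q, hQ, hQ'⟩ := hf φ
  have : P = Q := MvPolynomial.funext fun c => by rw [hP, hQ]
  rw [this, hQ']

theorem const (L : Derivation ℝ (MvPolynomial ι ℝ) (MvPolynomial ι ℝ)) (w : V) :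
    HasPolyDeriv L (fun _ => w) fun _ => 0 := fun φ =>
  ⟨C (φ w), by simp, by simp⟩

theorem congr_deriv (hf : HasPolyDeriv L f f') (hg : ∀ c, f' c = g' c) : HasPolyDeriv L f g' := by
  rwa [show g' = f' from _root_.funext fun c => (hg c).symm]

theorem neg (hf : HasPolyDeriv L f f') : HasPolyDeriv L (fun c => -f c) fun c => -f' c := fun φ => by
  obtain ⟨P, hP, hP'⟩ := hf φ
  exact ⟨-P, by simp [hP], by simp [hP']⟩

theorem add (hf : HasPolyDeriv L f f') (hg : HasPolyDeriv L g g') :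
    HasPolyDeriv L (fun c => f c + g c) fun c => f' c + g' c := fun φ => by
  obtain ⟨P, hP, hP'⟩ := hf φ
  obtain ⟨Q, hQ, hQ'⟩ := hg φ
  exact ⟨P + Q, by simp [hP, hQ], by simp [hP', hQ']⟩

theorem map {W : Type*} [AddCommGroup W] [Module ℝ W] (ψ : V →ₗ[ℝ] W)
    (hf : HasPolyDeriv L f f') :
    HasPolyDeriv L (fun c => ψ (f c)) fun c => ψ (f' c) := fun φ => hf (φ ∘ₗ ψ)

theorem sum_smul [Fintype ι] (e : ι → V) :
    HasPolyDeriv L (fun c => ∑ i, c i • e i) fun c => ∑ i, eval c (L (X i)) • e i := fun φ =>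
  ⟨∑ i, C (φ (e i)) * X i, by simp [mul_comm], by simp [mul_comm]⟩

theorem bilin [FiniteDimensional ℝ V] (β : V →ₗ[ℝ] V →ₗ[ℝ] V)
    (hf : HasPolyDeriv L f f') (hg : HasPolyDeriv L g g') :
    HasPolyDeriv L (fun c => β (f c) (g c)) fun c => β (f' c) (g c) + β (f c) (g' c) := by
  intro φ
  let e := Module.finBasis ℝ V
  choose P hP hP' using fun i => hf (e.coord i)
  choose Q hQ hQ' using fun i => hg (φ ∘ₗ β (e i))
  have key : ∀ x y, φ (β x y) = ∑ i, e.coord i x * φ (β (e i) y) := fun x y => by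
    conv_lhs => rw [← e.sum_repr x]
    simp only [map_sum, map_smul, LinearMap.sum_apply, LinearMap.smul_apply, smul_eq_mul,
      Module.Basis.coord_apply]
  refine ⟨∑ i, P i * Q i, fun c => ?_, fun c => ?_⟩
  · simp only [map_sum, map_mul, hP, hQ, key (f c), LinearMap.comp_apply]
  · simp only [map_sum, Derivation.leibniz, smul_eq_mul, map_add, map_mul, hP, hP', hQ, hQ',
      key (f c), key (f' c),
      Finset.sum_add_distrib, LinearMap.comp_apply]
    rw [add_comm]
    congr 1
    exact Finset.sum_congr rfl fun i _ => mul_comm _ _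

theorem lie {𝔤 : Type*} [LieRing 𝔤] [LieAlgebra ℝ 𝔤] [FiniteDimensional ℝ 𝔤]
    {f f' g g' : (ι → ℝ) → 𝔤} (hf : HasPolyDeriv L f f') (hg : HasPolyDeriv L g g') :
    HasPolyDeriv L (fun c => ⁅f c, g c⁆) fun c => ⁅f' c, g c⁆ + ⁅f c, g' c⁆ :=
  hf.bilin (LieModule.toEnd ℝ 𝔤 𝔤 : 𝔤 →ₗ[ℝ] 𝔤 →ₗ[ℝ] 𝔤) hg

end HasPolyDeriv

end MvPolynomial

/-! ### Truncated exponentials and the Bergman operator -/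

namespace ParaHermitian

/-- `exp (ad a)`, truncated after the quadratic term. -/
noncomputable def adExp {𝔤 : Type*} [LieRing 𝔤] [LieAlgebra ℝ 𝔤] (a : 𝔤) : 𝔤 →ₗ[ℝ] 𝔤 :=
  1 + LieAlgebra.ad ℝ 𝔤 a + (1 / 2 : ℝ) • (LieAlgebra.ad ℝ 𝔤 a * LieAlgebra.ad ℝ 𝔤 a)

section

variable {𝔤 : Type*} [LieRing 𝔤] [LieAlgebra ℝ 𝔤]

theorem adExp_apply (a w : 𝔤) : adExp a w = w + ⁅a, w⁆ + (1 / 2 : ℝ) • ⁅a, ⁅a, w⁆⁆ := rfl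

/-- The two sides differ by terms of order three and four in `D`. Those of order three vanish
because `D³ ⁅x, y⁆` is three times their sum; replacing `x` by `D x` disposes of order four. -/
theorem exp_derivation_lie {D : 𝔤 →ₗ[ℝ] 𝔤} (hD : ∀ x y, D ⁅x, y⁆ = ⁅D x, y⁆ + ⁅x, D y⁆)
    (h0 : ∀ x, D (D (D x)) = 0) (x y : 𝔤) :
    ⁅x, y⁆ + D ⁅x, y⁆ + (1 / 2 : ℝ) • D (D ⁅x, y⁆) =
      ⁅x + D x + (1 / 2 : ℝ) • D (D x), y + D y + (1 / 2 : ℝ) • D (D y)⁆ := by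
  have h3 : ∀ x y : 𝔤, ⁅D (D x), D y⁆ + ⁅D x, D (D y)⁆ = 0 := fun x y => by
    have h := h0 ⁅x, y⁆
    simp only [hD, map_add, h0, zero_lie, lie_zero] at h
    have h' : (3 : ℝ) • (⁅D (D x), D y⁆ + ⁅D x, D (D y)⁆) = 0 := by
      rw [← h]
      module
    exact (smul_eq_zero.1 h').resolve_left (by norm_num)
  have h4 : ⁅D (D x), D (D y)⁆ = 0 := by
    have h := h3 (D x) y
    rwa [h0, zero_lie, zero_add] at h
  simp only [hD, map_add, lie_add, add_lie, lie_smul, smul_lie, h4]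
  linear_combination (norm := module) (-(1 / 2 : ℝ)) • h3 x y

theorem adExp_lie {a : 𝔤} (ha : ∀ x : 𝔤, ⁅a, ⁅a, ⁅a, x⁆⁆⁆ = 0) (x y : 𝔤) :
    adExp a ⁅x, y⁆ = ⁅adExp a x, adExp a y⁆ :=
  exp_derivation_lie (D := LieAlgebra.ad ℝ 𝔤 a) (leibniz_lie a) ha x y

theorem adExp_of_lie_eq_zero {a x : 𝔤} (h : ⁅a, x⁆ = 0) : adExp a x = x := by
  rw [adExp_apply, h, lie_zero, smul_zero, add_zero, add_zero]

end

namespace IsGraded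

open MvPolynomial

variable {𝔤 : Type*} [LieRing 𝔤] [LieAlgebra ℝ 𝔤] {Z : 𝔤} {m p : Submodule ℝ 𝔤}

variable (h : IsGraded Z m p)
include h

theorem lie_m_m_m {a b c : 𝔤} (ha : a ∈ m) (hb : b ∈ m) (hc : c ∈ m) (x : 𝔤) :
    ⁅a, ⁅b, ⁅c, x⁆⁆⁆ = 0 := by
  obtain ⟨v, hv, T, hT, u, hu, rfl⟩ := h.exists_decomp x
  simp only [lie_add, h.lie_m_m hc hv, h.lie_m_m hb (h.lie_m_zero hT hc),
    h.lie_m_m ha (h.lie_m_zero (h.lie_m_p hc hu) hb), lie_zero, add_zero]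

theorem lie_p_p_p {a b c : 𝔤} (ha : a ∈ p) (hb : b ∈ p) (hc : c ∈ p) (x : 𝔤) :
    ⁅a, ⁅b, ⁅c, x⁆⁆⁆ = 0 := by
  obtain ⟨v, hv, T, hT, u, hu, rfl⟩ := h.exists_decomp x
  simp only [lie_add, h.lie_p_p hc hu, h.lie_p_p hb (h.lie_p_zero hT hc),
    h.lie_p_p ha (h.lie_p_zero (h.lie_p_m hv hc) hb), add_zero]

theorem projP_lie_zero {T : 𝔤} (hT : ⁅Z, T⁆ = 0) (x : 𝔤) :
    (h.projP ⁅T, x⁆ : 𝔤) = ⁅T, (h.projP x : 𝔤)⁆ := by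
  have h1 : ∀ y : 𝔤, ⁅Z, ⁅T, y⁆⁆ = ⁅T, ⁅Z, y⁆⁆ := fun y => by
    rw [leibniz_lie, hT, zero_lie, zero_add]
  rw [coe_projP, coe_projP, h1, h1, lie_smul, lie_add]

theorem projP_lie_m {v : 𝔤} (hv : v ∈ m) (x : 𝔤) : h.projP ⁅v, x⁆ = 0 := by
  obtain ⟨v', hv', T, hT, u, hu, rfl⟩ := h.exists_decomp x
  rw [lie_add, lie_add, h.lie_m_m hv hv', map_add, map_add, map_zero,
    h.projP_m (h.lie_m_zero hT hv), h.projP_zero (h.lie_m_p hv hu)]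
  simp

/-- The component of weight one of `exp (ad η) exp (-ad ξ)` on elements of weight one. -/
noncomputable def bergman (ξ η : 𝔤) : p →ₗ[ℝ] p :=
  h.projP ∘ₗ adExp η ∘ₗ adExp (-ξ) ∘ₗ p.subtype

theorem bergman_apply (ξ η : 𝔤) (w : p) : h.bergman ξ η w = h.projP (adExp η (adExp (-ξ) w)) := rfl

variable [FiniteDimensional ℝ 𝔤] {ι : Type*}
  {L : Derivation ℝ (MvPolynomial ι ℝ) (MvPolynomial ι ℝ)} {ξ ξ' η η' : (ι → ℝ) → 𝔤}

/-- As `m` and `p` are abelian, `ξ` commutes with `ξ'` and `η` with `η'`, so each factor satisfies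
`(exp (ad ζ))' = ad ζ' exp (ad ζ)`. The truncation does no harm since `ad ζ' (ad ζ)² = 0`. -/
theorem hasPolyDeriv_adExp (hξ : HasPolyDeriv L ξ ξ') (hη : HasPolyDeriv L η η')
    (hξm : ∀ c, ξ c ∈ m) (hξm' : ∀ c, ξ' c ∈ m) (hηp : ∀ c, η c ∈ p) (hηp' : ∀ c, η' c ∈ p)
    (w : 𝔤) :
    HasPolyDeriv L (fun c => adExp (η c) (adExp (-ξ c) w)) fun c =>
      ⁅η' c, adExp (η c) (adExp (-ξ c) w)⁆ - adExp (η c) ⁅ξ' c, adExp (-ξ c) w⁆ := by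
  have general : ∀ {ζ ζ' x x' : (ι → ℝ) → 𝔤}, HasPolyDeriv L ζ ζ' → HasPolyDeriv L x x' →
      (∀ c, ⁅ζ c, ζ' c⁆ = 0) → (∀ c (y : 𝔤), ⁅ζ' c, ⁅ζ c, ⁅ζ c, y⁆⁆⁆ = 0) →
      HasPolyDeriv L (fun c => adExp (ζ c) (x c)) fun c =>
        ⁅ζ' c, adExp (ζ c) (x c)⁆ + adExp (ζ c) (x' c) := by
    intro ζ ζ' x x' hζ hx h0 h3
    have h1 := hζ.lie hx
    have h2 := (hx.add h1).add ((hζ.lie h1).map ((1 / 2 : ℝ) • LinearMap.id))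
    refine h2.congr_deriv fun c => ?_
    have h4 : ⁅ζ c, ⁅ζ' c, x c⁆⁆ = ⁅ζ' c, ⁅ζ c, x c⁆⁆ := by
      rw [leibniz_lie, h0, zero_lie, zero_add]
    simp only [adExp_apply, lie_add, lie_smul, h3, h4, LinearMap.smul_apply, LinearMap.id_apply]
    module
  have h1 := general hξ.neg (HasPolyDeriv.const L w)
    (fun c => h.lie_m_m (m.neg_mem (hξm c)) (m.neg_mem (hξm' c)))
    (fun c => h.lie_m_m_m (m.neg_mem (hξm' c)) (m.neg_mem (hξm c)) (m.neg_mem (hξm c)))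
  have h2 := general hη h1 (fun c => h.lie_p_p (hηp c) (hηp' c))
    (fun c => h.lie_p_p_p (hηp' c) (hηp c) (hηp c))
  refine h2.congr_deriv fun c => ?_
  rw [map_zero, add_zero, neg_lie, map_neg, sub_eq_add_neg]

omit [FiniteDimensional ℝ 𝔤] in
-- Along the quadratic field of `v + u` the Bergman operator `B` satisfies `B' = B ad ⁅x, u⁆ - ad
-- ⁅y, v⁆ B`. The quadratic terms of the field cancel those of `exp (ad y) v` and `exp (-ad x) (u +
-- ⁅x, u⁆)`; what remains is a bracket with `v`, which has no component of weight one.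
theorem projP_deriv_frame {x y u v w : 𝔤} (hx : x ∈ m) (hy : y ∈ p) (hv : v ∈ m) (hu : u ∈ p)
    (hw : w ∈ p) :
    (h.projP (⁅u + (1 / 2 : ℝ) • ⁅y, ⁅y, v⁆⁆, adExp y (adExp (-x) w)⁆ -
      adExp y ⁅v + (1 / 2 : ℝ) • ⁅x, ⁅x, u⁆⁆, adExp (-x) w⁆) : 𝔤) =
    (h.projP (adExp y (adExp (-x) ⁅⁅x, u⁆, w⁆)) : 𝔤) -
      ⁅⁅y, v⁆, (h.projP (adExp y (adExp (-x) w)) : 𝔤)⁆ := by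
  have hE := adExp_lie (h.lie_p_p_p hy hy hy)
  have hF := adExp_lie (h.lie_m_m_m (m.neg_mem hx) (m.neg_mem hx) (m.neg_mem hx))
  set z := adExp (-x) w with hz
  have h1 : adExp y u = u := adExp_of_lie_eq_zero (h.lie_p_p hy hu)
  have h2 : ⁅u, adExp y z⁆ = adExp y ⁅u, z⁆ := by rw [hE, h1]
  have h3 : adExp y ⁅v, z⁆ = ⁅v, adExp y z⁆ + ⁅⁅y, v⁆, adExp y z⁆ +
      ⁅(1 / 2 : ℝ) • ⁅y, ⁅y, v⁆⁆, adExp y z⁆ := by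
    rw [hE, adExp_apply y v, add_lie, add_lie]
  have h4 : adExp (-x) ⁅⁅x, u⁆, w⁆ = ⁅u, z⁆ - ⁅(1 / 2 : ℝ) • ⁅x, ⁅x, u⁆⁆, z⁆ := by
    have h5 : adExp (-x) (u + ⁅x, u⁆) = u - (1 / 2 : ℝ) • ⁅x, ⁅x, u⁆⁆ := by
      simp only [adExp_apply, lie_add, neg_lie, lie_neg, neg_neg, h.lie_m_m_m hx hx hx]
      module
    have h6 := hF (u + ⁅x, u⁆) w
    rwa [add_lie, h.lie_p_p hu hw, zero_add, h5, sub_lie] at h6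
  rw [← h.projP_lie_zero (h.lie_p_m hv hy), h4, add_lie, h2, add_lie, map_add (adExp y), h3,
    ← Submodule.coe_sub, ← map_sub]
  congr 1
  rw [← sub_eq_zero, ← map_sub, ← neg_eq_zero, ← map_neg, ← h.projP_lie_m hv (adExp y z)]
  congr 1
  rw [map_sub (adExp y)]
  abel

omit [FiniteDimensional ℝ 𝔤] in
-- Moving `x` and `y` by the derivation `ad T` changes `exp (ad y) exp (-ad x)` by its commutator
-- with `ad T`.
theorem deriv_linear {T x y : 𝔤} (hT : ⁅Z, T⁆ = 0) (hx : x ∈ m) (hy : y ∈ p) (w : 𝔤) :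
    ⁅⁅T, y⁆, adExp y (adExp (-x) w)⁆ - adExp y ⁅⁅T, x⁆, adExp (-x) w⁆ =
      ⁅T, adExp y (adExp (-x) w)⁆ - adExp y (adExp (-x) ⁅T, w⁆) := by
  have key : ∀ {a z : 𝔤}, ⁅⁅T, a⁆, ⁅a, ⁅a, z⁆⁆⁆ = 0 → ⁅a, ⁅T, a⁆⁆ = 0 →
      ⁅⁅T, a⁆, adExp a z⁆ = ⁅T, adExp a z⁆ - adExp a ⁅T, z⁆ := fun {a z} h0 h1 => by
    have h2 := leibniz_lie a ⁅T, a⁆ z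
    rw [h1, zero_lie, zero_add] at h2
    simp only [adExp_apply, lie_add, lie_smul, h0]
    simp only [lie_lie, lie_sub] at h2 ⊢
    linear_combination (norm := module) (-(1 / 2 : ℝ)) • h2
  have h1 := key (h.lie_m_m_m (h.lie_zero_m hT (m.neg_mem hx)) (m.neg_mem hx) (m.neg_mem hx) w)
    (h.lie_m_m (m.neg_mem hx) (h.lie_zero_m hT (m.neg_mem hx)))
  rw [lie_neg, neg_lie, neg_eq_iff_eq_neg] at h1
  rw [key (h.lie_p_p_p (h.lie_zero_p hT hy) hy hy _)
    (h.lie_p_p hy (h.lie_zero_p hT hy)), h1, map_neg, map_sub]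
  abel

end IsGraded

end ParaHermitian

/-! ### Polynomial vector fields on `m ⊕ p` -/

namespace ParaHermitian

namespace IsGraded

open MvPolynomial

variable {𝔤 : Type*} [LieRing 𝔤] [LieAlgebra ℝ 𝔤] {Z : 𝔤} {m p : Submodule ℝ 𝔤}
variable (h : IsGraded Z m p)
variable {κ κ' : Type*} (bm : Module.Basis κ ℝ m) (bp : Module.Basis κ' ℝ p)

/-- The basis vectors of `m`, extended by zero. -/
noncomputable def vecM : κ ⊕ κ' → 𝔤 := Sum.elim (fun i => (bm i : 𝔤)) 0

/-- The basis vectors of `p`, extended by zero. -/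
noncomputable def vecP : κ ⊕ κ' → 𝔤 := Sum.elim 0 fun j => (bp j : 𝔤)

/-- The coordinates with respect to the union of the bases of `m` and `p`. -/
noncomputable def coordMP : κ ⊕ κ' → 𝔤 →ₗ[ℝ] ℝ :=
  Sum.elim (fun i => bm.coord i ∘ₗ h.projM) fun j => bp.coord j ∘ₗ h.projP

theorem vecM_mem (i : κ ⊕ κ') : vecM bm i ∈ m := by
  cases i <;> simp [vecM]

theorem vecP_mem (i : κ ⊕ κ') : vecP bp i ∈ p := by
  cases i <;> simp [vecP]

theorem coordMP_vec [DecidableEq κ] [DecidableEq κ'] (i j : κ ⊕ κ') :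
    h.coordMP bm bp i (vecM bm j + vecP bp j) = if i = j then 1 else 0 := by
  have h1 : ∀ x : m, h.projM x = x := fun x => Subtype.ext (h.projM_m x.2)
  have h2 : ∀ x : p, h.projP x = x := fun x => Subtype.ext (h.projP_p x.2)
  rcases i with i | i <;> rcases j with j | j <;>
    simp [coordMP, vecM, vecP, h1, h2, h.projP_m, h.projM_p, Finsupp.single_apply, eq_comm]

omit [LieRing 𝔤] [LieAlgebra ℝ 𝔤] in
theorem coe_sum_repr [AddCommGroup 𝔤] [Module ℝ 𝔤] {m : Submodule ℝ 𝔤} [Fintype κ]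
    (b : Module.Basis κ ℝ m) (x : m) : ∑ i, b.repr x i • (b i : 𝔤) = x := by
  simpa only [map_sum, map_smul, Submodule.subtype_apply] using congrArg m.subtype (b.sum_repr x)

variable [Fintype κ] [Fintype κ']

theorem sum_coordMP_vecM (x : 𝔤) :
    ∑ i, h.coordMP bm bp i x • vecM bm i = (h.projM x : 𝔤) := by
  simpa [coordMP, vecM] using coe_sum_repr bm (h.projM x)

theorem sum_coordMP_vecP (x : 𝔤) :
    ∑ i, h.coordMP bm bp i x • vecP bp i = (h.projP x : 𝔤) := by
  simpa [coordMP, vecP] using coe_sum_repr bp (h.projP x)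

/-- The matrix of the operators `bergman ξ η`, as a matrix of polynomials. -/
theorem exists_matrix [FiniteDimensional ℝ 𝔤] :
    ∃ M : Matrix κ' κ' (MvPolynomial (κ ⊕ κ') ℝ), ∀ c i j, eval c (M i j) =
      bp.coord i (h.bergman (∑ i, c i • vecM bm i) (∑ i, c i • vecP bp i) (bp j)) := by
  -- Only polynomiality is needed here, so the derivation is taken to be zero.
  have h1 := fun j => h.hasPolyDeriv_adExp
    (HasPolyDeriv.sum_smul (L := 0) (vecM (κ' := κ') bm)) (HasPolyDeriv.sum_smul (L := 0) (vecP (κ := κ) bp))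
    (fun c => m.sum_smul_mem _ fun i _ => vecM_mem bm i)
    (fun c => m.sum_smul_mem _ fun i _ => vecM_mem bm i)
    (fun c => p.sum_smul_mem _ fun i _ => vecP_mem bp i)
    (fun c => p.sum_smul_mem _ fun i _ => vecP_mem bp i) (bp j)
  choose M hM using fun i j => h1 j (bp.coord i ∘ₗ h.projP)
  exact ⟨M, fun c i j => (hM i j).1 c⟩

variable [DecidableEq κ'] [FiniteDimensional ℝ 𝔤]

/-- The derivative of `det bergman` along a polynomial vector field. -/
theorem derivation_det {L : Derivation ℝ (MvPolynomial (κ ⊕ κ') ℝ) (MvPolynomial (κ ⊕ κ') ℝ)}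
    {M : Matrix κ' κ' (MvPolynomial (κ ⊕ κ') ℝ)}
    (hM : ∀ c i j, eval c (M i j) =
      bp.coord i (h.bergman (∑ i, c i • vecM bm i) (∑ i, c i • vecP bp i) (bp j)))
    {T₁ T₂ ξ' η' : (κ ⊕ κ' → ℝ) → 𝔤} {T₁' T₂' : (κ ⊕ κ' → ℝ) → 𝔤}
    (hξ' : ∀ c, ∑ i, eval c (L (X i)) • vecM bm i = ξ' c)
    (hη' : ∀ c, ∑ i, eval c (L (X i)) • vecP bp i = η' c)
    (hT₁ : HasPolyDeriv L T₁ T₁') (hT₂ : HasPolyDeriv L T₂ T₂')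
    (heq : ∀ c, ∀ w : p, ∀ x y, x = ∑ i, c i • vecM bm i → y = ∑ i, c i • vecP bp i →
      h.projP (⁅η' c, adExp y (adExp (-x) w)⁆ - adExp y ⁅ξ' c, adExp (-x) w⁆) =
        h.bergman x y (h.projP ⁅T₁ c, (w : 𝔤)⁆) - h.projP ⁅T₂ c, (h.bergman x y w : 𝔤)⁆) :
    ∃ t : MvPolynomial (κ ⊕ κ') ℝ, L M.det = M.det * t ∧
      ∀ c, eval c t = ∑ i, bp.coord i (h.projP ⁅T₁ c - T₂ c, (bp i : 𝔤)⁆) := by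
  choose A₁ hA₁ using fun i j => hT₁.lie (HasPolyDeriv.const L (bp j : 𝔤)) (bp.coord i ∘ₗ h.projP)
  choose A₂ hA₂ using fun i j => hT₂.lie (HasPolyDeriv.const L (bp j : 𝔤)) (bp.coord i ∘ₗ h.projP)
  have key : ∀ (x : p) (i) (f : p →ₗ[ℝ] p),
      bp.coord i (f x) = ∑ k, bp.coord i (f (bp k)) * bp.coord k x := fun x i f => by
    conv_lhs => rw [← bp.sum_repr x]
    simp only [map_sum, map_smul, smul_eq_mul, Module.Basis.coord_apply]
    exact Finset.sum_congr rfl fun k _ => mul_comm _ _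
  refine ⟨Matrix.trace (Matrix.of A₁) - Matrix.trace (Matrix.of A₂), ?_, fun c => ?_⟩
  · refine L.det_eq_of_map_eq M (Matrix.of A₁) (Matrix.of A₂) ?_
    ext1 i j
    refine MvPolynomial.funext fun c => ?_
    have h1 := (h.hasPolyDeriv_adExp
      (HasPolyDeriv.sum_smul (L := L) (vecM bm)) (HasPolyDeriv.sum_smul (L := L) (vecP bp))
      (fun c => m.sum_smul_mem _ fun i _ => vecM_mem bm i)
      (fun c => m.sum_smul_mem _ fun i _ => vecM_mem bm i)
      (fun c => p.sum_smul_mem _ fun i _ => vecP_mem bp i)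
      (fun c => p.sum_smul_mem _ fun i _ => vecP_mem bp i) (bp j)).eval_eq
        (bp.coord i ∘ₗ h.projP) (P := M i j) (fun c => hM c i j) c
    have h2 := fun w : p => key w i (h.projP ∘ₗ LieAlgebra.ad ℝ 𝔤 (T₂ c) ∘ₗ p.subtype)
    simp only [LinearMap.comp_apply, LieAlgebra.ad_apply, Submodule.subtype_apply] at h2
    rw [Matrix.map_apply, h1, hξ', hη', LinearMap.comp_apply, heq c (bp j) _ _ rfl rfl, map_sub,
      key (h.projP _) i, h2]
    simp only [Matrix.sub_apply, Matrix.mul_apply, Matrix.of_apply, map_sub, map_sum, map_mul, hM,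
      (hA₁ _ _).1, (hA₂ _ _).1]
    rfl
  · simp only [Matrix.trace, Matrix.diag_apply, Matrix.of_apply, map_sub, map_sum, (hA₁ _ _).1,
      (hA₂ _ _).1, sub_lie, LinearMap.comp_apply, Finset.sum_sub_distrib]

omit [DecidableEq κ'] [FiniteDimensional ℝ 𝔤] in
theorem sum_elim_vecM (ξ : m) (η : p) :
    ∑ i, Sum.elim (bm.repr ξ) (bp.repr η) i • vecM (κ' := κ') bm i = (ξ : 𝔤) := by
  simpa [vecM] using coe_sum_repr bm ξ

omit [DecidableEq κ'] [FiniteDimensional ℝ 𝔤] in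
theorem sum_elim_vecP (ξ : m) (η : p) :
    ∑ i, Sum.elim (bm.repr ξ) (bp.repr η) i • vecP (κ := κ) bp i = (η : 𝔤) := by
  simpa [vecP] using coe_sum_repr bp η

/-- The linear vector field of a weight-zero element preserves `det bergman`. -/
theorem derivation_det_linear {M : Matrix κ' κ' (MvPolynomial (κ ⊕ κ') ℝ)}
    (hM : ∀ c i j, eval c (M i j) =
      bp.coord i (h.bergman (∑ i, c i • vecM bm i) (∑ i, c i • vecP bp i) (bp j)))
    {T : 𝔤} (hT : ⁅Z, T⁆ = 0) :
    M.det ∣ mkDerivation ℝ (fun i => ∑ j, C (h.coordMP bm bp i ⁅T, vecM bm j + vecP bp j⁆) * X j)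
      M.det := by
  set L := mkDerivation ℝ (fun i => ∑ j, C (h.coordMP bm bp i ⁅T, vecM bm j + vecP bp j⁆) * X j)
  have hL : ∀ c i, eval c (L (X i)) =
      h.coordMP bm bp i (⁅T, ∑ i, c i • vecM bm i⁆ + ⁅T, ∑ i, c i • vecP bp i⁆) := fun c i => by
    rw [mkDerivation_X, ← lie_add, ← Finset.sum_add_distrib]
    simp only [← smul_add, lie_sum, lie_smul, map_sum, map_smul, smul_eq_mul, map_mul, eval_C,
      eval_X, mul_comm]
  have hx : ∀ c : κ ⊕ κ' → ℝ, ∑ i, c i • vecM bm i ∈ m := fun c =>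
    m.sum_smul_mem _ fun i _ => vecM_mem bm i
  have hy : ∀ c : κ ⊕ κ' → ℝ, ∑ i, c i • vecP bp i ∈ p := fun c =>
    p.sum_smul_mem _ fun i _ => vecP_mem bp i
  -- The operator changes by `ad T B - B ad T`, so both coefficients are `-T`.
  obtain ⟨t, ht, -⟩ := h.derivation_det bm bp hM (L := L)
    (ξ' := fun c => ⁅T, ∑ i, c i • vecM bm i⁆) (η' := fun c => ⁅T, ∑ i, c i • vecP bp i⁆)
    (T₁ := fun _ => -T) (T₂ := fun _ => -T) (T₁' := fun _ => 0) (T₂' := fun _ => 0)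
    (fun c => by
      simp only [hL]
      rw [sum_coordMP_vecM, map_add, h.projM_p (h.lie_zero_p hT (hy c)), add_zero,
        h.projM_m (h.lie_zero_m hT (hx c))])
    (fun c => by
      simp only [hL]
      rw [sum_coordMP_vecP, map_add, h.projP_m (h.lie_zero_m hT (hx c)), zero_add,
        h.projP_p (h.lie_zero_p hT (hy c))])
    (HasPolyDeriv.const L _) (HasPolyDeriv.const L _)
    (by
      rintro c w x y rfl rfl
      rw [h.deriv_linear hT (hx c) (hy c), map_sub, neg_lie, neg_lie, map_neg, map_neg, map_neg,
        sub_neg_eq_add, neg_add_eq_sub]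
      congr 1
      · ext
        rw [h.projP_lie_zero hT, h.projP_p (h.lie_zero_p hT (Subtype.mem _)), bergman_apply]
      · rw [bergman_apply, h.projP_p (h.lie_zero_p hT w.2)])
  exact ⟨t, ht⟩

/-- The quadratic vector fields, which at the origin form a frame. -/
noncomputable def frame (k : κ ⊕ κ') :
    Derivation ℝ (MvPolynomial (κ ⊕ κ') ℝ) (MvPolynomial (κ ⊕ κ') ℝ) :=
  mkDerivation ℝ fun i => C (h.coordMP bm bp i (vecM bm k + vecP bp k)) +
    ∑ a, ∑ b, C (1 / 2 * h.coordMP bm bp i (⁅vecM bm a, ⁅vecM bm b, vecP bp k⁆⁆ +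
      ⁅vecP bp a, ⁅vecP bp b, vecM bm k⁆⁆)) * (X a * X b)

omit [DecidableEq κ'] [FiniteDimensional ℝ 𝔤] in
theorem eval_frame (k i : κ ⊕ κ') (c : κ ⊕ κ' → ℝ) :
    eval c (h.frame bm bp k (X i)) = h.coordMP bm bp i
      (vecM bm k + (1 / 2 : ℝ) • ⁅∑ i, c i • vecM bm i, ⁅∑ i, c i • vecM bm i, vecP bp k⁆⁆ +
        (vecP bp k + (1 / 2 : ℝ) • ⁅∑ i, c i • vecP bp i, ⁅∑ i, c i • vecP bp i, vecM bm k⁆⁆)) := by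
  have key : ∀ (e : κ ⊕ κ' → 𝔤) (u : 𝔤), ⁅∑ i, c i • e i, ⁅∑ i, c i • e i, u⁆⁆ =
      ∑ a, ∑ b, (c a * c b) • ⁅e a, ⁅e b, u⁆⁆ := fun e u => by
    rw [sum_lie]
    refine Finset.sum_congr rfl fun a _ => ?_
    rw [sum_lie, lie_sum]
    refine Finset.sum_congr rfl fun b _ => ?_
    rw [smul_lie, smul_lie, lie_smul, smul_smul]
  rw [frame, mkDerivation_X, key, key]
  simp only [map_add, map_sum, map_smul, map_mul, eval_C, eval_X, smul_eq_mul, Finset.mul_sum]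
  rw [add_add_add_comm, ← Finset.sum_add_distrib]
  congr 1
  refine Finset.sum_congr rfl fun a _ => ?_
  rw [← Finset.sum_add_distrib]
  refine Finset.sum_congr rfl fun b _ => ?_
  ring

omit [DecidableEq κ'] [FiniteDimensional ℝ 𝔤] in
theorem totalDegree_frame_le (k i : κ ⊕ κ') : (h.frame bm bp k (X i)).totalDegree ≤ 2 := by
  rw [frame, mkDerivation_X]
  refine (totalDegree_add _ _).trans (max_le (by rw [totalDegree_C]; exact Nat.zero_le _) ?_)
  refine totalDegree_finsetSum_le fun a _ => totalDegree_finsetSum_le fun b _ => ?_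
  refine (totalDegree_mul _ _).trans ?_
  rw [totalDegree_C, zero_add]
  refine (totalDegree_mul _ _).trans ?_
  rw [totalDegree_X, totalDegree_X]

/-- The explicit logarithmic derivative, a trace over `p`, is retained because it shows that the
determinant is not constant. -/
theorem derivation_det_frame {M : Matrix κ' κ' (MvPolynomial (κ ⊕ κ') ℝ)}
    (hM : ∀ c i j, eval c (M i j) =
      bp.coord i (h.bergman (∑ i, c i • vecM bm i) (∑ i, c i • vecP bp i) (bp j)))
    (k : κ ⊕ κ') :
    ∃ t : MvPolynomial (κ ⊕ κ') ℝ, h.frame bm bp k M.det = M.det * t ∧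
      ∀ c, eval c t = ∑ i, bp.coord i (h.projP ⁅⁅∑ i, c i • vecM bm i, vecP bp k⁆ -
        ⁅∑ i, c i • vecP bp i, vecM bm k⁆, (bp i : 𝔤)⁆) := by
  have hx : ∀ c : κ ⊕ κ' → ℝ, ∑ i, c i • vecM bm i ∈ m := fun c =>
    m.sum_smul_mem _ fun i _ => vecM_mem bm i
  have hy : ∀ c : κ ⊕ κ' → ℝ, ∑ i, c i • vecP bp i ∈ p := fun c =>
    p.sum_smul_mem _ fun i _ => vecP_mem bp i
  have hu : vecP bp k ∈ p := vecP_mem bp k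
  have hv : vecM bm k ∈ m := vecM_mem bm k
  have hξ : ∀ c : κ ⊕ κ' → ℝ, vecM bm k + (1 / 2 : ℝ) • ⁅∑ i, c i • vecM bm i,
      ⁅∑ i, c i • vecM bm i, vecP bp k⁆⁆ ∈ m := fun c =>
    m.add_mem hv (m.smul_mem _ (h.lie_m_zero (h.lie_m_p (hx c) hu) (hx c)))
  have hη : ∀ c : κ ⊕ κ' → ℝ, vecP bp k + (1 / 2 : ℝ) • ⁅∑ i, c i • vecP bp i,
      ⁅∑ i, c i • vecP bp i, vecM bm k⁆⁆ ∈ p := fun c =>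
    p.add_mem hu (p.smul_mem _ (h.lie_p_zero (h.lie_p_m hv (hy c)) (hy c)))
  refine h.derivation_det bm bp hM (L := h.frame bm bp k)
    (T₁ := fun c => ⁅∑ i, c i • vecM bm i, vecP bp k⁆)
    (T₂ := fun c => ⁅∑ i, c i • vecP bp i, vecM bm k⁆)
    (ξ' := fun c => vecM bm k + (1 / 2 : ℝ) • ⁅∑ i, c i • vecM bm i,
      ⁅∑ i, c i • vecM bm i, vecP bp k⁆⁆)
    (η' := fun c => vecP bp k + (1 / 2 : ℝ) • ⁅∑ i, c i • vecP bp i,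
      ⁅∑ i, c i • vecP bp i, vecM bm k⁆⁆)
    (fun c => ?_) (fun c => ?_)
    ((HasPolyDeriv.sum_smul _).lie (HasPolyDeriv.const _ _))
    ((HasPolyDeriv.sum_smul _).lie (HasPolyDeriv.const _ _)) ?_
  · simp only [eval_frame]
    rw [sum_coordMP_vecM, map_add, h.projM_p (hη c), add_zero, h.projM_m (hξ c)]
  · simp only [eval_frame]
    rw [sum_coordMP_vecP, map_add, h.projP_m (hξ c), zero_add, h.projP_p (hη c)]
  · rintro c w x y rfl rfl
    ext
    rw [h.projP_deriv_frame (hx c) (hy c) hv hu w.2, Submodule.coe_sub, bergman_apply,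
      h.projP_p (h.lie_zero_p (h.lie_m_p (hx c) hu) w.2),
      h.projP_p (h.lie_zero_p (h.lie_p_m hv (hy c)) (Subtype.mem _)), bergman_apply]

end IsGraded

end ParaHermitian

/-! ### The determinant is a power of an irreducible polynomial -/

namespace ParaHermitian

namespace IsGraded

open MvPolynomial

variable {𝔤 : Type*} [LieRing 𝔤] [LieAlgebra ℝ 𝔤] {Z : 𝔤} {m p : Submodule ℝ 𝔤}
variable (h : IsGraded Z m p) [FiniteDimensional ℝ 𝔤]
variable {κ κ' : Type*} (bm : Module.Basis κ ℝ m) (bp : Module.Basis κ' ℝ p)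
variable [Fintype κ] [Fintype κ']

include h in
omit [FiniteDimensional ℝ 𝔤] in
-- `Z` is in the span of the `⁅v, u⁆`, so the trace of `ad Z` on `p`, which is `dim p`, would be
-- zero. But `p = 0` makes this span, and with it `Z`, zero.
theorem false_of_trace_eq_zero
    (ht : ∀ v ∈ m, ∀ j, ∑ i, bp.coord i (h.projP ⁅⁅v, (bp j : 𝔤)⁆, (bp i : 𝔤)⁆) = 0) : False := by
  classical
  have h1 : ∀ y ∈ Submodule.span ℝ {y : 𝔤 | ∃ v ∈ m, ∃ u ∈ p, y = ⁅v, u⁆},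
      ∑ i, bp.coord i (h.projP ⁅y, (bp i : 𝔤)⁆) = 0 := fun y hy => by
    induction hy using Submodule.span_induction with
    | mem y hy =>
      obtain ⟨v, hv, u, hu, rfl⟩ := hy
      have h2 : u = ∑ i, bp.repr ⟨u, hu⟩ i • (bp i : 𝔤) := (coe_sum_repr bp ⟨u, hu⟩).symm
      rw [h2]
      simp only [lie_sum, lie_smul, sum_lie, smul_lie, map_sum, map_smul]
      rw [Finset.sum_comm]
      refine Finset.sum_eq_zero fun j _ => ?_
      rw [← Finset.smul_sum, ht v hv, smul_zero]
    | zero => simp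
    | add x y _ _ hx hy => simp only [add_lie, map_add, Finset.sum_add_distrib, hx, hy, add_zero]
    | smul c x _ hx => simp only [smul_lie, map_smul, ← Finset.smul_sum, hx, smul_zero]
  have h2 := h1 Z (h.mem_span_lie (lie_self Z))
  have h3 : ∀ i, bp.coord i (h.projP ⁅Z, (bp i : 𝔤)⁆) = 1 := fun i => by
    rw [(h.mem_p _).1 (bp i).2, show h.projP (bp i : 𝔤) = bp i from Subtype.ext (h.projP_p (bp i).2)]
    simp
  simp only [h3, Finset.sum_const, Finset.card_univ, nsmul_eq_mul, mul_one, Nat.cast_eq_zero] at h2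
  have := Fintype.card_eq_zero_iff.1 h2
  have hp : ∀ u ∈ p, u = 0 := fun u hu => by
    simpa using (coe_sum_repr bp ⟨u, hu⟩).symm
  refine h.ne_zero ?_
  have h4 := h.mem_span_lie (lie_self Z)
  rwa [Submodule.span_eq_bot.2, Submodule.mem_bot] at h4
  rintro _ ⟨v, -, u, hu, rfl⟩
  rw [hp u hu, lie_zero]

omit [FiniteDimensional ℝ 𝔤] in
theorem sum_coordMP_vec {x : 𝔤} (hx : x ∈ m ∨ x ∈ p) :
    ∑ i, h.coordMP bm bp i x • (vecM bm i + vecP bp i) = x := by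
  simp only [smul_add, Finset.sum_add_distrib]
  rw [sum_coordMP_vecM, sum_coordMP_vecP]
  rcases hx with hx | hx
  · rw [h.projM_m hx, h.projP_m hx, ZeroMemClass.coe_zero, add_zero]
  · rw [h.projM_p hx, h.projP_p hx, ZeroMemClass.coe_zero, zero_add]

include h in
omit [FiniteDimensional ℝ 𝔤] [Fintype κ] [Fintype κ'] in
theorem lie_vec (j : κ ⊕ κ') : ⁅Z, vecM bm j + vecP bp j⁆ =
    (Sum.elim (fun _ => -1) (fun _ => 1) j : ℝ) • (vecM bm j + vecP bp j) := by
  rcases j with j | j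
  · simp [vecM, vecP, (h.mem_m _).1 (bm j).2]
  · simp [vecM, vecP, (h.mem_p _).1 (bp j).2]

/-- A symmetric bilinear form on `m ⊕ p` that is invariant under the weight-zero elements is a
multiple of the Killing form. -/
theorem exists_eq_mul_killing_vec {b : κ ⊕ κ' → κ ⊕ κ' → ℝ} (hb : ∀ j k, b j k = b k j)
    (hinv : ∀ T : 𝔤, ⁅Z, T⁆ = 0 → ∀ j k,
      ∑ i, h.coordMP bm bp i ⁅T, vecM bm j + vecP bp j⁆ * b k i +
        ∑ i, h.coordMP bm bp i ⁅T, vecM bm k + vecP bp k⁆ * b j i = 0) :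
    ∃ γ : ℝ, ∀ j k, b j k =
      γ * killingForm ℝ 𝔤 (vecM bm j + vecP bp j) (vecM bm k + vecP bp k) := by
  classical
  let β : LinearMap.BilinForm ℝ 𝔤 :=
    ∑ j, ∑ k, b j k • (h.coordMP bm bp j).smulRight (h.coordMP bm bp k)
  have hβ0 : ∀ x y, β x y = ∑ j, ∑ k, b j k * (h.coordMP bm bp j x * h.coordMP bm bp k y) :=
    fun x y => by
    simp only [β, LinearMap.sum_apply, LinearMap.smul_apply, LinearMap.smulRight_apply, smul_eq_mul]
  have hβ : ∀ j y, β (vecM bm j + vecP bp j) y = ∑ k, h.coordMP bm bp k y * b j k := fun j y => by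
    simp only [hβ0, coordMP_vec, ite_mul, one_mul, zero_mul, mul_ite, mul_zero]
    rw [Finset.sum_comm]
    refine Finset.sum_congr rfl fun k _ => ?_
    rw [Finset.sum_ite_eq' Finset.univ j, if_pos (Finset.mem_univ j), mul_comm]
  have hβb : ∀ j k, β (vecM bm j + vecP bp j) (vecM bm k + vecP bp k) = b j k := fun j k => by
    simp only [hβ, coordMP_vec, ite_mul, one_mul, zero_mul]
    rw [Finset.sum_ite_eq' Finset.univ k, if_pos (Finset.mem_univ k)]
  have hβs : ∀ x y, β x y = β y x := fun x y => by
    rw [hβ0, hβ0, Finset.sum_comm]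
    refine Finset.sum_congr rfl fun j _ => Finset.sum_congr rfl fun k _ => ?_
    rw [hb, mul_comm (h.coordMP bm bp k x)]
  have hβe : ∀ T : 𝔤, ⁅Z, T⁆ = 0 → ∀ j k, β ⁅T, vecM bm j + vecP bp j⁆ (vecM bm k + vecP bp k) +
      β (vecM bm j + vecP bp j) ⁅T, vecM bm k + vecP bp k⁆ = 0 := fun T hT j k => by
    rw [hβs, hβ, hβ]
    exact hinv T hT j k
  have hβT : ∀ T : 𝔤, ⁅Z, T⁆ = 0 → ∀ v ∈ m, ∀ u ∈ p, β ⁅T, v⁆ u + β v ⁅T, u⁆ = 0 :=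
    fun T hT v hv u hu => by
    let γ : LinearMap.BilinForm ℝ 𝔤 := β ∘ₗ LieAlgebra.ad ℝ 𝔤 T + β.compl₂ (LieAlgebra.ad ℝ 𝔤 T)
    have hγ : ∀ j k, γ (vecM bm j + vecP bp j) (vecM bm k + vecP bp k) = 0 := hβe T hT
    change γ v u = 0
    rw [← h.sum_coordMP_vec bm bp (Or.inl hv), ← h.sum_coordMP_vec bm bp (Or.inr hu)]
    simp only [map_sum, map_smul, LinearMap.sum_apply, LinearMap.smul_apply, hγ, smul_zero,
      Finset.sum_const_zero]
  obtain ⟨γ, hγ⟩ := h.exists_eq_mul_killing β hβT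
  -- Invariance under `Z` itself kills the `m × m` and `p × p` blocks, where the Killing form
  -- vanishes too.
  have hZ : ∀ j k, (Sum.elim (fun _ => -1) (fun _ => 1) j +
      Sum.elim (fun _ => -1) (fun _ => 1) k : ℝ) ≠ 0 → b j k =
      γ * killingForm ℝ 𝔤 (vecM bm j + vecP bp j) (vecM bm k + vecP bp k) := fun j k hjk => by
    have h1 := hβe Z (lie_self Z) j k
    rw [h.lie_vec, h.lie_vec, map_smul, map_smul, LinearMap.smul_apply, smul_eq_mul, smul_eq_mul,
      ← add_mul, hβb] at h1
    rw [killing_eq_zero (h.lie_vec bm bp j) (h.lie_vec bm bp k) hjk, mul_zero]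
    exact (mul_eq_zero.1 h1).resolve_left hjk
  refine ⟨γ, fun j k => ?_⟩
  rcases j with j | j <;> rcases k with k | k
  · exact hZ _ _ (by norm_num)
  · rw [← hβb]
    simpa [vecM, vecP] using hγ _ (bm j).2 _ (bp k).2
  · rw [← hβb, hβs, LieModule.traceForm_comm]
    simpa [vecM, vecP] using hγ _ (bm k).2 _ (bp j).2
  · exact hZ _ _ (by norm_num)

/-- The determinant of `bergman ξ η` is a power of an irreducible polynomial. -/
theorem exists_det_bergman_eq_pow :
    ∃ (P : MvPolynomial (κ ⊕ κ') ℝ) (k : ℕ), Irreducible P ∧ 0 < k ∧ ∀ (ξ : m) (η : p),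
      LinearMap.det (h.bergman ξ η) = eval (Sum.elim (bm.repr ξ) (bp.repr η)) P ^ k := by
  classical
  obtain ⟨M, hM⟩ := h.exists_matrix bm bp
  have hD : ∀ c, eval c M.det =
      LinearMap.det (h.bergman (∑ i, c i • vecM bm i) (∑ i, c i • vecP bp i)) := fun c => by
    rw [← LinearMap.det_toMatrix bp, RingHom.map_det]
    congr 1
    ext i j
    rw [LinearMap.toMatrix_apply, RingHom.mapMatrix_apply, Matrix.map_apply, hM]
    rfl
  have hD0 : constantCoeff M.det = 1 := by
    rw [← eval_zero, hD]
    have : h.bergman (∑ i : κ ⊕ κ', (0 : κ ⊕ κ' → ℝ) i • vecM bm i)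
        (∑ i : κ ⊕ κ', (0 : κ ⊕ κ' → ℝ) i • vecP bp i) = LinearMap.id := by
      ext w
      rw [bergman_apply, adExp_of_lie_eq_zero (by simp), adExp_of_lie_eq_zero (by simp),
        h.projP_p w.2]
      rfl
    rw [this, LinearMap.det_id]
  have hDL : ∀ k, M.det ∣ h.frame bm bp k M.det := fun k => by
    obtain ⟨t, ht, -⟩ := h.derivation_det_frame bm bp hM k
    exact ⟨t, ht⟩
  have hDu : ¬ IsUnit M.det := fun hu => by
    refine h.false_of_trace_eq_zero bp fun v hv j => ?_
    obtain ⟨t, ht, ht'⟩ := h.derivation_det_frame bm bp hM (Sum.inr j)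
    obtain ⟨r, -, hr⟩ := isUnit_iff_eq_C_of_isReduced.1 hu
    have h1 : t = 0 := by
      rw [hr, derivation_C, ← hr] at ht
      exact (mul_eq_zero.1 ht.symm).resolve_left hu.ne_zero
    -- At `ξ = v`, `η = 0` the logarithmic derivative is the trace of `ad ⁅v, bp j⁆` on `p`.
    have h2 := ht' (Sum.elim (bm.repr ⟨v, hv⟩) (bp.repr 0))
    rw [sum_elim_vecM, h1, map_zero] at h2
    simpa [vecM, vecP] using h2.symm
  obtain ⟨P, k, hP, hk, hPk⟩ := exists_eq_pow_irreducible (D := M.det) (L := h.frame bm bp)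
    (T := fun s : {T : 𝔤 // ⁅Z, T⁆ = 0} => mkDerivation ℝ
      (fun i => ∑ j, C (h.coordMP bm bp i ⁅s.1, vecM bm j + vecP bp j⁆) * X j))
    (A := fun s i j => h.coordMP bm bp i ⁅s.1, vecM bm j + vecP bp j⁆)
    (b₀ := fun j k => killingForm ℝ 𝔤 (vecM bm j + vecP bp j) (vecM bm k + vecP bp k))
    (h.totalDegree_frame_le bm bp)
    (fun k i => by
      rw [← eval_zero, eval_frame]
      simpa using h.coordMP_vec bm bp i k)
    (fun s i => mkDerivation_X _ _ _)
    (fun a ha => by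
      funext j
      have h1 := ha ⟨Z, lie_self Z⟩ j
      simp only [h.lie_vec, map_smul, coordMP_vec, smul_eq_mul, mul_ite, mul_one, mul_zero, ite_mul,
        zero_mul] at h1
      rw [Finset.sum_ite_eq' Finset.univ j, if_pos (Finset.mem_univ j)] at h1
      refine (mul_eq_zero.1 h1).resolve_left ?_
      rcases j with j | j <;> simp)
    (fun b hb hinv => h.exists_eq_mul_killing_vec bm bp hb fun T hT => hinv ⟨T, hT⟩)
    hD0 hDL (fun s => h.derivation_det_linear bm bp hM s.2) hDu
  refine ⟨P, k, hP, hk, fun ξ η => ?_⟩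
  rw [← map_pow, ← hPk, hD, sum_elim_vecM, sum_elim_vecP]

end IsGraded

end ParaHermitian

/-! ### The differential of an involutive automorphism -/

namespace ParaHermitian

section Automorphism

variable {d : ℕ} {G : Type*} [TopologicalSpace G] [ChartedSpace (EuclideanSpace ℝ (Fin d)) G]
  [Group G] [LieGroup (𝓡 d) ∞ G] {σ : G ≃* G}

omit [LieGroup (𝓡 d) ∞ G] in
theorem mfderiv_involution_comp (hσ : ContMDiff (𝓡 d) (𝓡 d) ∞ σ) (h2 : ∀ g, σ (σ g) = g)
    (x y : G) (hy : y = σ x) :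
    ∀ v, (mfderiv (𝓡 d) (𝓡 d) σ y : _ → EuclideanSpace ℝ (Fin d))
      ((mfderiv (𝓡 d) (𝓡 d) σ x : _ → EuclideanSpace ℝ (Fin d)) v) = v := by
  intro v
  have hd : ∀ x, MDifferentiableAt (𝓡 d) (𝓡 d) σ x := fun x => hσ.mdifferentiableAt (by simp)
  have := mfderiv_comp_apply_of_eq (I := 𝓡 d) (I' := 𝓡 d) (I'' := 𝓡 d) (x := x) (y := y)
    (hd y) (hd x) hy.symm v
  have e : (σ : G → G) ∘ σ = id := funext h2
  rw [e, mfderiv_id] at this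
  exact this.symm

omit [LieGroup (𝓡 d) ∞ G] in
theorem mfderiv_involution_isInvertible (hσ : ContMDiff (𝓡 d) (𝓡 d) ∞ σ) (h2 : ∀ g, σ (σ g) = g)
    (x : G) : (mfderiv (𝓡 d) (𝓡 d) σ x).IsInvertible := by
  refine ContinuousLinearMap.IsInvertible.of_inverse
    (g := (mfderiv (𝓡 d) (𝓡 d) σ (σ x) :
      EuclideanSpace ℝ (Fin d) →L[ℝ] EuclideanSpace ℝ (Fin d))) ?_ ?_
  · ext1 v
    exact mfderiv_involution_comp hσ h2 (σ x) x (h2 x).symm v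
  · ext1 v
    exact mfderiv_involution_comp hσ h2 x (σ x) rfl v

omit [LieGroup (𝓡 d) ∞ G] in
theorem diffOne_diffOne (hσ : ContMDiff (𝓡 d) (𝓡 d) ∞ σ) (h2 : ∀ g, σ (σ g) = g)
    (X : GroupLieAlgebra (𝓡 d) G) : diffOne σ (diffOne σ X) = X :=
  mfderiv_involution_comp hσ h2 1 1 (map_one σ).symm X

theorem diffOne_lie (hσ : ContMDiff (𝓡 d) (𝓡 d) ∞ σ) (h2 : ∀ g, σ (σ g) = g)
    (X Y : GroupLieAlgebra (𝓡 d) G) : diffOne σ ⁅X, Y⁆ = ⁅diffOne σ X, diffOne σ Y⁆ := by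
  have hp : ∀ X : GroupLieAlgebra (𝓡 d) G, VectorField.mpullback (𝓡 d) (𝓡 d) σ
      (mulInvariantVectorField (diffOne σ X)) = mulInvariantVectorField X := fun X => by
    funext x
    exact (mfderiv_involution_isInvertible hσ h2 x).inverse_apply_eq.2
      (mfderiv_hom_mulInvariantVectorField σ.toMonoidHom hσ x X).symm
  have h := VectorField.mpullback_mlieBracket (I := 𝓡 d) (I' := 𝓡 d) (n := ∞) (x₀ := (1 : G))
    (f := σ)
    (V := mulInvariantVectorField (diffOne σ X)) (W := mulInvariantVectorField (diffOne σ Y))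
    (mdifferentiableAt_mulInvariantVectorField _) (mdifferentiableAt_mulInvariantVectorField _)
    hσ.contMDiffAt
    (by rw [minSmoothness_of_isRCLikeNormedField]; exact WithTop.coe_le_coe.2 le_top)
  rw [hp, hp] at h
  have h' := (mfderiv_involution_isInvertible hσ h2 (1 : G)).inverse_apply_eq.1 h
  have e : ∀ z : G, z = 1 → (VectorField.mlieBracket (𝓡 d) (mulInvariantVectorField (diffOne σ X))
      (mulInvariantVectorField (diffOne σ Y)) z : EuclideanSpace ℝ (Fin d)) =
      (⁅diffOne σ X, diffOne σ Y⁆ : GroupLieAlgebra (𝓡 d) G) := by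
    rintro z rfl; rfl
  exact h'.symm.trans (e _ (map_one σ))

end Automorphism

/-! ### The grading of a para-Hermitian space and covariant functions -/

namespace ParaHermitianSpace

variable {d : ℕ} {G : Type*} [TopologicalSpace G] [ChartedSpace (EuclideanSpace ℝ (Fin d)) G]
  [Group G] [LieGroup (𝓡 d) ∞ G] (S : ParaHermitianSpace d G)

theorem diffOne_Z₀ : diffOne S.σ S.Z₀ = S.Z₀ := by
  have h := ((S.center_eq S.Z₀).2 ⟨1, (one_smul ℝ _).symm⟩).1
  rw [Module.End.mem_eigenspace_iff, one_smul] at h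
  exact h

theorem lie_Z₀_of_fixed {Y : GroupLieAlgebra (𝓡 d) G} (hY : diffOne S.σ Y = Y) :
    ⁅S.Z₀, Y⁆ = 0 := by
  refine ((S.center_eq S.Z₀).2 ⟨1, (one_smul ℝ _).symm⟩).2 Y ?_
  rw [Module.End.mem_eigenspace_iff, one_smul]
  exact hY

/-- `X + dσ X` is fixed by `dσ`, hence commutes with `Z₀`, so `dσ ⁅Z₀, X⁆ = ⁅Z₀, dσ X⁆ = -⁅Z₀, X⁆`.
-/
theorem lie_Z₀_mem_q (X : GroupLieAlgebra (𝓡 d) G) : ⁅S.Z₀, X⁆ ∈ S.q := by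
  refine Module.End.mem_eigenspace_iff.2 ?_
  have h1 := diffOne_lie S.smooth_σ S.involutive_σ S.Z₀ X
  rw [S.diffOne_Z₀] at h1
  have h2 : ⁅S.Z₀, X + diffOne S.σ X⁆ = 0 := S.lie_Z₀_of_fixed (by
    rw [map_add, diffOne_diffOne S.smooth_σ S.involutive_σ, add_comm])
  rw [lie_add] at h2
  rw [h1, neg_one_smul]
  exact (neg_eq_of_add_eq_zero_right h2).symm

/-- `W - dσ W` lies in `𝔮` and is killed by `ad Z₀`, whose square is the identity there. -/
theorem diffOne_eq_of_lie_Z₀ {W : GroupLieAlgebra (𝓡 d) G} (hW : ⁅S.Z₀, W⁆ = 0) :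
    diffOne S.σ W = W := by
  have h1 := diffOne_lie S.smooth_σ S.involutive_σ S.Z₀ W
  rw [S.diffOne_Z₀, hW, map_zero] at h1
  have h2 := S.sq_eq_one (W - diffOne S.σ W) (Module.End.mem_eigenspace_iff.2 (by
    rw [map_sub, diffOne_diffOne S.smooth_σ S.involutive_σ, neg_one_smul, neg_sub]))
  rw [lie_sub, hW, ← h1, sub_zero, lie_zero] at h2
  exact (sub_eq_zero.1 h2.symm).symm

/-- The Lie algebra of a para-Hermitian space is graded by `Z₀`. -/
theorem isGraded : IsGraded S.Z₀ S.qMinus S.qPlus where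
  simple := S.simple
  mem_m X := by
    constructor
    · rintro ⟨-, hX⟩
      rw [SetLike.mem_coe, Module.End.mem_eigenspace_iff, LieAlgebra.ad_apply, neg_one_smul] at hX
      exact hX
    · intro hX
      refine ⟨?_, ?_⟩
      · rw [← neg_neg X, ← hX]
        exact S.q.neg_mem (S.lie_Z₀_mem_q X)
      · rw [SetLike.mem_coe, Module.End.mem_eigenspace_iff, LieAlgebra.ad_apply, neg_one_smul, hX]
  mem_p X := by
    constructor
    · rintro ⟨-, hX⟩
      rw [SetLike.mem_coe, Module.End.mem_eigenspace_iff, LieAlgebra.ad_apply, one_smul] at hX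
      exact hX
    · intro hX
      refine ⟨?_, ?_⟩
      · rw [← hX]
        exact S.lie_Z₀_mem_q X
      · rw [SetLike.mem_coe, Module.End.mem_eigenspace_iff, LieAlgebra.ad_apply, one_smul, hX]
  cube X := S.sq_eq_one _ (S.lie_Z₀_mem_q X)
  center W hW hWc := by
    refine (S.center_eq W).1 ⟨?_, fun Y hY => hWc Y (S.lie_Z₀_of_fixed ?_)⟩
    · rw [Module.End.mem_eigenspace_iff, one_smul]
      exact S.diffOne_eq_of_lie_Z₀ hW
    · rw [Module.End.mem_eigenspace_iff, one_smul] at hY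
      exact hY
  -- The stabilizer of `0` is all of `G`, which would make `σ` trivial.
  ne_zero h0 := by
    obtain ⟨g, hg⟩ := S.σ_ne_one
    obtain ⟨U, -, hU⟩ := S.isOpen_H
    exact hg ((hU g).1 ((S.mem_H_iff g).2 (by rw [h0, map_zero]))).2

theorem Ad_mem_qMinus (h : S.H) {X : GroupLieAlgebra (𝓡 d) G} (hX : X ∈ S.qMinus) :
    Ad (h : G) X ∈ S.qMinus := by
  rw [S.isGraded.mem_m] at hX ⊢
  conv_lhs => rw [← (S.mem_H_iff h).1 h.2]
  rw [← Ad_lie, hX, map_neg]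

/-! ### The character `b` -/

theorem restrict_Ad_mul (h₁ h₂ : S.H) :
    (Ad ((h₁ * h₂ : S.H) : G)).restrict (S.Ad_mem_qPlus (h₁ * h₂)) =
      (Ad (h₁ : G)).restrict (S.Ad_mem_qPlus h₁) ∘ₗ
        (Ad (h₂ : G)).restrict (S.Ad_mem_qPlus h₂) := by
  ext X
  exact Ad_mul (h₁ : G) h₂ (X : GroupLieAlgebra (𝓡 d) G)

theorem b_mul (h₁ h₂ : S.H) : S.b (h₁ * h₂) = S.b h₁ * S.b h₂ := by
  rw [b, restrict_Ad_mul, LinearMap.det_comp]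
  rfl

theorem b_one : S.b 1 = 1 := by
  have e : (Ad ((1 : S.H) : G)).restrict (S.Ad_mem_qPlus 1) = LinearMap.id := by
    ext X
    exact Ad_one (X : GroupLieAlgebra (𝓡 d) G)
  rw [b, e, LinearMap.det_id]

theorem b_inv_mul (h : S.H) : S.b h⁻¹ * S.b h = 1 := by
  rw [← b_mul, inv_mul_cancel, b_one]

theorem b_ne_zero (h : S.H) : S.b h ≠ 0 := fun h0 => by
  simpa [h0] using S.b_inv_mul h

theorem projP_Ad (h : S.H) (X : GroupLieAlgebra (𝓡 d) G) :
    (S.isGraded.projP (Ad (h : G) X) : GroupLieAlgebra (𝓡 d) G) = Ad (h : G) (S.isGraded.projP X) := by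
  have h1 : ∀ Y, ⁅S.Z₀, Ad (h : G) Y⁆ = Ad (h : G) ⁅S.Z₀, Y⁆ := fun Y => by
    rw [Ad_lie, (S.mem_H_iff h).1 h.2]
  rw [IsGraded.coe_projP, IsGraded.coe_projP, h1, h1, map_smul, map_add]

variable [T2Space G]

theorem Ad_expPlus (η : S.qPlus) (X : GroupLieAlgebra (𝓡 d) G) :
    Ad (S.expPlus η) X = adExp (η : GroupLieAlgebra (𝓡 d) G) X :=
  Ad_lieExp_of_lie_lie_lie_eq_zero (S.isGraded.lie_p_p_p η.2 η.2 η.2 X)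

theorem Ad_expMinus (ξ : S.qMinus) (X : GroupLieAlgebra (𝓡 d) G) :
    Ad (S.expMinus ξ) X = adExp (ξ : GroupLieAlgebra (𝓡 d) G) X :=
  Ad_lieExp_of_lie_lie_lie_eq_zero (S.isGraded.lie_m_m_m ξ.2 ξ.2 ξ.2 X)

theorem expPlus_add (η η' : S.qPlus) : S.expPlus (η + η') = S.expPlus η * S.expPlus η' :=
  lieExp_add_of_lie_eq_zero (S.isGraded.lie_p_p η.2 η'.2)

theorem expMinus_add (ξ ξ' : S.qMinus) : S.expMinus (ξ + ξ') = S.expMinus ξ * S.expMinus ξ' :=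
  lieExp_add_of_lie_eq_zero (S.isGraded.lie_m_m ξ.2 ξ'.2)

theorem expPlus_neg (η : S.qPlus) : S.expPlus (-η) = (S.expPlus η)⁻¹ := lieExp_neg _

theorem expMinus_neg (ξ : S.qMinus) : S.expMinus (-ξ) = (S.expMinus ξ)⁻¹ := lieExp_neg _

theorem expPlus_Ad (h : S.H) (η : S.qPlus) :
    S.expPlus ⟨Ad (h : G) η, S.Ad_mem_qPlus h η η.2⟩ = h * S.expPlus η * (h : G)⁻¹ :=
  (conj_lieExp (h : G) (η : GroupLieAlgebra (𝓡 d) G)).symm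

theorem expMinus_Ad (h : S.H) (ξ : S.qMinus) :
    S.expMinus ⟨Ad (h : G) ξ, S.Ad_mem_qMinus h ξ.2⟩ = h * S.expMinus ξ * (h : G)⁻¹ :=
  (conj_lieExp (h : G) (ξ : GroupLieAlgebra (𝓡 d) G)).symm

variable {S} in
-- Inversion gives `exp η exp (-ξ) = h⁻¹ exp (-X) exp Y`. On `𝔮⁺` the factor `exp Y` acts trivially
-- and `exp (-X)` adds only components of weight below one, so the weight-one component is `Ad h⁻¹`.
theorem IsRedecomp.bergman_eq {ξ : S.qMinus} {η Y : S.qPlus} {X : S.qMinus} {h : S.H}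
    (hr : S.IsRedecomp ξ η Y X h) :
    S.isGraded.bergman ξ η = (Ad ((h⁻¹ : S.H) : G)).restrict (S.Ad_mem_qPlus h⁻¹) := by
  have e : S.expPlus η * S.expMinus (-ξ) =
      ((h⁻¹ : S.H) : G) * S.expMinus (-X) * S.expPlus Y := by
    have := congrArg (·⁻¹) hr
    simpa [expPlus_neg, expMinus_neg, mul_assoc] using this
  ext w
  have h1 := congrArg (fun g : G => Ad g (w : GroupLieAlgebra (𝓡 d) G)) e
  simp only [Ad_mul, Ad_expPlus, Ad_expMinus] at h1
  rw [adExp_of_lie_eq_zero (S.isGraded.lie_p_p Y.2 w.2)] at h1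
  have h2 : (S.isGraded.projP (adExp ((-X : S.qMinus) : GroupLieAlgebra (𝓡 d) G) w) :
      GroupLieAlgebra (𝓡 d) G) = w := by
    have hX := (-X).2
    rw [adExp_apply, map_add, map_add, map_smul, S.isGraded.projP_lie_m hX,
      S.isGraded.projP_lie_m hX, smul_zero, add_zero, add_zero, S.isGraded.projP_p w.2]
  have h3 := congrArg (fun x => (S.isGraded.projP x : GroupLieAlgebra (𝓡 d) G)) h1
  simp only [projP_Ad, h2] at h3
  exact h3

/-- The polynomial `N` and the genus exist. -/
theorem exists_isNormPair : ∃ p : S.Poly × ℕ, S.IsNormPair p.1 p.2 := by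
  obtain ⟨P, k, hP, hk, h⟩ := S.isGraded.exists_det_bergman_eq_pow
    (Module.finBasis ℝ S.qMinus) (Module.finBasis ℝ S.qPlus)
  refine ⟨(P, k), hP, hk, fun ξ η Y X h' hr => ?_⟩
  rw [evalAt, ← h ξ η, hr.bergman_eq]
  exact (inv_eq_of_mul_eq_one_right (S.b_inv_mul h')).symm

theorem isNormPair_normPair : S.IsNormPair S.normPair.1 S.normPair.2 := by
  rw [normPair, dif_pos S.exists_isNormPair]
  exact S.exists_isNormPair.choose_spec

/-! ### The characters `ω_λ` and the functions `Φ_λ` -/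

omit [T2Space G] in
theorem omega_mul (lam : ℂ) (h₁ h₂ : S.H) :
    S.omega lam (h₁ * h₂) = S.omega lam h₁ * S.omega lam h₂ := by
  rw [omega, b_mul, abs_mul, Complex.ofReal_mul,
    Complex.mul_cpow_ofReal_nonneg (abs_nonneg _) (abs_nonneg _)]
  rfl

omit [T2Space G] in
theorem omega_ne_zero (lam : ℂ) (h : S.H) : S.omega lam h ≠ 0 := by
  refine fun h0 => S.b_ne_zero h ?_
  have := (Complex.cpow_eq_zero_iff _ _).1 h0
  simpa using this.1

omit [T2Space G] in
theorem omega_inv (lam : ℂ) (h : S.H) : S.omega lam h⁻¹ = (S.omega lam h)⁻¹ := by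
  refine eq_inv_of_mul_eq_one_left ?_
  rw [← omega_mul, inv_mul_cancel, omega, b_one, abs_one, Complex.ofReal_one, Complex.one_cpow]

variable {S} in
theorem IsRedecomp.N_ne_zero {ξ : S.qMinus} {η Y : S.qPlus} {X : S.qMinus} {h : S.H}
    (hr : S.IsRedecomp ξ η Y X h) : S.N ξ η ≠ 0 := fun h0 => by
  obtain ⟨-, hk, hN⟩ := S.isNormPair_normPair
  refine S.b_ne_zero h ?_
  rw [hN _ _ _ _ _ hr, ← N, h0, zero_pow hk.ne', inv_zero]

variable {S} in
-- This is `|b(h)| = |N| ^ (-ϰ)` raised to the power `-λ/ϰ`; both bases are positive and `ϰ ≠ 0`, so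
-- real logarithms suffice.
theorem IsRedecomp.Phi_eq_omega {ξ : S.qMinus} {η Y : S.qPlus} {X : S.qMinus} {h : S.H}
    (hr : S.IsRedecomp ξ η Y X h) (lam : ℂ) : S.Phi lam ξ η = S.omega lam h := by
  obtain ⟨-, hk, hN⟩ := S.isNormPair_normPair
  have h1 : |S.b h| = (|S.N ξ η| ^ S.genus)⁻¹ := by
    rw [hN _ _ _ _ _ hr, abs_inv, abs_pow]
    rfl
  have h2 : |S.N ξ η| ≠ 0 := abs_ne_zero.2 hr.N_ne_zero
  have hk' : (S.genus : ℂ) ≠ 0 := Nat.cast_ne_zero.2 hk.ne'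
  rw [Phi, omega, Complex.cpow_def_of_ne_zero (Complex.ofReal_ne_zero.2 h2),
    Complex.cpow_def_of_ne_zero (Complex.ofReal_ne_zero.2 (abs_ne_zero.2 (S.b_ne_zero h))),
    ← Complex.ofReal_log (abs_nonneg _), ← Complex.ofReal_log (abs_nonneg _), h1, Real.log_inv,
    Real.log_pow]
  congr 1
  push_cast
  field_simp

/-! ### Covariant functions -/

/-- The covariance of the functions in `inducedSpace`. -/
def IsCovariant (lam : ℂ) (F : G × G → ℂ) : Prop :=
  ∀ (z : S.qMinus) (n : S.qPlus) (h₁ h₂ : S.H) (s₁ s₂ : G),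
    F (S.expMinus z * h₁ * s₁, h₂ * S.expPlus n * s₂) = S.omega lam (h₁⁻¹ * h₂) * F (s₁, s₂)

/-- `Q⁻` absorbs `z`, the factor `h₂` moves to the left through `Q⁻ Q⁺`, and `Q⁺` absorbs `n`. -/
theorem doubleCoset_eq (z : S.qMinus) (n : S.qPlus) (h₁ h₂ : S.H) (s₁ s₂ : G) :
    S.doubleCoset (S.expMinus z * h₁ * s₁) (h₂ * S.expPlus n * s₂) =
      S.doubleCoset (((h₁⁻¹ * h₂ : S.H) : G)⁻¹ * s₁) s₂ := by
  have key : ∀ ξ η, (S.expMinus z * h₁ * s₁)⁻¹ *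
      S.expMinus (z + ⟨Ad (h₂ : G) (ξ : S.qMinus), S.Ad_mem_qMinus h₂ ξ.2⟩) *
      S.expPlus ⟨Ad (h₂ : G) (η + -n : S.qPlus), S.Ad_mem_qPlus h₂ _ (η + -n).2⟩ *
      (h₂ * S.expPlus n * s₂) =
      (((h₁⁻¹ * h₂ : S.H) : G)⁻¹ * s₁)⁻¹ * S.expMinus ξ * S.expPlus η * s₂ := fun ξ η => by
    rw [expMinus_add, expMinus_Ad, expPlus_Ad, expPlus_add, expPlus_neg, Subgroup.coe_mul,
      Subgroup.coe_inv]
    group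
  have hinv : ∀ X : GroupLieAlgebra (𝓡 d) G, Ad (h₂ : G) (Ad ((h₂⁻¹ : S.H) : G) X) = X := fun X => by
    rw [← Ad_mul, Subgroup.coe_inv, mul_inv_cancel, Ad_one]
  ext u
  constructor
  · rintro ⟨ξ, η, rfl⟩
    refine ⟨⟨_, S.Ad_mem_qMinus h₂⁻¹ (ξ - z).2⟩, ⟨_, S.Ad_mem_qPlus h₂⁻¹ _ η.2⟩ + n, ?_⟩
    rw [← key]
    simp only [hinv, add_neg_cancel_right, Subtype.coe_eta, add_sub_cancel]
  · rintro ⟨ξ, η, rfl⟩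
    exact ⟨_, _, (key ξ η).symm⟩

theorem isCovariant_coneSpace {lam : ℂ} (f : S.coneSpace lam) :
    S.IsCovariant lam fun s => f.1 (S.pt s.1 s.2) := fun z n h₁ h₂ s₁ s₂ => by
  have e : S.pt (S.expMinus z * h₁ * s₁) (h₂ * S.expPlus n * s₂) =
      S.pt (((h₁⁻¹ * h₂ : S.H) : G)⁻¹ * s₁) s₂ := Subtype.ext (S.doubleCoset_eq z n h₁ h₂ s₁ s₂)
  simp only [e, f.2.2]

omit [T2Space G] in
theorem exists_eq_of_coset_eq {s g : G} (h : S.coset s = S.coset g) :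
    ∃ h₀ : S.H, s = h₀ * g := by
  have h1 := QuotientGroup.rightRel_apply.1 (Quotient.exact h)
  refine ⟨⟨_, S.H.inv_mem h1⟩, ?_⟩
  simp

variable {S} in
/-- A point with coordinates `(ξ, η)`, in the two forms that are adapted to `η` and to `ξ`. -/
theorem HasCoords.exists_eq {s : G} {ξ : S.qMinus} {η : S.qPlus}
    (hs : S.HasCoords (S.coset s) ξ η) :
    ∃ (h₀ h : S.H) (X : S.qMinus) (Y : S.qPlus), S.IsRedecomp ξ η Y X h ∧
      s = h₀ * S.expMinus X * h * S.expPlus η ∧ s = h₀ * S.expPlus Y * S.expMinus ξ := by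
  obtain ⟨Y, X, h, hr, hs⟩ := hs
  obtain ⟨h₀, rfl⟩ := S.exists_eq_of_coset_eq hs
  refine ⟨h₀, h, X, Y, hr, ?_, by group⟩
  have e := hr
  rw [IsRedecomp, expPlus_neg, expPlus_neg, mul_inv_eq_iff_eq_mul] at e
  rw [e]
  group

variable {S} in
-- As `H` normalizes `Q^±`, the arguments take the forms `Q⁻ H s₁` and `H Q⁺ s₂`; the common factor
-- `h₀` cancels in the character.
theorem IsCovariant.apply_mul {lam : ℂ} {F : G × G → ℂ} (hF : S.IsCovariant lam F)
    (h₀ h h₁ h₂ : S.H) (X X' : S.qMinus) (Y Y' : S.qPlus) (s₁ s₂ : G) :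
    F (h₀ * S.expMinus X * h * (S.expMinus X' * h₁ * s₁),
      h₀ * S.expPlus Y * (S.expPlus Y' * h₂ * s₂)) =
      (S.omega lam h)⁻¹ * (S.omega lam h₁)⁻¹ * S.omega lam h₂ * F (s₁, s₂) := by
  have e₁ : h₀ * S.expMinus X * h * (S.expMinus X' * h₁ * s₁) =
      S.expMinus (⟨_, S.Ad_mem_qMinus h₀ X.2⟩ + ⟨_, S.Ad_mem_qMinus (h₀ * h) X'.2⟩) *
        ((h₀ * h * h₁ : S.H) : G) * s₁ := by
    rw [expMinus_add, expMinus_Ad, expMinus_Ad]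
    simp only [Subgroup.coe_mul]
    group
  have e₂ : h₀ * S.expPlus Y * (S.expPlus Y' * h₂ * s₂) = ((h₀ * h₂ : S.H) : G) *
      S.expPlus ⟨_, S.Ad_mem_qPlus h₂⁻¹ _ (Y + Y').2⟩ * s₂ := by
    rw [expPlus_Ad, expPlus_add]
    simp only [Subgroup.coe_mul, Subgroup.coe_inv]
    group
  rw [e₁, e₂, hF, omega_mul, omega_inv, omega_mul, omega_mul, omega_mul]
  have := S.omega_ne_zero lam h₀
  field_simp

variable {S} in
theorem IsCovariant.apply_mul_eq {lam : ℂ} {F : G × G → ℂ} (hF : S.IsCovariant lam F) {g₁ g₂ : G}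
    {ξ ξ₂ : S.qMinus} {η η₁ : S.qPlus} {h₁ h₂ : S.H}
    (hξ : S.IsGauss ξ g₂ h₂ ξ₂) (hη : S.IsAntiGauss η g₁ h₁ η₁)
    {s t : G} (hs : S.HasCoords (S.coset s) ξ η) (ht : S.HasCoords (S.coset t) ξ₂ η₁) :
    F (s * g₁, s * g₂) = S.Phi lam ξ₂ η₁ / S.Phi lam ξ η * S.omega lam h₂ * S.omega lam h₁⁻¹ *
      F (t, t) := by
  obtain ⟨Y', hξ⟩ := hξ
  obtain ⟨X', hη⟩ := hη
  obtain ⟨a, h, X, Y, hr, hs₁, hs₂⟩ := hs.exists_eq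
  obtain ⟨a', h', X'', Y'', hr', ht₁, ht₂⟩ := ht.exists_eq
  -- The first argument uses the form of `s` ending in `exp η`, the second the form ending in `exp
  -- ξ`.
  have e₁ : s * g₁ = a * S.expMinus X * h * (S.expMinus X' * h₁ * S.expPlus η₁) := by
    rw [hs₁, mul_assoc _ _ g₁, hη]
  have e₂ : s * g₂ = a * S.expPlus Y * (S.expPlus Y' * h₂ * S.expMinus ξ₂) := by
    rw [hs₂, mul_assoc _ _ g₂, hξ]
  -- The same reduction for `t`, with trivial second factors, expresses `F (t, t)` through the same
  -- value of `F`.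
  have e₃ : F (t, t) = (S.omega lam h')⁻¹ * F (S.expPlus η₁, S.expMinus ξ₂) := by
    have := hF.apply_mul a' h' 1 1 X'' 0 Y'' 0 (S.expPlus η₁) (S.expMinus ξ₂)
    have h0 : S.expMinus 0 = 1 := lieExp_zero
    have h0' : S.expPlus 0 = 1 := lieExp_zero
    have h1 : S.omega lam 1 ≠ 0 := S.omega_ne_zero lam 1
    rw [h0, h0', OneMemClass.coe_one, one_mul, one_mul, one_mul, ← ht₁, ← ht₂] at this
    rw [this]
    field_simp
  rw [e₁, e₂, hF.apply_mul, e₃, hr.Phi_eq_omega, hr'.Phi_eq_omega, omega_inv]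
  have := S.omega_ne_zero lam h'
  field_simp

end ParaHermitianSpace

end ParaHermitian

theorem theorem5p1 {d : ℕ} {G : Type*} [TopologicalSpace G] [T2Space G] [ConnectedSpace G]
    [ChartedSpace (EuclideanSpace ℝ (Fin d)) G] [Group G] [LieGroup (𝓡 d) ∞ G]
    (S : ParaHermitian.ParaHermitianSpace d G) (lam : ℂ) (g₁ g₂ : G)
    -- `ξ₂ = ξ • g₂` with factor `h₂` and `η₁ = η ∘ g₁` with factor `h₁`
    (ξ ξ₂ : S.qMinus) (η η₁ : S.qPlus) (h₁ h₂ : S.H)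
    (hξ : S.IsGauss ξ g₂ h₂ ξ₂) (hη : S.IsAntiGauss η g₁ h₁ η₁)
    -- `Hs` has horospherical coordinates `(ξ, η)`, and `Ht` has coordinates `(ξ • g₂, η ∘ g₁)`
    (s t : G) (hs : S.HasCoords (S.coset s) ξ η) (ht : S.HasCoords (S.coset t) ξ₂ η₁) :
    S.Phi lam ξ η ≠ 0 ∧
    (∀ f : S.coneSpace lam,
      (S.Rtilde lam (g₁, g₂) f).1 (S.pt s s) =
        S.Phi lam ξ₂ η₁ / S.Phi lam ξ η * S.omega lam h₂ * S.omega lam h₁⁻¹ *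
          f.1 (S.pt t t)) ∧
    (∀ F : S.inducedSpace lam,
      (S.inducedRep lam (g₁, g₂) F).1 (s, s) =
        S.Phi lam ξ₂ η₁ / S.Phi lam ξ η * S.omega lam h₂ * S.omega lam h₁⁻¹ *
          F.1 (t, t)) := by
  obtain ⟨Y, X, h, hr, -⟩ := id hs
  refine ⟨?_, fun f => ?_, fun F => ?_⟩
  · rw [hr.Phi_eq_omega]
    exact S.omega_ne_zero lam h
  · have e : (S.Rtilde lam (g₁, g₂) f).1 (S.pt s s) = f.1 (S.pt (s * g₁) (s * g₂)) :=
      congrArg f.1 (S.translate_pt g₁ g₂ s s)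
    rw [e]
    exact (S.isCovariant_coneSpace f).apply_mul_eq hξ hη hs ht
  · exact (show S.IsCovariant lam F.1 from F.2.2).apply_mul_eq hξ hη hs ht
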